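/- Let $\mathcal X$ be a connected, second countable, smooth $n$-dimensional manifold with a smooth Riemannian metric $|\cdot|_x$ whose distance is complete. Let $f$ be a $C^2$ vector field on $\mathcal X$ such that every solution of $\dot x=f(x)$ is defined on all of $\mathbb R$, let $\psi_t$ be its flow, and suppose that every forward trajectory $\{\psi_t(x) : t\ge 0\}$ is bounded. Let $\omega(x)$ be the $\omega$-limit set of $x$. Let $\mathcal K(x)\subseteq T_x\mathcal X$ be a smooth cone field: each $\mathcal K(x)$ is a closed, convex, pointed cone containing $n$ linearly independent vectors; for all $x,y$ there is a linear isomorphism $T_x\mathcal X\to T_y\mathcal X$ mapping $\mathcal K(x)$ onto $\mathcal K(y)$; and locally $\mathcal K(x)=\{v : k_i(x,v)\ge 0\ \forall i\in I\}$, $I\subseteq\mathbb Z$, with $k_i$ smooth functions on the tangent bundle. Assume that $f$ is strictly differentially positive: for every $t_0$ and every solution $(x(\cdot),\delta x(\cdot))$ on $[t_0,\infty)$ of the prolonged system $\dot x=f(x)$, $\dot{\delta x}=\partial f(x)\,\delta x$ with $\delta x(t_0)\in\mathcal K(x(t_0))$, one has $\delta x(t)\in\mathcal K(x(t))$ for all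 $t\ge t_0$; and there are $T>0$ and closed, convex, pointed cones $\mathcal R(x)\subseteq\operatorname{int}\mathcal K(x)\cup\{0\}$ such that also $\delta x(t)\in\mathcal R(x(t))$ for all $t\ge t_0+T$ for every such solution, where there are linear isomorphisms $\Gamma(x,y):T_x\mathcal X\to T_y\mathcal X$ with $\Gamma(x,y)\mathcal K(x)=\mathcal K(y)$ and $\Gamma(x,y)\mathcal R(x)=\mathcal R(y)$ for all $x,y$. Assume finally that for each $x$ the set $\{v\in\mathcal K(x) : |v|_x=1\}$ is complete for the Hilbert metric of $\mathcal K(x)$, $d(v,v')=\log\big(M(v,v')/m(v,v')\big)$ with $M(v,v')=\inf\{\lambda\ge0 : \lambda v'-v\in\mathcal K(x)\}$ and $m(v,v')=\sup\{\lambda\ge0 : v-\lambda v'\in\mathcal K(x)\}$ (the value $\infty$ is allowed). Let $\mathbf w$ be the Perron-Frobenius vector field: $\mathbf w(x)\in\operatorname{int}\mathcal K(x)$ is the unit vector such that $\partial\psi_{-s}(\psi_s(x))\,\mathcal K(\psi_s(x))$ converges, in the sense of Painlevé-Kuratowski, to the ray $\{\lambda\mathbf w(x) : \lambda\ge0\}$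 as $s\to-\infty$. Suppose that $\xi\in\mathcal X$ is such that $\omega(\xi)$ does not consist of a single point and that for every $x\in\omega(\xi)$: (a) if $f(x)\ne0$, then $f(x)\neq\lambda\mathbf w(x)$ for all $\lambda\in\mathbb R$; and (b) either $\liminf_{t\to\infty}|\partial\psi_t(x)\mathbf w(x)|_{\psi_t(x)}=\infty$ or $\lim_{t\to\infty}f(\psi_t(x))=0$. Then for every $z\in\mathcal X$ with $\omega(z)\subseteq\omega(\xi)$: 1. $f(\psi_t(z))\notin\mathcal K(\psi_t(z))\setminus\{0\}$ for all $t\ge0$; 2. if $\omega(z)$ is not a singleton, then $\liminf_{t\to\infty}|\partial\psi_t(z)\mathbf w(z)|_{\psi_t(z)}=\infty$. -/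

import Mathlib

open Set Filter Topology Bundle
open scoped Manifold ContDiff ENNReal NNReal

noncomputable section

/-! ### Cones, the Hilbert metric, limits of sets -/

section Cones

/-- Closed, convex, pointed cones (they contain `0`). -/
structure IsClosedPointedCone {V : Type*} [AddCommGroup V] [Module ℝ V] [TopologicalSpace V]
    (C : Set V) : Prop where
  isClosed : IsClosed C
  add_mem : ∀ v ∈ C, ∀ w ∈ C, v + w ∈ C
  smul_mem : ∀ c : ℝ, 0 ≤ c → ∀ v ∈ C, c • v ∈ C
  pointed : C ∩ {v | -v ∈ C} = {0}

/-- `M_C(v, w) = inf {c ≥ 0 | c w - v ∈ C}`, with value `∞` if there is no such `c`. -/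
def hilbertSup {V : Type*} [AddCommGroup V] [Module ℝ V] (C : Set V) (v w : V) : ℝ≥0∞ :=
  ⨅ (c : ℝ≥0) (_ : (c : ℝ) • w - v ∈ C), (c : ℝ≥0∞)

/-- `m_C(v, w) = sup {c ≥ 0 | v - c w ∈ C}`. -/
def hilbertInf {V : Type*} [AddCommGroup V] [Module ℝ V] (C : Set V) (v w : V) : ℝ≥0∞ :=
  ⨆ (c : ℝ≥0) (_ : v - (c : ℝ) • w ∈ C), (c : ℝ≥0∞)

/-- The Hilbert (projective) metric `log (M_C / m_C)` of a cone; it may take the value `∞`. -/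
def hilbertDist {V : Type*} [AddCommGroup V] [Module ℝ V] (C : Set V) (v w : V) : EReal :=
  ENNReal.log (hilbertSup C v w / hilbertInf C v w)

/-- Completeness of the set `S` for the Hilbert metric of the cone `C`: every Cauchy sequence
in `S` converges, in the Hilbert metric, to a point of `S`. -/
def IsHilbertComplete {V : Type*} [AddCommGroup V] [Module ℝ V] (C S : Set V) : Prop :=
  ∀ u : ℕ → V, (∀ k, u k ∈ S) →
    (∀ ε : ℝ, 0 < ε → ∃ N, ∀ k ≥ N, ∀ l ≥ N, hilbertDist C (u k) (u l) < (ε : EReal)) →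
    ∃ v ∈ S, ∀ ε : ℝ, 0 < ε → ∃ N, ∀ k ≥ N, hilbertDist C (u k) v < (ε : EReal)

/-- Painlevé-Kuratowski convergence of a family of sets to the set `L` along a filter:
the inner limit and the outer limit are both equal to `L`. -/
def KuratowskiTendsto {α V : Type*} [TopologicalSpace V] (S : α → Set V) (l : Filter α)
    (L : Set V) : Prop :=
  {v | ∀ U ∈ 𝓝 v, ∀ᶠ a in l, (S a ∩ U).Nonempty} = L ∧
  {v | ∀ U ∈ 𝓝 v, ∃ᶠ a in l, (S a ∩ U).Nonempty} = L

end Cones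

/-! ### Cone fields, flows and differential positivity on an `n`-dimensional manifold -/

section Manifold

variable {n : ℕ} {X : Type*} [TopologicalSpace X] [ChartedSpace (EuclideanSpace ℝ (Fin n)) X]
  [IsManifold (𝓡 n) ∞ X]

/-- A smooth cone field: closed pointed convex cones that are solid (each contains `n` linearly
independent vectors), pairwise related by linear isomorphisms of the tangent spaces, and locally
given by inequalities `k i (x, v) ≥ 0` with smooth functions `k i`. -/
structure IsSmoothConeField (K : (x : X) → Set (TangentSpace (𝓡 n) x)) : Prop where
  cone : ∀ x, IsClosedPointedCone (K x)
  solid : ∀ x, ∃ b : Fin n → TangentSpace (𝓡 n) x, LinearIndependent ℝ b ∧ ∀ i, b i ∈ K x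
  homogeneous : ∃ Γ : (x y : X) → TangentSpace (𝓡 n) x ≃ₗ[ℝ] TangentSpace (𝓡 n) y,
    ∀ x y, Γ x y '' K x = K y
  smooth : ∀ x₀ : X, ∃ U : Set X, IsOpen U ∧ x₀ ∈ U ∧
    ∃ (ι : Set ℤ) (k : ℤ → TangentBundle (𝓡 n) X → ℝ),
      (∀ i ∈ ι, ContMDiffOn (𝓡 n).tangent 𝓘(ℝ, ℝ) ∞ (k i)
        {p : TangentBundle (𝓡 n) X | p.proj ∈ U}) ∧
      ∀ x ∈ U, ∀ v : TangentSpace (𝓡 n) x,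
        v ∈ K x ↔ ∀ i ∈ ι, 0 ≤ k i (⟨x, v⟩ : TangentBundle (𝓡 n) X)

/-- The system `ẋ = f(x)` is complete: through each point passes a solution defined on `ℝ`. -/
def IsCompleteField (f : (x : X) → TangentSpace (𝓡 n) x) : Prop :=
  ∀ x : X, ∃ γ : ℝ → X, γ 0 = x ∧ IsMIntegralCurve γ f

open Classical in
/-- The flow of a complete vector field: `flow f t x` is the value at time `t` of the solution of
`ẋ = f(x)` that starts at `x` at time `0`. (For a `C¹` field that solution is unique.) -/
def flow (f : (x : X) → TangentSpace (𝓡 n) x) (t : ℝ) (x : X) : X :=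
  if h : ∃ γ : ℝ → X, γ 0 = x ∧ IsMIntegralCurve γ f then h.choose t else x

/-- The coordinates of a tangent vector `v ∈ T_x X` in the chart of `X` around `y`. -/
def coordVec (y x : X) (v : TangentSpace (𝓡 n) x) : EuclideanSpace ℝ (Fin n) :=
  (trivializationAt (EuclideanSpace ℝ (Fin n)) (TangentSpace (𝓡 n) : X → Type _) y
    (⟨x, v⟩ : TangentBundle (𝓡 n) X)).2

/-- The vector field `f` written in the chart of `X` around `y`. -/
def coordField (f : (x : X) → TangentSpace (𝓡 n) x) (y : X) (p : EuclideanSpace ℝ (Fin n)) :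
    EuclideanSpace ℝ (Fin n) :=
  coordVec y ((extChartAt (𝓡 n) y).symm p) (f ((extChartAt (𝓡 n) y).symm p))

/-- `(x, δx)` is a solution on `[t₀, ∞)` of the prolonged system
`ẋ = f(x)`, `δẋ = ∂f(x) δx`; the second equation is read in local coordinates. -/
def IsProlongedSolution (f : (x : X) → TangentSpace (𝓡 n) x) (t₀ : ℝ) (x : ℝ → X)
    (δx : (t : ℝ) → TangentSpace (𝓡 n) (x t)) : Prop :=
  IsMIntegralCurveOn x f (Ici t₀) ∧
  ∀ t ∈ Ici t₀, ∀ y : X, x t ∈ (extChartAt (𝓡 n) y).source →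
    HasDerivWithinAt (fun s => coordVec y (x s) (δx s))
      (fderiv ℝ (coordField f y) (extChartAt (𝓡 n) y (x t)) (coordVec y (x t) (δx t)))
      (Ici t₀) t

/-- `ẋ = f(x)` is differentially positive with respect to the cone field `K`. -/
def IsDifferentiallyPositive (f : (x : X) → TangentSpace (𝓡 n) x)
    (K : (x : X) → Set (TangentSpace (𝓡 n) x)) : Prop :=
  ∀ (t₀ : ℝ) (x : ℝ → X) (δx : (t : ℝ) → TangentSpace (𝓡 n) (x t)),
    IsProlongedSolution f t₀ x δx → δx t₀ ∈ K (x t₀) → ∀ t, t₀ ≤ t → δx t ∈ K (x t)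

/-- `ẋ = f(x)` is (uniformly) strictly differentially positive with respect to `K`: after a
uniform time `T` the cones `K` are mapped into cones `R x ⊆ int (K x) ∪ {0}`, where some linear
isomorphisms of the tangent spaces transport both `K` and `R`. -/
def IsStrictlyDifferentiallyPositive (f : (x : X) → TangentSpace (𝓡 n) x)
    (K : (x : X) → Set (TangentSpace (𝓡 n) x)) : Prop :=
  IsDifferentiallyPositive f K ∧
  ∃ T : ℝ, 0 < T ∧ ∃ R : (x : X) → Set (TangentSpace (𝓡 n) x),
    (∀ x, IsClosedPointedCone (R x)) ∧
    (∀ x, R x ⊆ interior (K x) ∪ {0}) ∧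
    (∃ Γ : (x y : X) → TangentSpace (𝓡 n) x ≃ₗ[ℝ] TangentSpace (𝓡 n) y,
      ∀ x y, Γ x y '' K x = K y ∧ Γ x y '' R x = R y) ∧
    ∀ (t₀ : ℝ) (x : ℝ → X) (δx : (t : ℝ) → TangentSpace (𝓡 n) (x t)),
      IsProlongedSolution f t₀ x δx → δx t₀ ∈ K (x t₀) → ∀ t, t₀ + T ≤ t → δx t ∈ R (x t)

variable [RiemannianBundle (fun x : X => TangentSpace (𝓡 n) x)]

/-- `v` is the Perron-Frobenius vector at `x`: a unit vector in the interior of `K x` spanning the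
ray to which the images `∂ψ_{-s}(ψ_s(x)) K(ψ_s(x))` of the cones along the past of `x` converge
as `s → -∞`. -/
def IsPerronFrobeniusVector (f : (x : X) → TangentSpace (𝓡 n) x)
    (K : (x : X) → Set (TangentSpace (𝓡 n) x)) (x : X) (v : TangentSpace (𝓡 n) x) : Prop :=
  v ∈ interior (K x) ∧ ‖v‖ = 1 ∧
  KuratowskiTendsto
    (fun s : ℝ => {v' : TangentSpace (𝓡 n) x | ∃ u ∈ K (flow f s x),
      tangentMap (𝓡 n) (𝓡 n) (flow f (-s)) (⟨flow f s x, u⟩ : TangentBundle (𝓡 n) X) =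
        (⟨x, v'⟩ : TangentBundle (𝓡 n) X)})
    atBot {v' | ∃ c : ℝ, 0 ≤ c ∧ v' = c • v}

open Classical in
/-- The Perron-Frobenius vector field. -/
def perronFrobenius (f : (x : X) → TangentSpace (𝓡 n) x)
    (K : (x : X) → Set (TangentSpace (𝓡 n) x)) (x : X) : TangentSpace (𝓡 n) x :=
  if h : ∃ v, IsPerronFrobeniusVector f K x v then h.choose else 0

/-- `liminf_{t → ∞} |∂ψ_t(x) w(x)| = ∞` for the Perron-Frobenius vector field `w`. -/
def HasUnboundedPFGrowth (f : (x : X) → TangentSpace (𝓡 n) x)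
    (K : (x : X) → Set (TangentSpace (𝓡 n) x)) (x : X) : Prop :=
  liminf (fun t : ℝ => ‖mfderiv (𝓡 n) (𝓡 n) (flow f t) x (perronFrobenius f K x)‖ₑ) atTop = ⊤

/-- Case (ii) of the limit set dichotomy for the set `Ω = ω(ξ)`: at every `x ∈ Ω` the field `f` is
not aligned with the Perron-Frobenius vector field unless it vanishes, and either
`liminf |∂ψ_t(x) w(x)| = ∞` or `f(ψ_t(x)) → 0` as `t → ∞`. -/
def IsTransverseLimitSet (f : (x : X) → TangentSpace (𝓡 n) x)
    (K : (x : X) → Set (TangentSpace (𝓡 n) x)) (Ω : Set X) : Prop :=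
  ∀ x ∈ Ω, (f x ≠ 0 → ∀ c : ℝ, f x ≠ c • perronFrobenius f K x) ∧
    (HasUnboundedPFGrowth f K x ∨ Tendsto (fun t : ℝ => ‖f (flow f t x)‖) atTop (𝓝 0))

end Manifold

end

/-!
Write `ψ` for the flow, `w` for the Perron-Frobenius vector field and `G t x = |∂ψ_t(x) w(x)|` for
its growth factor, a multiplicative cocycle over the flow.

*The field `w`.* The tangent vectors at `x` whose whole past stays in the cone field form a closed
cone (`pastCone`). Strict positivity makes its nonzero vectors uniformly comparable, so it is a ray
(`IsPositiveSystem.pastCone_eq_ray`); it is the limit of the cones along the past, `w` is its unit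
vector, and `w` is continuous because the cone field has a closed total space
(`IsPositiveSystem.continuous_perronFrobenius`).

*From expansion to growth.* If over each point of the limit set of `p` the cocycle exceeds `2` at
some positive time, then `G t p → ∞` by compactness (`tendsto_atTop_of_cocycle`). In that case
`f p` is not a nonzero vector of the cone: some later `f (ψ_T p)` would dominate `a • w` with
`a > 0`, and the vectors `f (ψ_t p) - a_t • w` of the cone, divided by `G t p`, would converge along
the orbit to a negative multiple of `w` (`IsPositiveSystem.notMem_of_tendsto_pfGrowth`). Both
claims therefore follow once each point `x` of `ω(ξ)` is expanded. By assumption this holds unless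
`f (ψ_t x) → 0`; then `ω(x)` consists of equilibria in `ω(ξ)`, and it is enough to treat these.

*Equilibria.* Let `x` be an equilibrium in `ω(ξ)` at which `G` is bounded by `2`. A Perron-Frobenius
theorem with spectral gap (`exists_perronFrobenius_functional`) shows that near `x` a time-`τ` map
of the flow acts, both on tangent vectors and on differences of points in a chart, as a
perturbation of a linear map in which the direction of `w` dominates, with eigenvalue at most `1`
(`IsPositiveSystem.exists_isDominatedNhd`, `ConeStep`). As `ω(ξ) ≠ {x}`, the orbit of `ξ` comes
close to `x` and leaves again, infinitely often. Limits of its positions on the way out have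
backward orbits that stay near `x`. Hence they differ from `x` by a vector of the dominated cone,
and there `f` is parallel to `w`, since a component across `w` would grow too fast backwards. By
transversality these limits are equilibria. One of them lies halfway on the way out. Seen from it, the orbit
starts in the cone on the side of `x`, and domination keeps it on that side, so it cannot
leave: a contradiction (`IsPositiveSystem.exists_two_lt_pfGrowth`).

The tools that this needs are proved first: differentiability of the flow in the initial point and
the variational equation (`exists_local_flow_hasFDerivAt`, `continuous_tflow`), and compactness of
closed bounded sets in a complete Riemannian manifold (`properSpace_of_isRiemannianManifold`).
-/


/-! ### Differentiable dependence of solutions on initial values -/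

/-- Quadratic error bound for the linearisation of a map whose derivative is Lipschitz. -/
theorem norm_sub_sub_fderiv_le_sq {E : Type*} [NormedAddCommGroup E] [NormedSpace ℝ E]
    {g : E → E} {s : Set E} (hs : Convex ℝ s) (hso : IsOpen s)
    (hg : DifferentiableOn ℝ g s) {C : ℝ≥0} (hC : LipschitzOnWith C (fderiv ℝ g) s)
    {a b : E} (ha : a ∈ s) (hb : b ∈ s) :
    ‖g b - g a - fderiv ℝ g a (b - a)‖ ≤ C * ‖b - a‖ ^ 2 := by
  have hseg : segment ℝ a b ⊆ s := hs.segment_subset ha hb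
  have h := (convex_segment a b).norm_image_sub_le_of_norm_hasFDerivWithin_le' (f := g)
    (f' := fderiv ℝ g) (φ := fderiv ℝ g a) (C := C * ‖b - a‖)
    (fun z hz => ((hg z (hseg hz)).differentiableAt
      (hso.mem_nhds (hseg hz))).hasFDerivAt.hasFDerivWithinAt)
    (fun z hz => by
      have h1 := hC.dist_le_mul z (hseg hz) a ha
      rw [dist_eq_norm, dist_eq_norm] at h1
      refine h1.trans (mul_le_mul_of_nonneg_left ?_ C.2)
      exact norm_sub_le_of_mem_segment hz)
    (left_mem_segment ℝ a b) (right_mem_segment ℝ a b)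
  calc _ ≤ _ := h
    _ = _ := by ring

/-- A curve `z` with `z 0 = 0` and `‖z'‖ ≤ K ‖z‖ + ε` is bounded on `[-1, 1]` by a multiple
of `ε`, uniformly in `z` and `ε`. -/
theorem norm_le_mul_of_norm_deriv_le {E : Type*} [NormedAddCommGroup E] [NormedSpace ℝ E]
    {z z' : ℝ → E} {K ε τ : ℝ} (hK : 0 < K) (hε : 0 ≤ ε) (hτ : τ ≤ 1)
    (hz : ∀ t ∈ Ioo (-τ) τ, HasDerivAt z (z' t) t) (h0 : z 0 = 0)
    (hb : ∀ t ∈ Ioo (-τ) τ, ‖z' t‖ ≤ K * ‖z t‖ + ε) {t : ℝ} (ht : t ∈ Ioo (-τ) τ) :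
    ‖z t‖ ≤ ε / K * Real.exp K := by
  have key : ∀ (y y' : ℝ → E), (∀ s ∈ Ioo (-τ) τ, HasDerivAt y (y' s) s) → y 0 = 0 →
      (∀ s ∈ Ioo (-τ) τ, ‖y' s‖ ≤ K * ‖y s‖ + ε) → ∀ s ∈ Ioo (-τ) τ, 0 ≤ s →
      ‖y s‖ ≤ ε / K * Real.exp K := by
    intro y y' hy hy0 hyb s hs hs0
    have hsub : ∀ r, 0 ≤ r → r ≤ s → r ∈ Ioo (-τ) τ := fun r h0 h1 =>
      ⟨by linarith [hs.1, hs.2], lt_of_le_of_lt h1 hs.2⟩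
    have h := norm_le_gronwallBound_of_norm_deriv_right_le (f := y) (f' := y') (δ := 0) (K := K)
      (ε := ε) (a := 0) (b := s)
      (fun r hr => (hy r (hsub r hr.1 hr.2)).continuousAt.continuousWithinAt)
      (fun r hr => (hy r (hsub r hr.1 hr.2.le)).hasDerivWithinAt) (by simp [hy0])
      (fun r hr => hyb r (hsub r hr.1 hr.2.le)) s ⟨hs0, le_rfl⟩
    rw [gronwallBound_of_K_ne_0 hK.ne'] at h
    refine h.trans ?_
    simp only [zero_mul, zero_add, sub_zero]
    refine mul_le_mul_of_nonneg_left ?_ (div_nonneg hε hK.le)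
    have : Real.exp (K * s) ≤ Real.exp K := Real.exp_le_exp.2 (by nlinarith [hs.2])
    linarith
  rcases le_total 0 t with h | h
  · exact key z z' hz h0 hb t ht h
  · have h1 := key (fun s => z (-s)) (fun s => -z' (-s)) (fun s hs => by
      have := (hz (-s) ⟨by linarith [hs.2], by linarith [hs.1]⟩).scomp s (hasDerivAt_neg s)
      simpa [Function.comp_def] using this) (by simpa using h0)
      (fun s hs => by simpa using hb (-s) ⟨by linarith [hs.2], by linarith [hs.1]⟩) (-t)
      ⟨by linarith [ht.2], by linarith [ht.1]⟩ (by linarith)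
    simpa using h1

/-- The local flow `Φ` of a `C²` vector field is differentiable in the initial value; its
derivative `D` is jointly continuous and solves the variational equation. The derivative is
obtained by solving the field extended to `E × (E →L[ℝ] E)` by its variational equation. -/
theorem exists_local_flow_hasFDerivAt {E : Type*} [NormedAddCommGroup E] [NormedSpace ℝ E]
    [CompleteSpace E] {g : E → E} {Ω : Set E} (hΩ : IsOpen Ω) (hg : ContDiffOn ℝ 2 g Ω)
    {p₀ : E} (hp₀ : p₀ ∈ Ω) :
    ∃ ε > 0, ∃ U : Set E, IsOpen U ∧ p₀ ∈ U ∧ ∃ (Φ : E → ℝ → E) (D : E → ℝ → E →L[ℝ] E),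
      (∀ p ∈ U, Φ p 0 = p ∧ D p 0 = ContinuousLinearMap.id ℝ E) ∧
      (∀ p ∈ U, ∀ t ∈ Ioo (-ε) ε, Φ p t ∈ Ω ∧ HasDerivAt (Φ p) (g (Φ p t)) t ∧
        HasDerivAt (D p) ((fderiv ℝ g (Φ p t)).comp (D p t)) t ∧
        HasFDerivAt (fun q => Φ q t) (D p t) p) ∧
      ContinuousOn (fun q : E × ℝ => Φ q.1 q.2) (U ×ˢ Ioo (-ε) ε) ∧
      ContinuousOn (fun q : E × ℝ => D q.1 q.2) (U ×ˢ Ioo (-ε) ε) := by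
  have hgat : ContDiffAt ℝ 2 g p₀ := hg.contDiffAt (hΩ.mem_nhds hp₀)
  have hdg : ContDiffAt ℝ 1 (fderiv ℝ g) p₀ := hgat.fderiv_right (by norm_num)
  -- a convex ball on which `fderiv g` is bounded and Lipschitz
  obtain ⟨C, s, hs, hlip⟩ := hdg.exists_lipschitzOnWith
  obtain ⟨ρ, hρ, hρs⟩ := Metric.mem_nhds_iff.1 (inter_mem hs (hΩ.mem_nhds hp₀))
  have hlipB : LipschitzOnWith C (fderiv ℝ g) (Metric.ball p₀ ρ) :=
    hlip.mono fun x hx => (hρs hx).1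
  have hBΩ : Metric.ball p₀ ρ ⊆ Ω := fun x hx => (hρs hx).2
  have hdiff : DifferentiableOn ℝ g (Metric.ball p₀ ρ) :=
    (hg.differentiableOn (by norm_num)).mono hBΩ
  set K : ℝ := C * ρ + ‖fderiv ℝ g p₀‖ + 1 with hKdef
  have hK : 0 < K := by positivity
  have hbd : ∀ q ∈ Metric.ball p₀ ρ, ‖fderiv ℝ g q‖ ≤ K := by
    intro q hq
    have h1 := hlipB.dist_le_mul q hq p₀ (Metric.mem_ball_self hρ)
    have h2 : dist q p₀ ≤ ρ := (Metric.mem_ball.1 hq).le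
    have h3 : ‖fderiv ℝ g q‖ ≤ ‖fderiv ℝ g q - fderiv ℝ g p₀‖ + ‖fderiv ℝ g p₀‖ :=
      norm_le_norm_sub_add _ _
    rw [dist_eq_norm] at h1
    have h4 : (C : ℝ) * dist q p₀ ≤ C * ρ := mul_le_mul_of_nonneg_left h2 C.2
    linarith
  -- the extended field
  let G : E × (E →L[ℝ] E) → E × (E →L[ℝ] E) := fun q => (g q.1, (fderiv ℝ g q.1).comp q.2)
  have hG : ContDiffAt ℝ 1 G (p₀, ContinuousLinearMap.id ℝ E) := by
    refine ContDiffAt.prodMk ?_ ?_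
    · exact ContDiffAt.comp (g := g) (f := Prod.fst) (p₀, ContinuousLinearMap.id ℝ E)
        (hgat.of_le (by norm_num)) contDiffAt_fst
    · refine ContDiffAt.clm_comp (n := 1) ?_ contDiffAt_snd
      exact ContDiffAt.comp (g := fderiv ℝ g) (f := Prod.fst) (p₀, ContinuousLinearMap.id ℝ E)
        hdg contDiffAt_fst
  obtain ⟨e, he, a, r, L, K', hr, hpl⟩ := IsPicardLindelof.of_contDiffAt_one hG
  obtain ⟨α, hα, L', hL'⟩ := (hpl 0).exists_forall_mem_closedBall_eq_hasDerivWithinAt_lipschitzOnWith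
  simp only [zero_sub, zero_add] at hα hL'
  have hinit : ∀ p ∈ Metric.ball p₀ (r : ℝ),
      (p, ContinuousLinearMap.id ℝ E) ∈
        Metric.closedBall (p₀, ContinuousLinearMap.id ℝ E) (r : ℝ) := by
    intro p hp
    rw [Metric.mem_closedBall, Prod.dist_eq]
    simpa using (Metric.mem_ball.1 hp).le
  let β : E → ℝ → E × (E →L[ℝ] E) := fun p => α (p, ContinuousLinearMap.id ℝ E)
  have hβd : ∀ p ∈ Metric.ball p₀ (r : ℝ), ∀ t ∈ Ioo (-e) e, HasDerivAt (β p) (G (β p t)) t := by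
    intro p hp t ht
    exact ((hα _ (hinit p hp)).2 t (Ioo_subset_Icc_self ht)).hasDerivAt (Icc_mem_nhds ht.1 ht.2)
  have hβ0 : ∀ p ∈ Metric.ball p₀ (r : ℝ), β p 0 = (p, ContinuousLinearMap.id ℝ E) :=
    fun p hp => (hα _ (hinit p hp)).1
  have hβL : ∀ p ∈ Metric.ball p₀ (r : ℝ), ∀ q ∈ Metric.ball p₀ (r : ℝ), ∀ t ∈ Ioo (-e) e,
      dist (β p t) (β q t) ≤ L' * dist p q := by
    intro p hp q hq t ht
    have h := (hL' t (Ioo_subset_Icc_self ht)).dist_le_mul _ (hinit p hp) _ (hinit q hq)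
    have hd : dist (p, ContinuousLinearMap.id ℝ E) (q, ContinuousLinearMap.id ℝ E) = dist p q := by
      rw [Prod.dist_eq, dist_self, max_eq_left dist_nonneg]
    rwa [hd] at h
  have hβc : ContinuousOn (fun q : E × ℝ => β q.1 q.2) (Metric.ball p₀ (r : ℝ) ×ˢ Ioo (-e) e) := by
    refine continuousOn_prod_of_continuousOn_lipschitzOnWith _ L' (fun p hp t ht => ?_)
      (fun t ht => LipschitzOnWith.of_dist_le_mul fun p hp q hq => hβL p hp q hq t ht)
    exact (hβd p hp t ht).continuousAt.continuousWithinAt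
  have hr' : (0 : ℝ) < r := hr
  -- shrink the domain, so that the flow stays in the ball
  have h0mem : (p₀, (0 : ℝ)) ∈ Metric.ball p₀ (r : ℝ) ×ˢ Ioo (-e) e :=
    ⟨Metric.mem_ball_self hr', by simp [he]⟩
  have hopen : IsOpen (Metric.ball p₀ (r : ℝ) ×ˢ Ioo (-e) e) :=
    Metric.isOpen_ball.prod isOpen_Ioo
  have hnear : ∀ᶠ q : E × ℝ in 𝓝 (p₀, (0 : ℝ)), (β q.1 q.2).1 ∈ Metric.ball p₀ ρ := by
    have hc : ContinuousAt (fun q : E × ℝ => (β q.1 q.2).1) (p₀, 0) :=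
      (hβc.continuousAt (hopen.mem_nhds h0mem)).fst
    refine hc.eventually_mem (Metric.isOpen_ball.mem_nhds ?_)
    simp only [hβ0 p₀ (Metric.mem_ball_self hr')]
    exact Metric.mem_ball_self hρ
  obtain ⟨U₁, hU₁, V, hV, hUV⟩ := mem_nhds_prod_iff.1 hnear
  obtain ⟨η, hη, hηV⟩ := Metric.mem_nhds_iff.1 hV
  obtain ⟨U₂, hU₂sub, hU₂o, hU₂m⟩ := mem_nhds_iff.1 hU₁
  set ε : ℝ := min (min e η) 1 with hε
  have hεpos : 0 < ε := lt_min (lt_min he hη) one_pos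
  have hεe : ∀ t ∈ Ioo (-ε) ε, t ∈ Ioo (-e) e := by
    intro t ht
    have : ε ≤ e := (min_le_left _ _).trans (min_le_left _ _)
    exact ⟨by linarith [ht.1], by linarith [ht.2]⟩
  have hεη : ∀ t ∈ Ioo (-ε) ε, t ∈ V := by
    intro t ht
    refine hηV ?_
    have : ε ≤ η := (min_le_left _ _).trans (min_le_right _ _)
    rw [Real.ball_eq_Ioo]
    exact ⟨by linarith [ht.1], by linarith [ht.2]⟩
  have hin : ∀ p ∈ U₂ ∩ Metric.ball p₀ (r : ℝ), ∀ t ∈ Ioo (-ε) ε,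
      (β p t).1 ∈ Metric.ball p₀ ρ := fun p hp t ht =>
    hUV (mk_mem_prod (hU₂sub hp.1) (hεη t ht))
  refine ⟨ε, hεpos, U₂ ∩ Metric.ball p₀ (r : ℝ), hU₂o.inter Metric.isOpen_ball,
    ⟨hU₂m, Metric.mem_ball_self hr'⟩, fun p t => (β p t).1, fun p t => (β p t).2, ?_, ?_, ?_, ?_⟩
  · intro p hp
    simp [hβ0 p hp.2]
  · intro p hp t ht
    have h1 : ∀ q ∈ U₂ ∩ Metric.ball p₀ (r : ℝ), ∀ s ∈ Ioo (-ε) ε,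
        HasDerivAt (fun τ => (β q τ).1) (g (β q s).1) s := fun q hq s hs =>
      (hβd q hq.2 s (hεe s hs)).fst
    have h2 : ∀ s ∈ Ioo (-ε) ε,
        HasDerivAt (fun τ => (β p τ).2) ((fderiv ℝ g (β p s).1).comp (β p s).2) s := fun s hs =>
      (hβd p hp.2 s (hεe s hs)).snd
    refine ⟨hBΩ (hin p hp t ht), h1 p hp t ht, h2 t ht, ?_⟩
    -- the error of the linearisation is quadratic, by Grönwall
    have hquad : ∀ q ∈ U₂ ∩ Metric.ball p₀ (r : ℝ),
        ‖(β q t).1 - (β p t).1 - (β p t).2 (q - p)‖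
          ≤ (C * (L' * ‖q - p‖) ^ 2) / K * Real.exp K := by
      intro q hq
      refine norm_le_mul_of_norm_deriv_le (z := fun s => (β q s).1 - (β p s).1 - (β p s).2 (q - p))
        (z' := fun s => g (β q s).1 - g (β p s).1 - (fderiv ℝ g (β p s).1) ((β p s).2 (q - p)))
        (τ := ε) hK (by positivity) (min_le_right _ _) ?_ ?_ ?_ ht
      · intro s hs
        refine ((h1 q hq s hs).sub (h1 p hp s hs)).sub ?_
        have := (h2 s hs).clm_apply (hasDerivAt_const s (q - p))
        simpa using this
      · simp [hβ0 p hp.2, hβ0 q hq.2]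
      · intro s hs
        have hqa := norm_sub_sub_fderiv_le_sq (convex_ball p₀ ρ) Metric.isOpen_ball hdiff hlipB
          (hin p hp s hs) (hin q hq s hs)
        have hd : ‖(β q s).1 - (β p s).1‖ ≤ L' * ‖q - p‖ := by
          have h3 := hβL q hq.2 p hp.2 s (hεe s hs)
          rw [Prod.dist_eq] at h3
          have h4 := (le_max_left _ _).trans h3
          rwa [dist_eq_norm, dist_eq_norm] at h4
        have hsplit : g (β q s).1 - g (β p s).1 - (fderiv ℝ g (β p s).1) ((β p s).2 (q - p))
            = (g (β q s).1 - g (β p s).1 - (fderiv ℝ g (β p s).1) ((β q s).1 - (β p s).1))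
              + (fderiv ℝ g (β p s).1) ((β q s).1 - (β p s).1 - (β p s).2 (q - p)) := by
          simp only [map_sub]; abel
        have hop : ‖(fderiv ℝ g (β p s).1) ((β q s).1 - (β p s).1 - (β p s).2 (q - p))‖
            ≤ K * ‖(β q s).1 - (β p s).1 - (β p s).2 (q - p)‖ :=
          ((fderiv ℝ g (β p s).1).le_opNorm _).trans
            (mul_le_mul_of_nonneg_right (hbd _ (hin p hp s hs)) (norm_nonneg _))
        have hsq : (C : ℝ) * ‖(β q s).1 - (β p s).1‖ ^ 2 ≤ C * (L' * ‖q - p‖) ^ 2 :=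
          mul_le_mul_of_nonneg_left (pow_le_pow_left₀ (norm_nonneg _) hd 2) C.2
        rw [hsplit]
        refine (norm_add_le _ _).trans ?_
        linarith
    have hO : (fun q => (β q t).1 - (β p t).1 - (β p t).2 (q - p)) =O[𝓝 p]
        fun q => ‖q - p‖ ^ 2 := by
      refine Asymptotics.IsBigO.of_bound (C * L' ^ 2 / K * Real.exp K) ?_
      filter_upwards [(hU₂o.inter Metric.isOpen_ball).mem_nhds hp] with q hq
      refine (hquad q hq).trans (le_of_eq ?_)
      rw [Real.norm_of_nonneg (by positivity)]
      ring
    refine HasFDerivAt.of_isLittleO (hO.trans_isLittleO ?_)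
    have h5 : (fun q => ‖q - p‖ ^ 2) =o[𝓝 p] fun q => ‖q - p‖ ^ 1 :=
      Asymptotics.isLittleO_norm_pow_norm_pow (E' := E) one_lt_two |>.comp_tendsto (by
        have : Tendsto (fun q => q - p) (𝓝 p) (𝓝 (p - p)) := tendsto_id.sub_const p
        simpa using this)
    refine h5.trans_isBigO (Asymptotics.IsBigO.of_bound 1 ?_)
    filter_upwards with q
    simp
  · exact (hβc.mono (prod_mono inter_subset_right fun t ht => hεe t ht)).fst
  · exact (hβc.mono (prod_mono inter_subset_right fun t ht => hεe t ht)).snd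

/-! ### Coordinates on the tangent bundle -/

section Coordinates

variable {n : ℕ} {X : Type*} [TopologicalSpace X] [ChartedSpace (EuclideanSpace ℝ (Fin n)) X]
  [IsManifold (𝓡 n) ∞ X]

/-- The coordinates `coordVec y x` in the chart around `y`, as a linear isomorphism of `T_x X`
with the model space. -/
noncomputable def coordEquiv (y x : X) (hx : x ∈ (extChartAt (𝓡 n) y).source) :
    TangentSpace (𝓡 n) x ≃L[ℝ] EuclideanSpace ℝ (Fin n) :=
  (trivializationAt (EuclideanSpace ℝ (Fin n)) (TangentSpace (𝓡 n) : X → Type _)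
    y).continuousLinearEquivAt ℝ x (by simpa using hx)

theorem coordEquiv_apply {y x : X} (hx : x ∈ (extChartAt (𝓡 n) y).source)
    (v : TangentSpace (𝓡 n) x) : coordEquiv y x hx v = coordVec y x v := rfl

theorem coordVec_eq_mfderiv {y x : X} (hx : x ∈ (extChartAt (𝓡 n) y).source)
    (v : TangentSpace (𝓡 n) x) :
    coordVec y x v = mfderiv (𝓡 n) 𝓘(ℝ, EuclideanSpace ℝ (Fin n)) (extChartAt (𝓡 n) y) x v := by
  have hx' : x ∈ (chartAt (EuclideanSpace ℝ (Fin n)) y).source := by simpa using hx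
  have h := TangentBundle.continuousLinearMapAt_trivializationAt (𝕜 := ℝ) (I := 𝓡 n) hx'
  have h' := Trivialization.continuousLinearMapAt_apply_of_mem (R := ℝ)
    (trivializationAt (EuclideanSpace ℝ (Fin n)) (TangentSpace (𝓡 n) : X → Type _) y)
    (b := x) (by simpa using hx) v
  exact h'.symm.trans (congrArg (fun L => L v) h)

theorem coordVec_self (x : X) (v : TangentSpace (𝓡 n) x) : coordVec x x v = v := by
  rw [coordVec_eq_mfderiv (mem_extChartAt_source x), mfderiv_extChartAt_self]
  rfl

theorem coordVec_sub {y x : X} (hx : x ∈ (extChartAt (𝓡 n) y).source)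
    (v w : TangentSpace (𝓡 n) x) : coordVec y x (v - w) = coordVec y x v - coordVec y x w := by
  simp only [← coordEquiv_apply hx, map_sub]

theorem coordVec_smul {y x : X} (hx : x ∈ (extChartAt (𝓡 n) y).source) (c : ℝ)
    (v : TangentSpace (𝓡 n) x) : coordVec y x (c • v) = c • coordVec y x v := by
  simp only [← coordEquiv_apply hx, map_smul]

theorem coordVec_injective {y x : X} (hx : x ∈ (extChartAt (𝓡 n) y).source) :
    Function.Injective (coordVec (n := n) y x) := (coordEquiv y x hx).injective

theorem mfderiv_extChartAt_symm_coordVec {y x : X} (hx : x ∈ (extChartAt (𝓡 n) y).source)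
    (v : TangentSpace (𝓡 n) x) :
    mfderiv 𝓘(ℝ, EuclideanSpace ℝ (Fin n)) (𝓡 n) (extChartAt (𝓡 n) y).symm
      (extChartAt (𝓡 n) y x) (coordVec y x v) = v := by
  rw [coordVec_eq_mfderiv hx]
  have h := mfderivWithin_extChartAt_symm_comp_mfderiv_extChartAt' (I := 𝓡 n) hx
  have h' := congrArg (fun L => L v) h
  rw [ModelWithCorners.range_eq_univ, mfderivWithin_univ] at h'
  exact h'

/-- Convergence in the tangent bundle, read in the coordinates of a chart. -/
theorem tendsto_tangentBundle_iff {α : Type*} {l : Filter α} {P : α → TangentBundle (𝓡 n) X}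
    {p : TangentBundle (𝓡 n) X} {y : X} (hp : p.1 ∈ (extChartAt (𝓡 n) y).source) :
    Tendsto P l (𝓝 p) ↔ Tendsto (fun a => (P a).1) l (𝓝 p.1) ∧
      Tendsto (fun a => coordVec y (P a).1 (P a).2) l (𝓝 (coordVec y p.1 p.2)) :=
  (trivializationAt (EuclideanSpace ℝ (Fin n)) (TangentSpace (𝓡 n) : X → Type _) y).tendsto_nhds_iff
    (by rw [Trivialization.mem_source]; simpa using hp)

theorem contDiffOn_coordField {f : (x : X) → TangentSpace (𝓡 n) x}
    (hf : ContMDiff (𝓡 n) (𝓡 n).tangent 2 (fun x => (⟨x, f x⟩ : TangentBundle (𝓡 n) X))) (y : X) :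
    ContDiffOn ℝ 2 (coordField f y) (extChartAt (𝓡 n) y).target := by
  have h1 : ContMDiffOn (𝓡 n) 𝓘(ℝ, EuclideanSpace ℝ (Fin n)) 2
      (fun x => coordVec y x (f x)) (extChartAt (𝓡 n) y).source := by
    refine ((trivializationAt (EuclideanSpace ℝ (Fin n)) (TangentSpace (𝓡 n) : X → Type _)
      y).contMDiffOn_section_iff (isOpen_extChartAt_source y) ?_).1 hf.contMDiffOn
    intro x hx
    simpa using hx
  have h2 := h1.comp (contMDiffOn_extChartAt_symm (I := 𝓡 n) (n := 2) y)
    (fun p hp => (extChartAt (𝓡 n) y).map_target hp)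
  exact contMDiffOn_iff_contDiffOn.1 h2

end Coordinates

/-! ### The flow of a complete vector field -/

section Flow

set_option linter.unusedSectionVars false

variable {n : ℕ} {X : Type*} [TopologicalSpace X] [T2Space X]
  [ChartedSpace (EuclideanSpace ℝ (Fin n)) X] [IsManifold (𝓡 n) ∞ X]
  {f : (x : X) → TangentSpace (𝓡 n) x}

theorem flow_zero (hc : IsCompleteField f) (x : X) : flow f 0 x = x := by
  unfold flow
  rw [dif_pos (hc x)]
  exact (hc x).choose_spec.1

theorem isMIntegralCurve_flow (hc : IsCompleteField f) (x : X) :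
    IsMIntegralCurve (fun t => flow f t x) f := by
  have h : (fun t => flow f t x) = (hc x).choose := by
    funext t
    unfold flow
    rw [dif_pos (hc x)]
  rw [h]
  exact (hc x).choose_spec.2

theorem flow_eq_of_isMIntegralCurve
    (hf : ContMDiff (𝓡 n) (𝓡 n).tangent 2 (fun x => (⟨x, f x⟩ : TangentBundle (𝓡 n) X)))
    (hc : IsCompleteField f) {γ : ℝ → X} (hγ : IsMIntegralCurve γ f) (t : ℝ) :
    flow f t (γ 0) = γ t := by
  have := isMIntegralCurve_Ioo_eq_of_contMDiff_boundaryless (t₀ := 0) (hf.of_le (by norm_num))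
    (isMIntegralCurve_flow hc (γ 0)) hγ (flow_zero hc _)
  exact congrFun this t

theorem flow_add
    (hf : ContMDiff (𝓡 n) (𝓡 n).tangent 2 (fun x => (⟨x, f x⟩ : TangentBundle (𝓡 n) X)))
    (hc : IsCompleteField f) (s t : ℝ) (x : X) : flow f (s + t) x = flow f s (flow f t x) := by
  have h := flow_eq_of_isMIntegralCurve hf hc ((isMIntegralCurve_flow hc x).comp_add t) s
  simpa using h.symm

theorem flow_flow_neg
    (hf : ContMDiff (𝓡 n) (𝓡 n).tangent 2 (fun x => (⟨x, f x⟩ : TangentBundle (𝓡 n) X)))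
    (hc : IsCompleteField f) (t : ℝ) (x : X) : flow f t (flow f (-t) x) = x := by
  rw [← flow_add hf hc, add_neg_cancel, flow_zero hc]

theorem flow_of_eq_zero
    (hf : ContMDiff (𝓡 n) (𝓡 n).tangent 2 (fun x => (⟨x, f x⟩ : TangentBundle (𝓡 n) X)))
    (hc : IsCompleteField f) {x : X} (hx : f x = 0) (t : ℝ) : flow f t x = x :=
  flow_eq_of_isMIntegralCurve hf hc (isMIntegralCurve_const hx) t

theorem mfderiv_extChartAt_symm_coordField {y : X} {p : EuclideanSpace ℝ (Fin n)}
    (hp : p ∈ (extChartAt (𝓡 n) y).target) :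
    mfderiv 𝓘(ℝ, EuclideanSpace ℝ (Fin n)) (𝓡 n) (extChartAt (𝓡 n) y).symm p (coordField f y p) =
      f ((extChartAt (𝓡 n) y).symm p) := by
  have key : ∀ (x : X) (_ : x ∈ (extChartAt (𝓡 n) y).source) (q : EuclideanSpace ℝ (Fin n)),
      q = extChartAt (𝓡 n) y x → ∀ v : TangentSpace (𝓡 n) x,
      mfderiv 𝓘(ℝ, EuclideanSpace ℝ (Fin n)) (𝓡 n) (extChartAt (𝓡 n) y).symm q (coordVec y x v)
        = v := by
    rintro x hx q rfl v
    exact mfderiv_extChartAt_symm_coordVec hx v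
  exact key _ ((extChartAt (𝓡 n) y).map_target hp) p ((extChartAt (𝓡 n) y).right_inv hp).symm _

/-- A curve in a chart that solves the equation in coordinates is a solution on the manifold. -/
theorem hasMFDerivAt_extChartAt_symm_comp {y : X} {c : ℝ → EuclideanSpace ℝ (Fin n)} {t : ℝ}
    (hp : c t ∈ (extChartAt (𝓡 n) y).target) (hd : HasDerivAt c (coordField f y (c t)) t) :
    HasMFDerivAt 𝓘(ℝ, ℝ) (𝓡 n) (fun s => (extChartAt (𝓡 n) y).symm (c s)) t
      ((1 : ℝ →L[ℝ] ℝ).smulRight (f ((extChartAt (𝓡 n) y).symm (c t)))) := by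
  have h1 : MDifferentiableAt 𝓘(ℝ, EuclideanSpace ℝ (Fin n)) (𝓡 n) (extChartAt (𝓡 n) y).symm
      (c t) := by
    have h := mdifferentiableWithinAt_extChartAt_symm (I := 𝓡 n) hp
    rwa [ModelWithCorners.range_eq_univ, mdifferentiableWithinAt_univ] at h
  have h2 := HasMFDerivAt.comp t h1.hasMFDerivAt (hasMFDerivAt_iff_hasFDerivAt.2 hd.hasFDerivAt)
  refine HasMFDerivAt.congr_mfderiv h2 ?_
  refine ContinuousLinearMap.ext fun (r : ℝ) => ?_
  exact (ContinuousLinearMap.map_smul (mfderiv 𝓘(ℝ, EuclideanSpace ℝ (Fin n)) (𝓡 n)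
    (extChartAt (𝓡 n) y).symm (c t)) r (coordField f y (c t))).trans
    (congrArg (fun v : TangentSpace (𝓡 n) ((extChartAt (𝓡 n) y).symm (c t)) => r • v)
      (mfderiv_extChartAt_symm_coordField hp))

/-- In a chart around `y` the flow is, for short times and near a point of the chart,
differentiable in the initial point, and the derivative, read in the chart, is jointly continuous
and solves the variational equation. -/
theorem exists_local_coordinates_flow
    (hf : ContMDiff (𝓡 n) (𝓡 n).tangent 2 (fun x => (⟨x, f x⟩ : TangentBundle (𝓡 n) X)))
    (hc : IsCompleteField f) {y x₀ : X} (hx₀ : x₀ ∈ (extChartAt (𝓡 n) y).source) :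
    ∃ ε > 0, ∃ U : Set X, IsOpen U ∧ x₀ ∈ U ∧ U ⊆ (extChartAt (𝓡 n) y).source ∧
      ∃ D : X → ℝ → EuclideanSpace ℝ (Fin n) →L[ℝ] EuclideanSpace ℝ (Fin n),
      (∀ q ∈ U, D q 0 = ContinuousLinearMap.id ℝ _) ∧
      (∀ q ∈ U, ∀ t ∈ Ioo (-ε) ε, flow f t q ∈ (extChartAt (𝓡 n) y).source ∧
        MDifferentiableAt (𝓡 n) (𝓡 n) (flow f t) q ∧
        (∀ v : TangentSpace (𝓡 n) q, coordVec y (flow f t q)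
          (mfderiv (𝓡 n) (𝓡 n) (flow f t) q v) = D q t (coordVec y q v)) ∧
        HasDerivAt (D q)
          ((fderiv ℝ (coordField f y) (extChartAt (𝓡 n) y (flow f t q))).comp (D q t)) t) ∧
      ContinuousOn (fun q : X × ℝ => flow f q.2 q.1) (U ×ˢ Ioo (-ε) ε) ∧
      ContinuousOn (fun q : X × ℝ => D q.1 q.2) (U ×ˢ Ioo (-ε) ε) := by
  obtain ⟨ε, hε, U, hUo, hU, Φ, D, h0, h1, h2, h3⟩ :=
    exists_local_flow_hasFDerivAt (isOpen_extChartAt_target (I := 𝓡 n) y)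
      (contDiffOn_coordField hf y) ((extChartAt (𝓡 n) y).map_source hx₀)
  set e := extChartAt (𝓡 n) y with he
  set W : Set X := e.source ∩ e ⁻¹' U with hW
  have hWo : IsOpen W := by
    exact (continuousOn_extChartAt y).isOpen_inter_preimage (isOpen_extChartAt_source y) hUo
  have h0ε : (0 : ℝ) ∈ Ioo (-ε) ε := by simp [hε]
  have hflow : ∀ q ∈ W, ∀ t ∈ Ioo (-ε) ε, flow f t q = e.symm (Φ (e q) t) := by
    intro q hq t ht
    refine isMIntegralCurveOn_Ioo_eqOn_of_contMDiff_boundaryless (γ := fun t => flow f t q)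
      (γ' := fun t => e.symm (Φ (e q) t)) (v := f) h0ε
      (hf.of_le (by norm_num)) ((isMIntegralCurve_flow hc q).isMIntegralCurveOn _)
      (fun s hs => ?_) ?_ ht
    · exact (hasMFDerivAt_extChartAt_symm_comp (h1 _ hq.2 s hs).1
        (h1 _ hq.2 s hs).2.1).hasMFDerivWithinAt
    · simp only [flow_zero hc, (h0 _ hq.2).1]
      exact (e.left_inv hq.1).symm
  have hflowE : ∀ q ∈ W, ∀ t ∈ Ioo (-ε) ε, e (flow f t q) = Φ (e q) t := by
    intro q hq t ht
    rw [hflow q hq t ht, e.right_inv (h1 _ hq.2 t ht).1]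
  have hsrc : ∀ q ∈ W, ∀ t ∈ Ioo (-ε) ε, flow f t q ∈ e.source := by
    intro q hq t ht
    rw [hflow q hq t ht]
    exact e.map_target (h1 _ hq.2 t ht).1
  have hmd : ∀ q ∈ W, ∀ t ∈ Ioo (-ε) ε, MDifferentiableAt (𝓡 n) (𝓡 n) (flow f t) q := by
    intro q hq t ht
    have a1 : MDifferentiableAt 𝓘(ℝ, EuclideanSpace ℝ (Fin n)) (𝓡 n) e.symm (Φ (e q) t) := by
      have h := mdifferentiableWithinAt_extChartAt_symm (I := 𝓡 n) (h1 _ hq.2 t ht).1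
      rwa [ModelWithCorners.range_eq_univ, mdifferentiableWithinAt_univ] at h
    have a2 : MDifferentiableAt 𝓘(ℝ, EuclideanSpace ℝ (Fin n)) 𝓘(ℝ, EuclideanSpace ℝ (Fin n))
        (fun p => Φ p t) (e q) := (h1 _ hq.2 t ht).2.2.2.differentiableAt.mdifferentiableAt
    have a3 : MDifferentiableAt (𝓡 n) 𝓘(ℝ, EuclideanSpace ℝ (Fin n)) e q :=
      mdifferentiableAt_extChartAt (by simpa [he] using hq.1)
    have a4 := (MDifferentiableAt.comp q (MDifferentiableAt.comp (e q) a1 a2) a3)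
    refine a4.congr_of_eventuallyEq ?_
    filter_upwards [hWo.mem_nhds hq] with r hr
    exact hflow r hr t ht
  refine ⟨ε, hε, W, hWo, ⟨hx₀, hU⟩, fun q hq => hq.1, fun q t => D (e q) t,
    fun q hq => (h0 _ hq.2).2, fun q hq t ht => ⟨hsrc q hq t ht, hmd q hq t ht, fun v => ?_, ?_⟩,
    ?_, ?_⟩
  · -- differentiate the identity `e ∘ flow t = Φ(·, t) ∘ e`
    have a3 : MDifferentiableAt (𝓡 n) 𝓘(ℝ, EuclideanSpace ℝ (Fin n)) e q :=
      mdifferentiableAt_extChartAt (by simpa [he] using hq.1)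
    have a5 : MDifferentiableAt (𝓡 n) 𝓘(ℝ, EuclideanSpace ℝ (Fin n)) e (flow f t q) :=
      mdifferentiableAt_extChartAt (by simpa [he] using hsrc q hq t ht)
    have b1 := HasMFDerivAt.comp q a5.hasMFDerivAt (hmd q hq t ht).hasMFDerivAt
    have b2 := HasMFDerivAt.comp q (hasMFDerivAt_iff_hasFDerivAt.2 (h1 _ hq.2 t ht).2.2.2)
      a3.hasMFDerivAt
    have b3 := b2.congr_of_eventuallyEq (f₁ := e ∘ flow f t) (by
      filter_upwards [hWo.mem_nhds hq] with r hr
      exact hflowE r hr t ht)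
    have b4 := hasMFDerivAt_unique b1 b3
    rw [coordVec_eq_mfderiv (hsrc q hq t ht), coordVec_eq_mfderiv hq.1]
    exact congrArg (fun L => L v) b4
  · have := (h1 _ hq.2 t ht).2.2.1
    rw [hflowE q hq t ht]
    exact this
  · have hcomp : ContinuousOn (fun q : X × ℝ => Φ (e q.1) q.2) (W ×ˢ Ioo (-ε) ε) := by
      refine h2.comp (f := fun q : X × ℝ => (e q.1, q.2)) ?_ fun q hq => ⟨hq.1.2, hq.2⟩
      refine ContinuousOn.prodMk ?_ continuousOn_snd
      exact (continuousOn_extChartAt y).comp continuousOn_fst fun q hq => hq.1.1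
    refine ((continuousOn_extChartAt_symm y).comp hcomp fun q hq =>
      (h1 _ hq.1.2 _ hq.2).1).congr fun q hq => ?_
    exact hflow _ hq.1 _ hq.2
  · refine h3.comp (f := fun q : X × ℝ => (e q.1, q.2)) ?_ fun q hq => ⟨hq.1.2, hq.2⟩
    refine ContinuousOn.prodMk ?_ continuousOn_snd
    exact (continuousOn_extChartAt y).comp continuousOn_fst fun q hq => hq.1.1

end Flow

/-! ### The linearised flow on the tangent bundle -/

section TangentFlow

set_option linter.unusedSectionVars false

variable {n : ℕ} {X : Type*} [TopologicalSpace X] [T2Space X]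
  [ChartedSpace (EuclideanSpace ℝ (Fin n)) X] [IsManifold (𝓡 n) ∞ X]
  {f : (x : X) → TangentSpace (𝓡 n) x}

/-- The linearised flow: the tangent map of `flow f t`. -/
noncomputable def tflow (f : (x : X) → TangentSpace (𝓡 n) x) (t : ℝ)
    (p : TangentBundle (𝓡 n) X) : TangentBundle (𝓡 n) X :=
  tangentMap (𝓡 n) (𝓡 n) (flow f t) p

theorem exists_local_tflow
    (hf : ContMDiff (𝓡 n) (𝓡 n).tangent 2 (fun x => (⟨x, f x⟩ : TangentBundle (𝓡 n) X)))
    (hc : IsCompleteField f) (x₀ : X) :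
    ∃ ε > 0, ∃ U : Set X, IsOpen U ∧ x₀ ∈ U ∧
      (∀ q ∈ U, ∀ t ∈ Ioo (-ε) ε, MDifferentiableAt (𝓡 n) (𝓡 n) (flow f t) q) ∧
      ∀ t ∈ Ioo (-ε) ε, ∀ p : TangentBundle (𝓡 n) X, p.1 ∈ U →
        ContinuousAt (fun b : ℝ × TangentBundle (𝓡 n) X => tflow f b.1 b.2) (t, p) := by
  obtain ⟨ε, hε, U, hUo, hU, hUs, D, h0, h1, h2, h3⟩ :=
    exists_local_coordinates_flow hf hc (mem_extChartAt_source (I := 𝓡 n) x₀)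
  refine ⟨ε, hε, U, hUo, hU, fun q hq t ht => (h1 q hq t ht).2.1, fun t ht p hp => ?_⟩
  have hopen : IsOpen (U ×ˢ Ioo (-ε) ε) := hUo.prod isOpen_Ioo
  have hproj : ContinuousAt (fun b : ℝ × TangentBundle (𝓡 n) X => (b.2.1, b.1)) (t, p) :=
    (((FiberBundle.continuous_proj (EuclideanSpace ℝ (Fin n))
      (TangentSpace (𝓡 n) : X → Type _)).comp continuous_snd).prodMk continuous_fst).continuousAt
  have hev : ∀ᶠ b : ℝ × TangentBundle (𝓡 n) X in 𝓝 (t, p), (b.2.1, b.1) ∈ U ×ˢ Ioo (-ε) ε :=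
    hproj.eventually_mem (hopen.mem_nhds ⟨hp, ht⟩)
  refine (tendsto_tangentBundle_iff (y := x₀) (h1 p.1 hp t ht).1).2 ⟨?_, ?_⟩
  · exact ContinuousAt.comp (f := fun b : ℝ × TangentBundle (𝓡 n) X => (b.2.1, b.1))
      (g := fun q : X × ℝ => flow f q.2 q.1) (h2.continuousAt (hopen.mem_nhds ⟨hp, ht⟩)) hproj
  · have hD : ContinuousAt (fun b : ℝ × TangentBundle (𝓡 n) X => D b.2.1 b.1) (t, p) :=
      ContinuousAt.comp (f := fun b : ℝ × TangentBundle (𝓡 n) X => (b.2.1, b.1))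
        (g := fun q : X × ℝ => D q.1 q.2) (h3.continuousAt (hopen.mem_nhds ⟨hp, ht⟩)) hproj
    have hcv : ContinuousAt (fun b : ℝ × TangentBundle (𝓡 n) X => coordVec x₀ b.2.1 b.2.2)
        (t, p) :=
      ((tendsto_tangentBundle_iff (y := x₀) (hUs hp)).1
        (continuousAt_snd (X := ℝ) (Y := TangentBundle (𝓡 n) X) (p := (t, p)))).2
    have h4 := hD.clm_apply hcv
    have h5 : ∀ᶠ b : ℝ × TangentBundle (𝓡 n) X in 𝓝 (t, p),
        coordVec x₀ (tflow f b.1 b.2).1 (tflow f b.1 b.2).2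
          = D b.2.1 b.1 (coordVec x₀ b.2.1 b.2.2) := by
      filter_upwards [hev] with b hb
      exact (h1 b.2.1 hb.1 b.1 hb.2).2.2.1 b.2.2
    have h6 := h4.congr_of_eventuallyEq h5
    exact h6

theorem tflow_add_of_mdifferentiableAt
    (hf : ContMDiff (𝓡 n) (𝓡 n).tangent 2 (fun x => (⟨x, f x⟩ : TangentBundle (𝓡 n) X)))
    (hc : IsCompleteField f) {s t : ℝ} {p : TangentBundle (𝓡 n) X}
    (ht : MDifferentiableAt (𝓡 n) (𝓡 n) (flow f t) p.1)
    (hs : MDifferentiableAt (𝓡 n) (𝓡 n) (flow f s) (flow f t p.1)) :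
    tflow f (s + t) p = tflow f s (tflow f t p) := by
  have h : flow f (s + t) = flow f s ∘ flow f t := funext fun x => flow_add hf hc s t x
  unfold tflow
  rw [h]
  exact tangentMap_comp_at p hs ht

/-- The flow is differentiable and its tangent map jointly continuous. Both properties are open
and closed conditions on the time `t`. -/
theorem mdifferentiableAt_flow_and_continuousAt_tflow
    (hf : ContMDiff (𝓡 n) (𝓡 n).tangent 2 (fun x => (⟨x, f x⟩ : TangentBundle (𝓡 n) X)))
    (hc : IsCompleteField f) (t : ℝ) (x : X) :
    ∀ᶠ a : ℝ × X in 𝓝 (t, x), MDifferentiableAt (𝓡 n) (𝓡 n) (flow f a.1) a.2 ∧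
      ∀ v : TangentSpace (𝓡 n) a.2, ContinuousAt
        (fun b : ℝ × TangentBundle (𝓡 n) X => tflow f b.1 b.2) (a.1, ⟨a.2, v⟩) := by
  set Good : ℝ → Prop := fun t => ∀ᶠ a : ℝ × X in 𝓝 (t, x),
    MDifferentiableAt (𝓡 n) (𝓡 n) (flow f a.1) a.2 ∧
      ∀ v : TangentSpace (𝓡 n) a.2, ContinuousAt
        (fun b : ℝ × TangentBundle (𝓡 n) X => tflow f b.1 b.2) (a.1, ⟨a.2, v⟩) with hGood
  have hflowc : ∀ (r : ℝ) (q : X) (v : TangentSpace (𝓡 n) q), ContinuousAt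
      (fun b : ℝ × TangentBundle (𝓡 n) X => tflow f b.1 b.2) (r, ⟨q, v⟩) →
      ContinuousAt (fun b : ℝ × TangentBundle (𝓡 n) X => flow f b.1 b.2.1) (r, ⟨q, v⟩) := by
    intro r q v h
    exact (FiberBundle.continuous_proj (EuclideanSpace ℝ (Fin n))
      (TangentSpace (𝓡 n) : X → Type _)).continuousAt.comp h
  have hzero : Continuous (fun a : ℝ × X => (a.1, (⟨a.2, 0⟩ : TangentBundle (𝓡 n) X))) := by
    refine continuous_fst.prodMk ?_
    exact (Bundle.contMDiff_zeroSection (IB := 𝓡 n) (n := (0 : ℕ∞ω)) ℝ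
      (TangentSpace (𝓡 n) : X → Type _) (F := EuclideanSpace ℝ (Fin n))).continuous.comp continuous_snd
  have hstep : ∀ t₁ : ℝ, ∃ δ > 0, ∀ t ∈ Ioo (t₁ - δ) (t₁ + δ), ∀ t' ∈ Ioo (t₁ - δ) (t₁ + δ),
      Good t → Good t' := by
    intro t₁
    obtain ⟨ε, hε, U, hUo, hU, hmd, hct⟩ := exists_local_tflow hf hc (flow f t₁ x)
    have hcont : ContinuousAt (fun t => flow f t x) t₁ :=
      (isMIntegralCurve_flow hc x).continuous.continuousAt
    obtain ⟨δ₀, hδ₀, hδU⟩ := Metric.mem_nhds_iff.1 (hcont.preimage_mem_nhds (hUo.mem_nhds hU))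
    refine ⟨min δ₀ (ε / 2), lt_min hδ₀ (half_pos hε), fun t ht t' ht' hg => ?_⟩
    have htU : flow f t x ∈ U := hδU (by
      rw [Real.ball_eq_Ioo]
      have := min_le_left δ₀ (ε / 2)
      exact ⟨by linarith [ht.1], by linarith [ht.2]⟩)
    set s := t' - t with hs
    have hsε : s ∈ Ioo (-ε) ε := by
      have := min_le_right δ₀ (ε / 2)
      exact ⟨by linarith [ht.2, ht'.1], by linarith [ht.1, ht'.2]⟩
    -- near `(t, x)` everything is good and the flow stays in `U`
    have hg1 : ∀ᶠ a : ℝ × X in 𝓝 (t, x), (MDifferentiableAt (𝓡 n) (𝓡 n) (flow f a.1) a.2 ∧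
        ∀ v : TangentSpace (𝓡 n) a.2, ContinuousAt
          (fun b : ℝ × TangentBundle (𝓡 n) X => tflow f b.1 b.2) (a.1, ⟨a.2, v⟩)) ∧
        flow f a.1 a.2 ∈ U := by
      refine hg.and ?_
      have h1 := hflowc t x 0 (hg.self_of_nhds.2 0)
      have h2 : ContinuousAt (fun a : ℝ × X => flow f a.1 a.2) (t, x) :=
        ContinuousAt.comp (f := fun a : ℝ × X => (a.1, (⟨a.2, 0⟩ : TangentBundle (𝓡 n) X)))
          (x := (t, x)) h1 hzero.continuousAt
      exact h2.eventually_mem (hUo.mem_nhds htU)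
    have hshift : Tendsto (fun a : ℝ × X => (a.1 - s, a.2)) (𝓝 (t', x)) (𝓝 (t, x)) := by
      have : Continuous (fun a : ℝ × X => (a.1 - s, a.2)) := by fun_prop
      have h := this.tendsto (t', x)
      simpa [hs] using h
    have hg2 := (hshift.eventually hg1.eventually_nhds)
    filter_upwards [hg2] with a ha
    have ha0 := ha.self_of_nhds
    refine ⟨?_, fun v => ?_⟩
    · have h1 := MDifferentiableAt.comp a.2 (hmd _ ha0.2 s hsε) ha0.1.1
      have h2 : flow f s ∘ flow f (a.1 - s) = flow f a.1 := by
        funext z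
        rw [Function.comp_apply, ← flow_add hf hc, add_sub_cancel]
      rwa [h2] at h1
    · have h1 : ContinuousAt (fun b : ℝ × TangentBundle (𝓡 n) X =>
          tflow f s (tflow f (b.1 - s) b.2)) (a.1, ⟨a.2, v⟩) := by
        have c1 : ContinuousAt (fun b : ℝ × TangentBundle (𝓡 n) X => tflow f (b.1 - s) b.2)
            (a.1, ⟨a.2, v⟩) := by
          have c2 : Continuous (fun b : ℝ × TangentBundle (𝓡 n) X => (b.1 - s, b.2)) := by fun_prop
          exact ContinuousAt.comp (f := fun b : ℝ × TangentBundle (𝓡 n) X => (b.1 - s, b.2))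
            (g := fun b : ℝ × TangentBundle (𝓡 n) X => tflow f b.1 b.2)
            (x := (a.1, ⟨a.2, v⟩)) (ha0.1.2 v) c2.continuousAt
        have c3 : ContinuousAt (fun b : ℝ × TangentBundle (𝓡 n) X => tflow f b.1 b.2)
            (s, tflow f (a.1 - s) ⟨a.2, v⟩) := hct s hsε _ ha0.2
        exact ContinuousAt.comp (f := fun b : ℝ × TangentBundle (𝓡 n) X =>
          (s, tflow f (b.1 - s) b.2)) (x := (a.1, ⟨a.2, v⟩)) c3 (continuousAt_const.prodMk c1)
      refine h1.congr_of_eventuallyEq ?_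
      have hpr : Tendsto (fun b : ℝ × TangentBundle (𝓡 n) X => (b.1 - s, b.2.1))
          (𝓝 (a.1, ⟨a.2, v⟩)) (𝓝 (a.1 - s, a.2)) := by
        have : Continuous (fun b : ℝ × TangentBundle (𝓡 n) X => (b.1 - s, b.2.1)) :=
          (continuous_fst.sub continuous_const).prodMk ((FiberBundle.continuous_proj
            (EuclideanSpace ℝ (Fin n)) (TangentSpace (𝓡 n) : X → Type _)).comp continuous_snd)
        exact this.tendsto _
      filter_upwards [hpr.eventually ha] with b hb
      have := tflow_add_of_mdifferentiableAt hf hc (s := s) (t := b.1 - s) (p := b.2) hb.1.1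
        (hmd _ hb.2 s hsε)
      rwa [add_sub_cancel] at this
  have h0 : Good 0 := by
    obtain ⟨ε, hε, U, hUo, hU, hmd, hct⟩ := exists_local_tflow hf hc x
    have : Ioo (-ε) ε ×ˢ U ∈ 𝓝 ((0 : ℝ), x) :=
      (isOpen_Ioo.prod hUo).mem_nhds ⟨by simp [hε], hU⟩
    filter_upwards [this] with a ha
    exact ⟨hmd _ ha.2 _ ha.1, fun v => hct _ ha.1 _ ha.2⟩
  have hclopen : IsClopen {t | Good t} := by
    constructor
    · refine isClosed_of_closure_subset fun t₁ ht₁ => ?_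
      obtain ⟨δ, hδ, h⟩ := hstep t₁
      obtain ⟨t, ht, hgt⟩ := mem_closure_iff.1 ht₁ (Ioo (t₁ - δ) (t₁ + δ)) isOpen_Ioo
        ⟨by linarith, by linarith⟩
      exact h t ht t₁ ⟨by linarith, by linarith⟩ hgt
    · refine isOpen_iff_mem_nhds.2 fun t₁ ht₁ => ?_
      obtain ⟨δ, hδ, h⟩ := hstep t₁
      filter_upwards [Ioo_mem_nhds (show t₁ - δ < t₁ by linarith) (show t₁ < t₁ + δ by linarith)]
        with t ht
      exact h t₁ ⟨by linarith, by linarith⟩ t ht ht₁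
  have := hclopen.eq_univ ⟨0, h0⟩
  have ht : t ∈ {t | Good t} := by
    rw [this]
    exact mem_univ t
  exact ht

theorem mdifferentiable_flow
    (hf : ContMDiff (𝓡 n) (𝓡 n).tangent 2 (fun x => (⟨x, f x⟩ : TangentBundle (𝓡 n) X)))
    (hc : IsCompleteField f) (t : ℝ) : MDifferentiable (𝓡 n) (𝓡 n) (flow f t) := fun x =>
  (mdifferentiableAt_flow_and_continuousAt_tflow hf hc t x).self_of_nhds.1

theorem continuous_tflow
    (hf : ContMDiff (𝓡 n) (𝓡 n).tangent 2 (fun x => (⟨x, f x⟩ : TangentBundle (𝓡 n) X)))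
    (hc : IsCompleteField f) :
    Continuous (fun b : ℝ × TangentBundle (𝓡 n) X => tflow f b.1 b.2) :=
  continuous_iff_continuousAt.2 fun b =>
    (mdifferentiableAt_flow_and_continuousAt_tflow hf hc b.1 b.2.1).self_of_nhds.2 b.2.2

theorem continuous_flow
    (hf : ContMDiff (𝓡 n) (𝓡 n).tangent 2 (fun x => (⟨x, f x⟩ : TangentBundle (𝓡 n) X)))
    (hc : IsCompleteField f) : Continuous (fun a : ℝ × X => flow f a.1 a.2) := by
  have hzero : Continuous (fun a : ℝ × X => (a.1, (⟨a.2, 0⟩ : TangentBundle (𝓡 n) X))) := by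
    refine continuous_fst.prodMk ?_
    exact (Bundle.contMDiff_zeroSection (IB := 𝓡 n) (n := (0 : ℕ∞ω)) ℝ
      (TangentSpace (𝓡 n) : X → Type _) (F := EuclideanSpace ℝ (Fin n))).continuous.comp continuous_snd
  exact (FiberBundle.continuous_proj (EuclideanSpace ℝ (Fin n))
      (TangentSpace (𝓡 n) : X → Type _)).comp ((continuous_tflow hf hc).comp hzero)

theorem tflow_add
    (hf : ContMDiff (𝓡 n) (𝓡 n).tangent 2 (fun x => (⟨x, f x⟩ : TangentBundle (𝓡 n) X)))
    (hc : IsCompleteField f) (s t : ℝ) (p : TangentBundle (𝓡 n) X) :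
    tflow f (s + t) p = tflow f s (tflow f t p) :=
  tflow_add_of_mdifferentiableAt hf hc (mdifferentiable_flow hf hc t _)
    (mdifferentiable_flow hf hc s _)

theorem tflow_zero (hc : IsCompleteField f) (p : TangentBundle (𝓡 n) X) : tflow f 0 p = p := by
  have h : flow f 0 = id := funext fun x => flow_zero hc x
  unfold tflow
  rw [h, tangentMap_id]
  rfl

/-- The linearised flow solves the variational equation in every chart. -/
theorem hasDerivAt_coordVec_tflow
    (hf : ContMDiff (𝓡 n) (𝓡 n).tangent 2 (fun x => (⟨x, f x⟩ : TangentBundle (𝓡 n) X)))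
    (hc : IsCompleteField f) (p : TangentBundle (𝓡 n) X) (t : ℝ) {y : X}
    (hy : flow f t p.1 ∈ (extChartAt (𝓡 n) y).source) :
    HasDerivAt (fun s => coordVec y (tflow f s p).1 (tflow f s p).2)
      (fderiv ℝ (coordField f y) (extChartAt (𝓡 n) y (flow f t p.1))
        (coordVec y (tflow f t p).1 (tflow f t p).2)) t := by
  obtain ⟨ε, hε, U, hUo, hU, hUs, D, h0, h1, h2, h3⟩ := exists_local_coordinates_flow hf hc hy
  have hz : (0 : ℝ) ∈ Ioo (-ε) ε := by simp [hε]
  set P := tflow f t p with hP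
  have hPU : P.1 ∈ U := hU
  have hd := (h1 _ hPU 0 hz).2.2.2
  rw [flow_zero hc, h0 _ hPU, ContinuousLinearMap.comp_id] at hd
  have hd1 : HasDerivAt (D P.1) (fderiv ℝ (coordField f y) (extChartAt (𝓡 n) y P.1)) (t - t) := by
    rwa [sub_self]
  have hd2 := hd1.comp_sub_const t t
  have hd3 := hd2.clm_apply (hasDerivAt_const t (coordVec y P.1 P.2))
  simp only [map_zero, add_zero] at hd3
  refine hd3.congr_of_eventuallyEq ?_
  filter_upwards [Ioo_mem_nhds (show t - ε < t by linarith) (show t < t + ε by linarith)] with s hs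
  have h4 : tflow f s p = tflow f (s - t) P := by rw [hP, ← tflow_add hf hc, sub_add_cancel]
  rw [h4]
  exact (h1 _ hPU (s - t) ⟨by linarith [hs.1], by linarith [hs.2]⟩).2.2.1 P.2

theorem isProlongedSolution_tflow
    (hf : ContMDiff (𝓡 n) (𝓡 n).tangent 2 (fun x => (⟨x, f x⟩ : TangentBundle (𝓡 n) X)))
    (hc : IsCompleteField f) (p : TangentBundle (𝓡 n) X) :
    IsProlongedSolution f 0 (fun t => flow f t p.1) (fun t => (tflow f t p).2) :=
  ⟨(isMIntegralCurve_flow hc p.1).isMIntegralCurveOn _, fun t _ _ hy =>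
    (hasDerivAt_coordVec_tflow hf hc p t hy).hasDerivWithinAt⟩

/-- The linearised flow preserves the vector field. -/
theorem mfderiv_flow_field
    (hf : ContMDiff (𝓡 n) (𝓡 n).tangent 2 (fun x => (⟨x, f x⟩ : TangentBundle (𝓡 n) X)))
    (hc : IsCompleteField f) (t : ℝ) (x : X) :
    mfderiv (𝓡 n) (𝓡 n) (flow f t) x (f x) = f (flow f t x) := by
  have h1 := HasMFDerivAt.comp (0 : ℝ) (mdifferentiable_flow hf hc t (flow f 0 x)).hasMFDerivAt
    (isMIntegralCurve_flow hc x 0)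
  have h2 := isMIntegralCurve_flow hc (flow f t x) 0
  have h3 : flow f t ∘ (fun s => flow f s x) = fun s => flow f s (flow f t x) := by
    funext s
    rw [Function.comp_apply, ← flow_add hf hc, add_comm, flow_add hf hc]
  rw [h3] at h1
  have h4 := hasMFDerivAt_unique h1 h2
  have h5 : ((1 : ℝ) • mfderiv (𝓡 n) (𝓡 n) (flow f t) (flow f 0 x) (f (flow f 0 x)) :
      EuclideanSpace ℝ (Fin n)) = (1 : ℝ) • f (flow f 0 (flow f t x)) := by
    have h6 := congrArg (fun L => L (1 : ℝ)) h4
    refine Eq.trans ?_ h6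
    exact (ContinuousLinearMap.map_smul (mfderiv (𝓡 n) (𝓡 n) (flow f t) (flow f 0 x)) (1 : ℝ)
      (f (flow f 0 x))).symm
  have h7 : (mfderiv (𝓡 n) (𝓡 n) (flow f t) (flow f 0 x) (f (flow f 0 x)) :
      EuclideanSpace ℝ (Fin n)) = f (flow f 0 (flow f t x)) :=
    (one_smul ℝ _).symm.trans (h5.trans (one_smul ℝ _))
  have h8 : (mfderiv (𝓡 n) (𝓡 n) (flow f t) (flow f 0 x) (f (flow f 0 x)) :
      EuclideanSpace ℝ (Fin n)) = mfderiv (𝓡 n) (𝓡 n) (flow f t) x (f x) :=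
    congrArg (fun z : X => (mfderiv (𝓡 n) (𝓡 n) (flow f t) z (f z) : EuclideanSpace ℝ (Fin n)))
      (flow_zero hc x)
  have h9 : (f (flow f 0 (flow f t x)) : EuclideanSpace ℝ (Fin n)) = f (flow f t x) :=
    congrArg (fun z : X => (f z : EuclideanSpace ℝ (Fin n))) (flow_zero hc _)
  exact h8.symm.trans (h7.trans h9)

end TangentFlow

/-! ### Closed balls of a complete Riemannian manifold are compact -/

section HopfRinow

/-- The theorem of Hopf, Rinow and Cohn-Vossen: a complete, locally compact metric space with
approximate geodesics is proper. For a fixed centre `x`, the radii `r` such that the closed ball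
is compact form an open and closed set. -/
theorem properSpace_of_approx_geodesics {X : Type*} [MetricSpace X] [CompleteSpace X]
    [LocallyCompactSpace X]
    (hlen : ∀ x y : X, ∀ r, 0 ≤ r → r ≤ dist x y → ∀ ε > 0,
      ∃ z, dist x z = r ∧ dist z y < dist x y - r + ε) : ProperSpace X := by
  have hopen : ∀ (x : X) (r : ℝ), 0 ≤ r → IsCompact (Metric.closedBall x r) →
      ∃ δ > 0, IsCompact (Metric.closedBall x (r + δ)) := by
    intro x r hr hcpt
    obtain ⟨N, hN, hsub⟩ := exists_compact_superset hcpt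
    obtain ⟨δ, hδ, hδN⟩ := hcpt.exists_thickening_subset_open isOpen_interior hsub
    refine ⟨δ / 2, half_pos hδ, hN.of_isClosed_subset Metric.isClosed_closedBall ?_⟩
    intro y hy
    refine interior_subset (hδN (Metric.mem_thickening_iff.2 ?_))
    rw [Metric.mem_closedBall, dist_comm] at hy
    rcases le_total (dist x y) r with h | h
    · exact ⟨y, by rwa [Metric.mem_closedBall, dist_comm], by simpa using hδ⟩
    · obtain ⟨z, hz, hzy⟩ := hlen x y r hr h (δ / 2) (half_pos hδ)
      refine ⟨z, by rw [Metric.mem_closedBall, dist_comm, hz], ?_⟩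
      rw [dist_comm]
      linarith
  have hclosed : ∀ (x : X) (r : ℝ), 0 < r → (∀ s < r, IsCompact (Metric.closedBall x s)) →
      IsCompact (Metric.closedBall x r) := by
    intro x r hr hs
    refine TotallyBounded.isCompact_of_isClosed ?_ Metric.isClosed_closedBall
    refine Metric.totallyBounded_iff.2 fun ε hε => ?_
    set s := max 0 (r - ε / 4) with hsdef
    have hsr : s < r := max_lt hr (by linarith)
    obtain ⟨t, ht, htc⟩ := Metric.totallyBounded_iff.1 (hs s hsr).totallyBounded (ε / 2)
      (half_pos hε)
    refine ⟨t, ht, fun y hy => ?_⟩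
    rw [Metric.mem_closedBall, dist_comm] at hy
    obtain ⟨z, hz, hzy⟩ : ∃ z, z ∈ Metric.closedBall x s ∧ dist y z < ε / 2 := by
      rcases le_total (dist x y) s with h | h
      · exact ⟨y, by rwa [Metric.mem_closedBall, dist_comm], by simpa using half_pos hε⟩
      · obtain ⟨z, hz, hzy⟩ := hlen x y s (le_max_left _ _) h (ε / 4) (by linarith)
        refine ⟨z, by rw [Metric.mem_closedBall, dist_comm, hz], ?_⟩
        rw [dist_comm]
        have := le_max_right 0 (r - ε / 4)
        linarith
    obtain ⟨c, hc, hzc⟩ := mem_iUnion₂.1 (htc hz)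
    refine mem_iUnion₂.2 ⟨c, hc, ?_⟩
    rw [Metric.mem_ball] at hzc ⊢
    linarith [dist_triangle y z c]
  refine ⟨fun x r => ?_⟩
  by_contra hnc
  have hr0 : ∀ s, s < 0 → IsCompact (Metric.closedBall x s) := fun s hs => by
    rw [Metric.closedBall_eq_empty.2 hs]; exact isCompact_empty
  set S : Set ℝ := {s | ¬ IsCompact (Metric.closedBall x s)} with hS
  have hup : ∀ s ∈ S, ∀ s', s ≤ s' → s' ∈ S := fun s hs s' hss' hc =>
    hs (hc.of_isClosed_subset Metric.isClosed_closedBall (Metric.closedBall_subset_closedBall hss'))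
  have hbdd : BddBelow S := ⟨0, fun s hs => not_lt.1 fun h => hs (hr0 s h)⟩
  have hne : S.Nonempty := ⟨r, hnc⟩
  set m := sInf S with hm
  have hm0 : 0 ≤ m := le_csInf hne fun s hs => not_lt.1 fun h => hs (hr0 s h)
  have hlt : ∀ s < m, IsCompact (Metric.closedBall x s) := fun s hs => by
    by_contra h
    exact absurd (csInf_le hbdd h) (not_le.2 hs)
  have hmc : IsCompact (Metric.closedBall x m) := by
    rcases hm0.eq_or_lt with h | h
    · rw [← h, Metric.closedBall_zero]; exact isCompact_singleton
    · exact hclosed x m h hlt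
  obtain ⟨δ, hδ, hδc⟩ := hopen x m hm0 hmc
  obtain ⟨s, hs, hsm⟩ := exists_lt_of_csInf_lt hne (show sInf S < m + δ by linarith)
  exact hup s hs _ hsm.le hδc

theorem properSpace_of_isRiemannianManifold (n : ℕ) (X : Type*) [MetricSpace X] [CompleteSpace X]
    [ChartedSpace (EuclideanSpace ℝ (Fin n)) X] [IsManifold (𝓡 n) ∞ X]
    [RiemannianBundle (fun x : X => TangentSpace (𝓡 n) x)]
    [IsRiemannianManifold (𝓡 n) X] : ProperSpace X := by
  have : LocallyCompactSpace X := Manifold.locallyCompact_of_finiteDimensional (𝓡 n)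
  refine properSpace_of_approx_geodesics fun x y r hr hrd ε hε => ?_
  have h1 : Manifold.riemannianEDist (𝓡 n) x y < ENNReal.ofReal (dist x y + ε) := by
    rw [← IsRiemannianManifold.out (I := 𝓡 n) x y, edist_dist]
    exact (ENNReal.ofReal_lt_ofReal_iff (by positivity)).2 (by linarith)
  obtain ⟨γ, hγ0, hγ1, hγs, hγL⟩ := Manifold.exists_lt_of_riemannianEDist_lt h1
  have hcont : ContinuousOn (fun t => dist x (γ t)) (Icc 0 1) :=
    
    (continuous_const.dist continuous_id).comp_continuousOn hγs.continuousOn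
  obtain ⟨t, ht, htr⟩ := intermediate_value_Icc zero_le_one hcont
    (show r ∈ Icc (dist x (γ 0)) (dist x (γ 1)) by rw [hγ0, hγ1, dist_self]; exact ⟨hr, hrd⟩)
  refine ⟨γ t, htr, ?_⟩
  have hl1 : Manifold.riemannianEDist (𝓡 n) x (γ t) ≤ Manifold.pathELength (𝓡 n) γ 0 t :=
    Manifold.riemannianEDist_le_pathELength (hγs.mono (Icc_subset_Icc_right ht.2)) hγ0 rfl ht.1
  have hl2 : Manifold.riemannianEDist (𝓡 n) (γ t) y ≤ Manifold.pathELength (𝓡 n) γ t 1 :=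
    Manifold.riemannianEDist_le_pathELength (hγs.mono (Icc_subset_Icc_left ht.1)) rfl hγ1 ht.2
  have hsum := Manifold.pathELength_add (I := 𝓡 n) (γ := γ) ht.1 ht.2
  rw [← IsRiemannianManifold.out (I := 𝓡 n)] at hl1 hl2
  have h2 : edist x (γ t) + edist (γ t) y < ENNReal.ofReal (dist x y + ε) :=
    (add_le_add hl1 hl2).trans_lt (hsum ▸ hγL)
  rw [edist_dist, edist_dist, ← ENNReal.ofReal_add dist_nonneg dist_nonneg,
    ENNReal.ofReal_lt_ofReal_iff (by positivity)] at h2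
  have h3 : dist x (γ t) = r := htr
  linarith

end HopfRinow

/-! ### Closed pointed cones and positive linear maps -/

section ConeLemmas

theorem IsClosedPointedCone.zero_mem {V : Type*} [AddCommGroup V] [Module ℝ V]
    [TopologicalSpace V] {C : Set V} (hC : IsClosedPointedCone C) : (0 : V) ∈ C := by
  have h : (0 : V) ∈ C ∩ {v | -v ∈ C} := by rw [hC.pointed]; rfl
  exact h.1

theorem IsClosedPointedCone.eq_zero {V : Type*} [AddCommGroup V] [Module ℝ V]
    [TopologicalSpace V] {C : Set V} (hC : IsClosedPointedCone C) {v : V} (h : v ∈ C)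
    (h' : -v ∈ C) : v = 0 := by
  have h : v ∈ C ∩ {v | -v ∈ C} := ⟨h, h'⟩
  rwa [hC.pointed] at h

/-- Any two nonzero elements of `R` are comparable in the order of `C`, with ratio `Θ`. -/
def ComparableIn {V : Type*} [AddCommGroup V] [Module ℝ V] (C R : Set V) (Θ : ℝ) : Prop :=
  ∀ r₁ ∈ R, ∀ r₂ ∈ R, r₁ ≠ 0 → r₂ ≠ 0 →
    ∃ α : ℝ, 0 < α ∧ r₁ - α • r₂ ∈ C ∧ (Θ * α) • r₂ - r₁ ∈ C

theorem ComparableIn.map {V W : Type*} [AddCommGroup V] [Module ℝ V] [AddCommGroup W] [Module ℝ W]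
    {C R : Set V} {Θ : ℝ} (h : ComparableIn C R Θ) (Γ : V ≃ₗ[ℝ] W) :
    ComparableIn (Γ '' C) (Γ '' R) Θ := by
  rintro _ ⟨r₁, h₁, rfl⟩ _ ⟨r₂, h₂, rfl⟩ hn₁ hn₂
  obtain ⟨α, hα, ha, hb⟩ := h r₁ h₁ r₂ h₂ (fun h => hn₁ (by simp [h])) (fun h => hn₂ (by simp [h]))
  exact ⟨α, hα, ⟨_, ha, by simp⟩, ⟨_, hb, by simp⟩⟩

variable {E : Type*} [NormedAddCommGroup E] [NormedSpace ℝ E]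

/-- If `a - c w ∈ C` for arbitrarily large `c`, then `-w ∈ C`. -/
theorem IsClosedPointedCone.neg_mem_of_frequently {C : Set E} (hC : IsClosedPointedCone C) {a w : E}
    (h : ∀ N : ℝ, ∃ c ≥ N, a - c • w ∈ C) : -w ∈ C := by
  choose c hcN hc using fun k : ℕ => h ((k : ℝ) + 1)
  have hpos : ∀ k, 0 < c k := fun k => lt_of_lt_of_le (by positivity) (hcN k)
  have hlim : Tendsto (fun k => (c k)⁻¹ • (a - c k • w)) atTop (𝓝 (-w)) := by
    have h1 : Tendsto c atTop atTop := tendsto_atTop_mono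
      (fun k => (le_add_of_nonneg_right zero_le_one).trans (hcN k)) tendsto_natCast_atTop_atTop
    have h2 : Tendsto (fun k => (c k)⁻¹ • a - w) atTop (𝓝 ((0 : ℝ) • a - w)) :=
      ((tendsto_inv_atTop_zero.comp h1).smul_const a).sub_const w
    rw [zero_smul, zero_sub] at h2
    refine h2.congr fun k => ?_
    rw [smul_sub, smul_smul, inv_mul_cancel₀ (hpos k).ne', one_smul]
  exact hC.isClosed.mem_of_tendsto hlim (Eventually.of_forall fun k =>
    hC.smul_mem _ (inv_nonneg.2 (hpos k).le) _ (hc k))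

/-- A closed pointed cone in which `a - α b` stays in the cone for some `α > 0`, for all nonzero
`a` and `b`, is a ray: subtract from `a` the largest possible multiple of `w`. -/
theorem IsClosedPointedCone.eq_ray {I : Set E} (hI : IsClosedPointedCone I)
    (h : ∀ a ∈ I, ∀ b ∈ I, a ≠ 0 → b ≠ 0 → ∃ α : ℝ, 0 < α ∧ a - α • b ∈ I)
    {w : E} (hw : w ∈ I) (hw0 : w ≠ 0) : I = {v | ∃ c : ℝ, 0 ≤ c ∧ v = c • w} := by
  ext a
  constructor
  · intro ha
    set S : Set ℝ := {c | 0 ≤ c ∧ a - c • w ∈ I} with hS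
    have h0 : (0 : ℝ) ∈ S := ⟨le_rfl, by simpa using ha⟩
    have hbdd : BddAbove S := by
      by_contra hb
      rw [not_bddAbove_iff] at hb
      refine hw0 (hI.eq_zero hw (hI.neg_mem_of_frequently (a := a) fun N => ?_))
      obtain ⟨c, hc, hN⟩ := hb N
      exact ⟨c, hN.le, hc.2⟩
    have hcl : IsClosed S := by
      refine (isClosed_Ici (a := (0 : ℝ))).inter (hI.isClosed.preimage ?_)
      fun_prop
    have hm := hcl.csSup_mem ⟨0, h0⟩ hbdd
    refine ⟨sSup S, hm.1, ?_⟩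
    by_contra hne
    obtain ⟨α, hα, hα'⟩ := h _ hm.2 w hw (fun h => hne (sub_eq_zero.1 h)) hw0
    have : sSup S + α ∈ S := ⟨by linarith [hm.1], by rwa [add_smul, ← sub_sub]⟩
    linarith [le_csSup hbdd this]
  · rintro ⟨c, hc, rfl⟩
    exact hI.smul_mem c hc w hw

/-- The order-unit bound given by an interior point of a cone. -/
theorem exists_smul_add_mem_of_mem_interior {C : Set E} (hC : IsClosedPointedCone C) {w : E}
    (hw : w ∈ interior C) : ∃ ρ > 0, ∀ v : E, (ρ * ‖v‖) • w + v ∈ C := by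
  obtain ⟨δ, hδ, hb⟩ := Metric.mem_nhds_iff.1 (mem_interior_iff_mem_nhds.1 hw)
  refine ⟨2 / δ, by positivity, fun v => ?_⟩
  rcases eq_or_ne v 0 with rfl | hv
  · simpa using hC.zero_mem
  have hv' : 0 < ‖v‖ := norm_pos_iff.2 hv
  have h1 : w + (δ / 2 / ‖v‖) • v ∈ C := hb (by
    rw [Metric.mem_ball, dist_eq_norm, add_sub_cancel_left, norm_smul, Real.norm_of_nonneg
      (by positivity), div_mul_cancel₀ _ hv'.ne']
    linarith)
  have h2 := hC.smul_mem (2 / δ * ‖v‖) (by positivity) _ h1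
  rwa [smul_add, smul_smul, show 2 / δ * ‖v‖ * (δ / 2 / ‖v‖) = 1 by field_simp, one_smul] at h2

variable [FiniteDimensional ℝ E]

/-- Vectors of a cone in the interior of `C` are uniformly comparable, since the unit vectors of
the smaller cone form a compact set. -/
theorem exists_comparableIn {C R : Set E} (hC : IsClosedPointedCone C) (hR : IsClosedPointedCone R)
    (hRC : R ⊆ interior C ∪ {0}) : ∃ Θ ≥ 1, ComparableIn C R Θ := by
  have hcpt : IsCompact (R ∩ Metric.sphere (0 : E) 1) :=
    (isCompact_sphere (0 : E) 1).inter_left hR.isClosed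
  have hsub : R ∩ Metric.sphere (0 : E) 1 ⊆ interior C := by
    rintro r ⟨hr, hr1⟩
    rcases hRC hr with h | h
    · exact h
    · rw [mem_singleton_iff.1 h] at hr1
      simp at hr1
  obtain ⟨δ, hδ, hthick⟩ := hcpt.exists_thickening_subset_open isOpen_interior hsub
  set ε := min (δ / 2) 1 with hεdef
  have hε : 0 < ε := lt_min (half_pos hδ) one_pos
  have hε1 : ε ≤ 1 := min_le_right _ _
  have key : ∀ r₁ ∈ R, ∀ r₂ ∈ R, r₁ ≠ 0 → r₂ ≠ 0 → r₁ - (ε * ‖r₁‖ / ‖r₂‖) • r₂ ∈ C := by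
    intro r₁ h₁ r₂ h₂ hn₁ hn₂
    have p₁ : 0 < ‖r₁‖ := norm_pos_iff.2 hn₁
    have p₂ : 0 < ‖r₂‖ := norm_pos_iff.2 hn₂
    have hmem : ‖r₁‖⁻¹ • r₁ - (ε / ‖r₂‖) • r₂ ∈ C := by
      refine interior_subset (hthick (Metric.mem_thickening_iff.2 ⟨‖r₁‖⁻¹ • r₁, ⟨hR.smul_mem _
        (inv_nonneg.2 p₁.le) _ h₁, ?_⟩, ?_⟩))
      · rw [mem_sphere_zero_iff_norm, norm_smul, norm_inv, norm_norm, inv_mul_cancel₀ p₁.ne']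
      · rw [dist_eq_norm, sub_sub_cancel_left, norm_neg, norm_smul, Real.norm_of_nonneg
          (by positivity), div_mul_cancel₀ _ p₂.ne']
        linarith [min_le_left (δ / 2) 1]
    have h3 := hC.smul_mem ‖r₁‖ p₁.le _ hmem
    rwa [smul_sub, smul_smul, smul_smul, mul_inv_cancel₀ p₁.ne', one_smul,
      show ‖r₁‖ * (ε / ‖r₂‖) = ε * ‖r₁‖ / ‖r₂‖ by ring] at h3
  refine ⟨(ε ^ 2)⁻¹, ?_, fun r₁ h₁ r₂ h₂ hn₁ hn₂ => ?_⟩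
  · rw [ge_iff_le, one_le_inv₀ (by positivity)]
    exact pow_le_one₀ hε.le hε1
  have p₁ : 0 < ‖r₁‖ := norm_pos_iff.2 hn₁
  have p₂ : 0 < ‖r₂‖ := norm_pos_iff.2 hn₂
  refine ⟨ε * ‖r₁‖ / ‖r₂‖, by positivity, key r₁ h₁ r₂ h₂ hn₁ hn₂, ?_⟩
  have h4 := hC.smul_mem (ε⁻¹ * ‖r₁‖ / ‖r₂‖) (by positivity) _ (key r₂ h₂ r₁ h₁ hn₂ hn₁)
  rwa [smul_sub, smul_smul, show ε⁻¹ * ‖r₁‖ / ‖r₂‖ * (ε * ‖r₂‖ / ‖r₁‖) = 1 by field_simp,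
    one_smul, show ε⁻¹ * ‖r₁‖ / ‖r₂‖ = (ε ^ 2)⁻¹ * (ε * ‖r₁‖ / ‖r₂‖) by field_simp] at h4

/-- Closed pointed cones in finite dimension are normal: order intervals `[-a, a]` are bounded
by a multiple of `‖a‖`. -/
theorem IsClosedPointedCone.exists_norm_le {C : Set E} (hC : IsClosedPointedCone C) :
    ∃ κ > 0, ∀ a z : E, a + z ∈ C → a - z ∈ C → ‖z‖ ≤ κ * ‖a‖ := by
  have hne : C.Nonempty := ⟨0, hC.zero_mem⟩
  rcases subsingleton_or_nontrivial E with hE | hE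
  · exact ⟨1, one_pos, fun a z _ _ => by rw [Subsingleton.elim z 0]; simp⟩
  have hcont : Continuous fun z : E => Metric.infDist z C + Metric.infDist (-z) C :=
    (Metric.continuous_infDist_pt C).add ((Metric.continuous_infDist_pt C).comp continuous_neg)
  obtain ⟨z₀, hz₀, hmin⟩ := (isCompact_sphere (0 : E) 1).exists_isMinOn
    (NormedSpace.sphere_nonempty.2 zero_le_one) hcont.continuousOn
  set m := Metric.infDist z₀ C + Metric.infDist (-z₀) C with hm
  have hm0 : 0 < m := by
    have h1 := Metric.infDist_nonneg (x := z₀) (s := C)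
    have h2 := Metric.infDist_nonneg (x := -z₀) (s := C)
    rcases (add_nonneg h1 h2).eq_or_lt with h | h
    · exfalso
      have h3 : z₀ ∈ C := (hC.isClosed.mem_iff_infDist_zero hne).2 (by linarith)
      have h4 : -z₀ ∈ C := (hC.isClosed.mem_iff_infDist_zero hne).2 (by linarith)
      rw [hC.eq_zero h3 h4] at hz₀
      simp at hz₀
    · exact h
  refine ⟨2 / m, by positivity, fun a z h₁ h₂ => ?_⟩
  rcases eq_or_ne z 0 with rfl | hz
  · rw [norm_zero]; positivity
  have hz' : 0 < ‖z‖ := norm_pos_iff.2 hz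
  have hle : m ≤ _ := hmin (show ‖z‖⁻¹ • z ∈ Metric.sphere (0 : E) 1 by
    rw [mem_sphere_zero_iff_norm, norm_smul, norm_inv, norm_norm, inv_mul_cancel₀ hz'.ne'])
  have e₁ : Metric.infDist (‖z‖⁻¹ • z) C ≤ ‖z‖⁻¹ * ‖a‖ := by
    refine (Metric.infDist_le_dist_of_mem (hC.smul_mem ‖z‖⁻¹ (inv_nonneg.2 hz'.le) _ h₁)).trans ?_
    rw [dist_eq_norm, ← smul_sub, norm_smul, norm_inv, norm_norm]
    refine mul_le_mul_of_nonneg_left ?_ (inv_nonneg.2 hz'.le)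
    rw [sub_add_cancel_right, norm_neg]
  have e₂ : Metric.infDist (-(‖z‖⁻¹ • z)) C ≤ ‖z‖⁻¹ * ‖a‖ := by
    refine (Metric.infDist_le_dist_of_mem (hC.smul_mem ‖z‖⁻¹ (inv_nonneg.2 hz'.le) _ h₂)).trans ?_
    rw [dist_eq_norm, ← smul_neg, ← smul_sub, norm_smul, norm_inv, norm_norm]
    refine mul_le_mul_of_nonneg_left (le_of_eq ?_) (inv_nonneg.2 hz'.le)
    rw [← norm_neg]; congr 1; abel
  have h5 : m ≤ 2 * (‖z‖⁻¹ * ‖a‖) := by linarith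
  have h6 : m * ‖z‖ ≤ 2 * ‖a‖ := by
    calc m * ‖z‖ ≤ 2 * (‖z‖⁻¹ * ‖a‖) * ‖z‖ := mul_le_mul_of_nonneg_right h5 hz'.le
      _ = 2 * ‖a‖ := by field_simp
  rw [div_mul_eq_mul_div, le_div_iff₀ hm0]
  linarith

omit [FiniteDimensional ℝ E] in
/-- A linear map that sends a cone `C` into a smaller cone `R` contracts order intervals around
its positive eigenvector `w`. -/
theorem exists_interval_contraction {C R : Set E} (hC : IsClosedPointedCone C) {Θ : ℝ}
    (hΘ : 1 ≤ Θ) (hcomp : ComparableIn C R Θ)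
    {B : E →L[ℝ] E} (hB : ∀ v ∈ C, B v ∈ R) {w : E} (hw : w ∈ C) (hw0 : w ≠ 0) (hBw : B w = w)
    {v : E} {a b : ℝ} (ha : v - a • w ∈ C) (hb : b • w - v ∈ C) :
    ∃ a' b', B v - a' • w ∈ C ∧ b' • w - B v ∈ C ∧ b' - a' ≤ (1 - Θ⁻¹) * (b - a) := by
  have hwR : w ∈ R := hBw ▸ hB w hw
  have hΘ0 : 0 < Θ := lt_of_lt_of_le one_pos hΘ
  have hBs : B (v - a • w) = B v - a • w := by rw [map_sub, map_smul, hBw]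
  have hab : a ≤ b := by
    by_contra h
    push Not at h
    have h1 := hC.add_mem _ ha _ hb
    have h2 : v - a • w + (b • w - v) = (a - b) • (-w) := by module
    rw [h2] at h1
    have h3 := hC.smul_mem (a - b)⁻¹ (inv_nonneg.2 (by linarith)) _ h1
    rw [smul_smul, inv_mul_cancel₀ (by linarith), one_smul] at h3
    exact hw0 (hC.eq_zero hw h3)
  have hΘ1 : 0 ≤ 1 - Θ⁻¹ := by
    have := inv_le_one_of_one_le₀ hΘ
    linarith
  rcases eq_or_ne (B v - a • w) 0 with h0 | h0
  · refine ⟨a, a, by rw [h0]; exact hC.zero_mem, ?_, ?_⟩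
    · rw [← neg_sub, h0, neg_zero]; exact hC.zero_mem
    · rw [sub_self]; exact mul_nonneg hΘ1 (by linarith)
  obtain ⟨α, hα, h1, h2⟩ := hcomp _ (hBs ▸ hB _ ha) w hwR h0 hw0
  have hRC : ∀ r ∈ R, r ≠ 0 → r ∈ C := fun r hr hr0 => by
    obtain ⟨β, hβ, h3, h4⟩ := hcomp r hr w hwR hr0 hw0
    have := hC.add_mem _ h3 _ (hC.smul_mem β hβ.le _ hw)
    rwa [sub_add_cancel] at this
  have hup : b • w - B v ∈ C := by
    have h3 : B (b • w - v) = b • w - B v := by rw [map_sub, map_smul, hBw]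
    rw [← h3]
    rcases eq_or_ne (B (b • w - v)) 0 with h | h
    · rw [h]; exact hC.zero_mem
    · exact hRC _ (hB _ hb) h
  have hlow : B v - (a + α) • w ∈ C := by rwa [add_smul, ← sub_sub]
  rcases le_total (b - a) (Θ * α) with h | h
  · refine ⟨a + α, b, hlow, hup, ?_⟩
    have : (b - a) * Θ⁻¹ ≤ α := by
      rw [← div_eq_mul_inv, div_le_iff₀ hΘ0]; linarith
    linarith
  · refine ⟨a + α, a + Θ * α, hlow, ?_, ?_⟩
    · have h3 : (a + Θ * α) • w - B v = (Θ * α) • w - (B v - a • w) := by module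
      rwa [h3]
    · have h3 : (1 - Θ⁻¹) * (Θ * α) ≤ (1 - Θ⁻¹) * (b - a) := mul_le_mul_of_nonneg_left h hΘ1
      have h4 : (1 - Θ⁻¹) * (Θ * α) = Θ * α - α := by field_simp
      linarith

/-- Perron-Frobenius theorem with spectral gap: a linear map that sends a cone into a cone in its
interior and has a positive eigenvector `w` is, up to an exponentially small relative error, the
projection onto `w` along the kernel of an eigenfunctional `p`. -/
theorem exists_perronFrobenius_functional {C R : Set E} (hC : IsClosedPointedCone C)
    (hR : IsClosedPointedCone R) (hRC : R ⊆ interior C ∪ {0}) {P : E →L[ℝ] E}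
    (hP : ∀ v ∈ C, P v ∈ R) {w : E} (hw : w ∈ interior C) (hw0 : w ≠ 0) {μ : ℝ} (hμ : 0 < μ)
    (hPw : P w = μ • w) :
    ∃ (p : E →L[ℝ] ℝ) (κ θ : ℝ), p w = 1 ∧ (∀ v, p (P v) = μ * p v) ∧ 0 ≤ θ ∧ θ < 1 ∧
      ∀ (j : ℕ) (v : E), ‖(P ^ j) v - (μ ^ j * p v) • w‖ ≤ κ * θ ^ j * μ ^ j * ‖v‖ := by
  obtain ⟨Θ, hΘ, hcomp⟩ := exists_comparableIn hC hR hRC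
  have hΘ0 : 0 < Θ := lt_of_lt_of_le one_pos hΘ
  obtain ⟨κ, hκ, hnormal⟩ := hC.exists_norm_le
  obtain ⟨ρ, hρ, hunit⟩ := exists_smul_add_mem_of_mem_interior hC hw
  have hwC : w ∈ C := interior_subset hw
  set B : E →L[ℝ] E := μ⁻¹ • P with hBdef
  have hBR : ∀ v ∈ C, B v ∈ R := fun v hv => hR.smul_mem _ (inv_nonneg.2 hμ.le) _ (hP v hv)
  have hRC' : ∀ r ∈ R, r ∈ C := fun r hr => by
    rcases hRC hr with h | h
    · exact interior_subset h
    · rw [mem_singleton_iff.1 h]; exact hC.zero_mem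
  have hBC : ∀ v ∈ C, B v ∈ C := fun v hv => hRC' _ (hBR v hv)
  have hBw : B w = w := by
    rw [hBdef, smul_apply, hPw, smul_smul, inv_mul_cancel₀ hμ.ne', one_smul]
  set θ := 1 - Θ⁻¹ with hθ
  have hθ0 : 0 ≤ θ := by
    have := inv_le_one_of_one_le₀ hΘ
    linarith
  have hθ1 : θ < 1 := by
    have : 0 < Θ⁻¹ := inv_pos.2 hΘ0
    linarith
  have hBs : ∀ j v, (B ^ (j + 1)) v = B ((B ^ j) v) := fun j v => by
    rw [pow_succ', mul_apply_eq_comp]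
  have hBjw : ∀ j, (B ^ j) w = w := fun j => by
    induction j with
    | zero => simp
    | succ j ih => rw [hBs, ih, hBw]
  have hBjC : ∀ j, ∀ v ∈ C, (B ^ j) v ∈ C := fun j => by
    induction j with
    | zero => intro v hv; simpa using hv
    | succ j ih => intro v hv; rw [hBs]; exact hBC _ (ih v hv)
  -- the limit of `B ^ j v` exists and lies on the line of `w`
  have hlim : ∀ v : E, ∃ c : ℝ, ∀ j : ℕ, ‖(B ^ j) v - c • w‖ ≤ κ * (2 * ρ * ‖w‖) * θ ^ j * ‖v‖ := by
    intro v
    have hint : ∀ j : ℕ, ∃ a b, (B ^ j) v - a • w ∈ C ∧ b • w - (B ^ j) v ∈ C ∧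
        b - a ≤ θ ^ j * (2 * ρ * ‖v‖) := by
      intro j
      induction j with
      | zero =>
        refine ⟨-(ρ * ‖v‖), ρ * ‖v‖, ?_, ?_, ?_⟩
        · have := hunit v
          simpa [add_comm] using this
        · have := hunit (-v)
          simpa [sub_eq_add_neg] using this
        · rw [pow_zero]; linarith
      | succ j ih =>
        obtain ⟨a, b, ha, hb, hab⟩ := ih
        obtain ⟨a', b', ha', hb', hab'⟩ :=
          exists_interval_contraction hC hΘ hcomp hBR hwC hw0 hBw ha hb
        refine ⟨a', b', by rwa [hBs], by rwa [hBs], hab'.trans ?_⟩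
        calc (1 - Θ⁻¹) * (b - a) ≤ θ * (θ ^ j * (2 * ρ * ‖v‖)) :=
              mul_le_mul_of_nonneg_left hab hθ0
          _ = _ := by ring
    choose a b ha hb hab using hint
    have hle : ∀ i j, a i ≤ b j := by
      intro i j
      by_contra h
      push Not at h
      have e1 : (B ^ (i + j)) v - a i • w ∈ C := by
        have := hBjC j _ (ha i)
        rwa [map_sub, map_smul, hBjw, ← mul_apply_eq_comp, ← pow_add, add_comm] at this
      have e2 : b j • w - (B ^ (i + j)) v ∈ C := by
        have := hBjC i _ (hb j)
        rwa [map_sub, map_smul, hBjw, ← mul_apply_eq_comp, ← pow_add] at this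
      have h1 := hC.add_mem _ e1 _ e2
      have h2 : (B ^ (i + j)) v - a i • w + (b j • w - (B ^ (i + j)) v) = (a i - b j) • (-w) := by
        module
      rw [h2] at h1
      have h3 := hC.smul_mem (a i - b j)⁻¹ (inv_nonneg.2 (by linarith)) _ h1
      rw [smul_smul, inv_mul_cancel₀ (by linarith), one_smul] at h3
      exact hw0 (hC.eq_zero hwC h3)
    have hbdd : BddAbove (range a) := ⟨b 0, by rintro _ ⟨i, rfl⟩; exact hle i 0⟩
    set c := sSup (range a) with hc
    have hac : ∀ j, a j ≤ c := fun j => le_csSup hbdd ⟨j, rfl⟩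
    have hcb : ∀ j, c ≤ b j := fun j => csSup_le ⟨a 0, 0, rfl⟩ (by rintro _ ⟨i, rfl⟩; exact hle i j)
    refine ⟨c, fun j => ?_⟩
    set D := θ ^ j * (2 * ρ * ‖v‖) with hD
    have hD0 : 0 ≤ D := by positivity
    have e1 : D • w + ((B ^ j) v - c • w) ∈ C := by
      have := hC.add_mem _ (ha j) _ (hC.smul_mem (D - c + a j) (by linarith [hab j, hcb j]) _ hwC)
      convert this using 1
      module
    have e2 : D • w - ((B ^ j) v - c • w) ∈ C := by
      have := hC.add_mem _ (hb j) _ (hC.smul_mem (D + c - b j) (by linarith [hab j, hac j]) _ hwC)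
      convert this using 1
      module
    refine (hnormal _ _ e1 e2).trans (le_of_eq ?_)
    rw [norm_smul, Real.norm_of_nonneg hD0, hD]
    ring
  choose c hc using hlim
  have htend : ∀ v, Tendsto (fun j : ℕ => (B ^ j) v) atTop (𝓝 (c v • w)) := by
    intro v
    rw [tendsto_iff_norm_sub_tendsto_zero]
    have h1 : Tendsto (fun j : ℕ => κ * (2 * ρ * ‖w‖) * θ ^ j * ‖v‖) atTop (𝓝 0) := by
      have := ((tendsto_pow_atTop_nhds_zero_of_lt_one hθ0 hθ1).const_mul
        (κ * (2 * ρ * ‖w‖))).mul_const ‖v‖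
      simpa using this
    exact squeeze_zero (fun _ => norm_nonneg _) (hc v) h1
  have huniq : ∀ v r, Tendsto (fun j : ℕ => (B ^ j) v) atTop (𝓝 (r • w)) → c v = r := fun v r h =>
    smul_left_injective ℝ hw0 (tendsto_nhds_unique (htend v) h)
  have hlin : IsLinearMap ℝ c := by
    constructor
    · intro x y
      refine huniq _ _ ?_
      rw [add_smul]
      simpa using (htend x).add (htend y)
    · intro r x
      refine huniq _ _ ?_
      rw [smul_eq_mul, mul_smul]
      simpa using (htend x).const_smul r
  set p : E →L[ℝ] ℝ := LinearMap.toContinuousLinearMap (hlin.mk' c) with hp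
  have hpc : ∀ v, p v = c v := fun v => rfl
  have hcB : ∀ v, c (B v) = c v := fun v => by
    refine huniq _ _ (((tendsto_add_atTop_iff_nat 1).2 (htend v)).congr fun j => ?_)
    rw [pow_succ, mul_apply_eq_comp]
  have hPB : P = μ • B := by
    rw [hBdef, smul_smul, mul_inv_cancel₀ hμ.ne', one_smul]
  refine ⟨p, κ * (2 * ρ * ‖w‖), θ, ?_, fun v => ?_, hθ0, hθ1, fun j v => ?_⟩
  · rw [hpc]
    refine huniq _ _ ?_
    simp only [hBjw, one_smul]
    exact tendsto_const_nhds
  · rw [hPB, smul_apply, map_smul, hpc, hpc, hcB, smul_eq_mul]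
  · have h1 : (P ^ j) v - (μ ^ j * p v) • w = μ ^ j • ((B ^ j) v - c v • w) := by
      rw [hPB, smul_pow, smul_apply, hpc, mul_smul, smul_sub]
    rw [h1, norm_smul, Real.norm_of_nonneg (by positivity)]
    calc μ ^ j * ‖(B ^ j) v - c v • w‖ ≤ μ ^ j * (κ * (2 * ρ * ‖w‖) * θ ^ j * ‖v‖) :=
          mul_le_mul_of_nonneg_left (hc v j) (by positivity)
      _ = _ := by ring

end ConeLemmas

/-! ### The cones seen from the infinite past -/

section PastCone

set_option linter.unusedSectionVars false

variable {n : ℕ} {X : Type*} [TopologicalSpace X] [T2Space X]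
  [ChartedSpace (EuclideanSpace ℝ (Fin n)) X] [IsManifold (𝓡 n) ∞ X]
  {f : (x : X) → TangentSpace (𝓡 n) x} {K : (x : X) → Set (TangentSpace (𝓡 n) x)}

/-- The standing assumptions: a complete `C²` vector field on a manifold of positive dimension
that is strictly differentially positive with respect to a smooth cone field. -/
structure IsPositiveSystem (f : (x : X) → TangentSpace (𝓡 n) x)
    (K : (x : X) → Set (TangentSpace (𝓡 n) x)) : Prop where
  contMDiff : ContMDiff (𝓡 n) (𝓡 n).tangent 2 (fun x => (⟨x, f x⟩ : TangentBundle (𝓡 n) X))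
  complete : IsCompleteField f
  cone : IsSmoothConeField K
  positive : IsStrictlyDifferentiallyPositive f K
  dim_pos : 0 < n

/-- The total space of a field of subsets of the tangent spaces. -/
def fieldTotal (K : (x : X) → Set (TangentSpace (𝓡 n) x)) : Set (TangentBundle (𝓡 n) X) :=
  {p | p.2 ∈ K p.1}

/-- A smooth cone field is upper semicontinuous. -/
theorem IsSmoothConeField.isClosed_fieldTotal (hK : IsSmoothConeField K) :
    IsClosed (fieldTotal K) := by
  refine isClosed_of_closure_subset fun p hp => ?_
  obtain ⟨U, hU, hpU, ι, k, hk, hmem⟩ := hK.smooth p.1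
  refine (hmem p.1 hpU p.2).2 fun i hi => ?_
  by_contra hneg
  push Not at hneg
  have hopen : IsOpen {q : TangentBundle (𝓡 n) X | q.proj ∈ U} :=
    hU.preimage (FiberBundle.continuous_proj (EuclideanSpace ℝ (Fin n))
      (TangentSpace (𝓡 n) : X → Type _))
  have hc : ContinuousAt (k i) p := (hk i hi).continuousOn.continuousAt (hopen.mem_nhds hpU)
  have hev : ∀ᶠ q in 𝓝 p, k i q < 0 ∧ q.proj ∈ U :=
    (hc.eventually_lt_const hneg).and (hopen.mem_nhds hpU)
  obtain ⟨q, hq, hqK⟩ := (mem_closure_iff_frequently.1 hp).and_eventually hev |>.exists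
  exact absurd ((hmem q.1 hqK.2 q.2).1 hq i hi) (not_le.2 hqK.1)

/-- Tangent vectors whose whole past lies in the cone field. -/
def pastCone (f : (x : X) → TangentSpace (𝓡 n) x) (K : (x : X) → Set (TangentSpace (𝓡 n) x))
    (x : X) : Set (TangentSpace (𝓡 n) x) :=
  {v | ∀ s : ℝ, 0 ≤ s → tflow f (-s) ⟨x, v⟩ ∈ fieldTotal K}

namespace IsPositiveSystem

variable (h : IsPositiveSystem f K)
include h

theorem tflow_neg_tflow (t : ℝ) (p : TangentBundle (𝓡 n) X) : tflow f (-t) (tflow f t p) = p := by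
  rw [← tflow_add h.contMDiff h.complete, neg_add_cancel, tflow_zero h.complete]

theorem tflow_tflow_neg (t : ℝ) (p : TangentBundle (𝓡 n) X) : tflow f t (tflow f (-t) p) = p := by
  rw [← tflow_add h.contMDiff h.complete, add_neg_cancel, tflow_zero h.complete]

theorem mfderiv_flow_eq_zero {t : ℝ} {x : X} {v : TangentSpace (𝓡 n) x}
    (hv : mfderiv (𝓡 n) (𝓡 n) (flow f t) x v = 0) : v = 0 := by
  have h1 : tflow f t ⟨x, v⟩ = tflow f t ⟨x, 0⟩ := by
    change (⟨flow f t x, mfderiv (𝓡 n) (𝓡 n) (flow f t) x v⟩ : TangentBundle (𝓡 n) X) =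
      ⟨flow f t x, mfderiv (𝓡 n) (𝓡 n) (flow f t) x 0⟩
    rw [hv, map_zero]
  have h2 := congrArg (tflow f (-t)) h1
  rw [h.tflow_neg_tflow, h.tflow_neg_tflow] at h2
  simpa using h2

theorem tflow_mem {p : TangentBundle (𝓡 n) X} (hp : p ∈ fieldTotal K) {t : ℝ} (ht : 0 ≤ t) :
    tflow f t p ∈ fieldTotal K := by
  refine h.positive.1 0 _ _ (isProlongedSolution_tflow h.contMDiff h.complete p) ?_ t ht
  change tflow f 0 p ∈ fieldTotal K
  rwa [tflow_zero h.complete]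

/-- Strict positivity, for the linearised flow: after time `T` the cones `K` are mapped into
cones `R` whose nonzero vectors are comparable in the order of `K`, with a uniform ratio. -/
theorem exists_comparable [Nonempty X] : ∃ T > 0,
    ∃ (R : (x : X) → Set (TangentSpace (𝓡 n) x)) (Θ : ℝ),
    (∀ x, IsClosedPointedCone (R x)) ∧ (∀ x, R x ⊆ interior (K x) ∪ {0}) ∧
    (∀ x, ComparableIn (K x) (R x) Θ) ∧
    ∀ p ∈ fieldTotal K, ∀ t, T ≤ t → tflow f t p ∈ fieldTotal R := by
  obtain ⟨T, hT, R, hR, hRK, ⟨Γ, hΓ⟩, hTR⟩ := h.positive.2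
  obtain ⟨x₀⟩ := ‹Nonempty X›
  obtain ⟨Θ, hΘ, hcomp⟩ := exists_comparableIn (E := EuclideanSpace ℝ (Fin n)) (C := K x₀)
    (R := R x₀) (h.cone.cone x₀) (hR x₀) (hRK x₀)
  refine ⟨T, hT, R, Θ, hR, hRK, fun x => ?_, fun p hp t ht => ?_⟩
  · have h1 : ComparableIn (V := TangentSpace (𝓡 n) x₀) (K x₀) (R x₀) Θ := hcomp
    have h2 := h1.map (Γ x₀ x)
    rwa [(hΓ x₀ x).1, (hΓ x₀ x).2] at h2
  · refine hTR 0 _ _ (isProlongedSolution_tflow h.contMDiff h.complete p) ?_ t (by linarith)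
    change tflow f 0 p ∈ fieldTotal K
    rwa [tflow_zero h.complete]

theorem pastCone_subset {x : X} {v : TangentSpace (𝓡 n) x} (hv : v ∈ pastCone f K x) : v ∈ K x := by
  have h1 := hv 0 le_rfl
  rw [neg_zero, tflow_zero h.complete] at h1
  exact h1

/-- The past conditions are nested. -/
theorem tflow_neg_mem_of_le {x : X} {v : TangentSpace (𝓡 n) x} {s s' : ℝ} (hs : s ≤ s')
    (hv : tflow f (-s') ⟨x, v⟩ ∈ fieldTotal K) : tflow f (-s) ⟨x, v⟩ ∈ fieldTotal K := by
  have h1 := h.tflow_mem hv (sub_nonneg.2 hs)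
  rwa [← tflow_add h.contMDiff h.complete, show s' - s + -s' = -s by ring] at h1

theorem isClosed_setOf_tflow_mem (t : ℝ) (x : X) :
    IsClosed {v : TangentSpace (𝓡 n) x | tflow f t ⟨x, v⟩ ∈ fieldTotal K} :=
  (h.cone.cone _).isClosed.preimage (mfderiv (𝓡 n) (𝓡 n) (flow f t) x).continuous

theorem isClosedPointedCone_pastCone (x : X) : IsClosedPointedCone (pastCone f K x) where
  isClosed := by
    have h1 : pastCone f K x = ⋂ (s : ℝ) (_ : 0 ≤ s),
        {v : TangentSpace (𝓡 n) x | tflow f (-s) ⟨x, v⟩ ∈ fieldTotal K} := by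
      ext v
      simp [pastCone]
    rw [h1]
    exact isClosed_iInter fun s => isClosed_iInter fun _ => h.isClosed_setOf_tflow_mem (-s) x
  add_mem v hv w hw s hs := by
    have h1 := (h.cone.cone (flow f (-s) x)).add_mem _ (hv s hs) _ (hw s hs)
    change mfderiv (𝓡 n) (𝓡 n) (flow f (-s)) x (v + w) ∈ K (flow f (-s) x)
    rw [map_add]
    exact h1
  smul_mem c hc v hv s hs := by
    have h1 := (h.cone.cone (flow f (-s) x)).smul_mem c hc _ (hv s hs)
    change mfderiv (𝓡 n) (𝓡 n) (flow f (-s)) x (c • v) ∈ K (flow f (-s) x)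
    rw [map_smul]
    exact h1
  pointed := by
    ext v
    constructor
    · rintro ⟨h1, h2⟩
      exact (h.cone.cone x).eq_zero (h.pastCone_subset h1) (h.pastCone_subset h2)
    · rintro rfl
      have h0 : (0 : TangentSpace (𝓡 n) x) ∈ pastCone f K x := fun s _ => by
        change mfderiv (𝓡 n) (𝓡 n) (flow f (-s)) x 0 ∈ K (flow f (-s) x)
        rw [map_zero]
        exact (h.cone.cone _).zero_mem
      exact ⟨h0, by simpa using h0⟩

/-- The past cone is a decreasing intersection of closed cones that contain unit vectors. -/
theorem exists_mem_pastCone (x : X) : ∃ v ∈ pastCone f K x, v ≠ 0 := by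
  -- nonempty compact sets of unit vectors, decreasing with the time
  let S : ℕ → Set (EuclideanSpace ℝ (Fin n)) := fun k =>
    {v | tflow f (-(k : ℝ)) (⟨x, v⟩ : TangentBundle (𝓡 n) X) ∈ fieldTotal K} ∩ Metric.sphere 0 1
  have hcl : ∀ k : ℕ, IsClosed {v : EuclideanSpace ℝ (Fin n) |
      tflow f (-(k : ℝ)) (⟨x, v⟩ : TangentBundle (𝓡 n) X) ∈ fieldTotal K} := fun k =>
    h.isClosed_setOf_tflow_mem _ x
  have hScl : ∀ k, IsClosed (S k) := fun k => (hcl k).inter Metric.isClosed_sphere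
  have hne : ∀ k, (S k).Nonempty := by
    intro k
    obtain ⟨b, hb, hbK⟩ := h.cone.solid (flow f (-(k : ℝ)) x)
    set u := b ⟨0, h.dim_pos⟩ with hu
    have hu0 : u ≠ 0 := hb.ne_zero _
    set q : TangentBundle (𝓡 n) X := ⟨flow f (-(k : ℝ)) x, u⟩ with hq
    obtain ⟨v, hv⟩ : ∃ v : EuclideanSpace ℝ (Fin n),
        tflow f (-(k : ℝ)) (⟨x, v⟩ : TangentBundle (𝓡 n) X) = q := by
      have h1 : (tflow f k q).1 = x := flow_flow_neg h.contMDiff h.complete _ _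
      have h2 := h.tflow_neg_tflow k q
      generalize tflow f k q = p at h1 h2
      obtain ⟨p₁, p₂⟩ := p
      subst h1
      exact ⟨p₂, h2⟩
    have hv0 : v ≠ 0 := by
      rintro rfl
      have h3 : mfderiv (𝓡 n) (𝓡 n) (flow f (-(k : ℝ))) x 0 = u := by
        have h4 : (⟨flow f (-(k : ℝ)) x, mfderiv (𝓡 n) (𝓡 n) (flow f (-(k : ℝ))) x 0⟩ :
          TangentBundle (𝓡 n) X) = ⟨flow f (-(k : ℝ)) x, u⟩ := hv
        simpa using h4
      rw [map_zero] at h3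
      exact hu0 h3.symm
    have hv' : 0 < ‖v‖ := norm_pos_iff.2 hv0
    refine ⟨‖v‖⁻¹ • v, ?_, ?_⟩
    · have h5 : tflow f (-(k : ℝ)) (⟨x, v⟩ : TangentBundle (𝓡 n) X) ∈ fieldTotal K := by
        rw [hv]
        exact hbK _
      have h6 : ∀ (c : ℝ) (r : TangentSpace (𝓡 n) x), 0 ≤ c →
          tflow f (-(k : ℝ)) ⟨x, r⟩ ∈ fieldTotal K →
          tflow f (-(k : ℝ)) ⟨x, c • r⟩ ∈ fieldTotal K := by
        intro c r hc hr
        change mfderiv (𝓡 n) (𝓡 n) (flow f (-(k : ℝ))) x (c • r) ∈ K (flow f (-(k : ℝ)) x)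
        rw [map_smul]
        exact (h.cone.cone _).smul_mem c hc _ hr
      exact h6 _ v (inv_nonneg.2 hv'.le) h5
    · rw [mem_sphere_zero_iff_norm, norm_smul, norm_inv, norm_norm, inv_mul_cancel₀ hv'.ne']
  obtain ⟨v, hv⟩ := IsCompact.nonempty_iInter_of_sequence_nonempty_isCompact_isClosed S
    (fun k v hv => ⟨h.tflow_neg_mem_of_le (by push_cast; linarith) hv.1, hv.2⟩) hne
    ((isCompact_sphere _ _).inter_left (hcl 0)) hScl
  rw [mem_iInter] at hv
  refine ⟨v, fun s _ => ?_, ?_⟩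
  · obtain ⟨k, hk⟩ := exists_nat_ge s
    exact h.tflow_neg_mem_of_le hk (hv k).1
  · intro h0
    have h1 := (hv 0).2
    have h2 : v = (0 : EuclideanSpace ℝ (Fin n)) := h0
    rw [h2, mem_sphere_zero_iff_norm, norm_zero] at h1
    exact zero_ne_one h1

/-- Nonzero vectors of the past cone are uniformly comparable, because at every past time they
come from the cones `R`. -/
theorem exists_sub_smul_mem_pastCone {x : X} {a b : TangentSpace (𝓡 n) x}
    (ha : a ∈ pastCone f K x) (hb : b ∈ pastCone f K x) (ha0 : a ≠ 0) (hb0 : b ≠ 0) :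
    ∃ α : ℝ, 0 < α ∧ a - α • b ∈ pastCone f K x := by
  have : Nonempty X := ⟨x⟩
  obtain ⟨T, hT, R, Θ, hR, hRK, hcomp, hTR⟩ := h.exists_comparable
  have hpastR : ∀ v ∈ pastCone f K x, ∀ s, 0 ≤ s →
      mfderiv (𝓡 n) (𝓡 n) (flow f (-s)) x v ∈ R (flow f (-s) x) := by
    intro v hv s hs
    have h1 := hTR _ (hv (s + T) (by linarith)) T le_rfl
    rw [← tflow_add h.contMDiff h.complete, show T + -(s + T) = -s by ring] at h1
    exact h1
  have hα : ∀ k : ℕ, ∃ α : ℝ, 0 < α ∧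
      mfderiv (𝓡 n) (𝓡 n) (flow f (-(k : ℝ))) x (a - α • b) ∈ K (flow f (-(k : ℝ)) x) ∧
      mfderiv (𝓡 n) (𝓡 n) (flow f (-(k : ℝ))) x ((Θ * α) • b - a) ∈ K (flow f (-(k : ℝ)) x) := by
    intro k
    obtain ⟨α, hα, h1, h2⟩ := hcomp _ _ (hpastR a ha k (by positivity)) _
      (hpastR b hb k (by positivity)) (fun h0 => ha0 (h.mfderiv_flow_eq_zero h0))
      (fun h0 => hb0 (h.mfderiv_flow_eq_zero h0))
    refine ⟨α, hα, ?_, ?_⟩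
    · rwa [map_sub, map_smul]
    · rwa [map_sub, map_smul]
  choose α hα0 hα1 hα2 using hα
  -- the ratios are bounded below, since `-a ∉ K x`
  obtain ⟨β, hβ, hβα⟩ : ∃ β > 0, ∀ k, β ≤ α k := by
    by_contra hcon
    push Not at hcon
    have hmem : ∀ ε : ℝ, 0 < ε → (Θ * ε) • b - a ∈ K x := by
      intro ε hε
      obtain ⟨k, hk⟩ := hcon ε hε
      have h1 : (Θ * α k) • b - a ∈ K x := by
        have h2 := h.tflow_neg_mem_of_le (s := 0) (s' := k) (v := (Θ * α k) • b - a)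
          (by positivity) (hα2 k)
        rw [neg_zero, tflow_zero h.complete] at h2
        exact h2
      have hΘ : 0 ≤ Θ := by
        obtain ⟨γ, hγ, h3, h4⟩ := hcomp _ _ (hpastR b hb 0 le_rfl) _ (hpastR b hb 0 le_rfl)
          (fun h0 => hb0 (h.mfderiv_flow_eq_zero h0)) (fun h0 => hb0 (h.mfderiv_flow_eq_zero h0))
        by_contra hneg
        push Not at hneg
        set r := mfderiv (𝓡 n) (𝓡 n) (flow f (-0)) x b with hr
        have hrK : r ∈ K _ := hb 0 le_rfl
        have hr0 : r ≠ 0 := fun h0 => hb0 (h.mfderiv_flow_eq_zero h0)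
        have h5 := (h.cone.cone _).add_mem _ h4 _
          ((h.cone.cone _).smul_mem (-(Θ * γ)) (by nlinarith) _ hrK)
        have h6 : (Θ * γ) • r - r + (-(Θ * γ)) • r = -r := by module
        rw [h6] at h5
        exact hr0 ((h.cone.cone _).eq_zero hrK h5)
      have h5 := (h.cone.cone x).add_mem _ h1 _ ((h.cone.cone x).smul_mem (Θ * (ε - α k))
        (mul_nonneg hΘ (by linarith)) _ (h.pastCone_subset hb))
      convert h5 using 1
      module
    have hlim : -a ∈ K x := by
      have h1 : Tendsto (fun ε : ℝ => (Θ * ε) • b - a) (𝓝[>] 0) (𝓝 ((Θ * 0) • b - a)) := by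
        have h2 : Continuous (fun ε : ℝ => (Θ * ε) • b - a) := by fun_prop
        exact (h2.tendsto 0).mono_left nhdsWithin_le_nhds
      rw [mul_zero, zero_smul, zero_sub] at h1
      refine (h.cone.cone x).isClosed.mem_of_tendsto h1 ?_
      filter_upwards [self_mem_nhdsWithin] with ε hε
      exact hmem ε hε
    exact ha0 ((h.cone.cone x).eq_zero (h.pastCone_subset ha) hlim)
  refine ⟨β, hβ, fun s _ => ?_⟩
  obtain ⟨k, hk⟩ := exists_nat_ge s
  refine h.tflow_neg_mem_of_le hk ?_
  have h1 := (h.cone.cone _).add_mem _ (hα1 k) _ ((h.cone.cone _).smul_mem (α k - β)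
    (by linarith [hβα k]) _ (hb k (by positivity)))
  have h2 : mfderiv (𝓡 n) (𝓡 n) (flow f (-(k : ℝ))) x (a - β • b) =
      mfderiv (𝓡 n) (𝓡 n) (flow f (-(k : ℝ))) x (a - α k • b) +
        (α k - β) • mfderiv (𝓡 n) (𝓡 n) (flow f (-(k : ℝ))) x b := by
    rw [← map_smul, ← map_add]
    congr 1
    module
  change mfderiv (𝓡 n) (𝓡 n) (flow f (-(k : ℝ))) x (a - β • b) ∈ K _
  rw [h2]
  exact h1

theorem pastCone_eq_ray {x : X} {w : TangentSpace (𝓡 n) x} (hw : w ∈ pastCone f K x)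
    (hw0 : w ≠ 0) : pastCone f K x = {v | ∃ c : ℝ, 0 ≤ c ∧ v = c • w} :=
  IsClosedPointedCone.eq_ray (E := EuclideanSpace ℝ (Fin n)) (h.isClosedPointedCone_pastCone x)
    (fun _ ha _ hb ha0 hb0 => h.exists_sub_smul_mem_pastCone ha hb ha0 hb0) hw hw0

theorem pastCone_subset_interior {x : X} {v : TangentSpace (𝓡 n) x} (hv : v ∈ pastCone f K x)
    (hv0 : v ≠ 0) : v ∈ interior (K x) := by
  have : Nonempty X := ⟨x⟩
  obtain ⟨T, hT, R, Θ, hR, hRK, hcomp, hTR⟩ := h.exists_comparable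
  have h1 := hTR _ (hv T hT.le) T le_rfl
  rw [h.tflow_tflow_neg] at h1
  exact (hRK x h1).resolve_right hv0

/-- The linearised flow preserves the field of past cones. -/
theorem mfderiv_flow_mem_pastCone {x : X} {v : TangentSpace (𝓡 n) x} (hv : v ∈ pastCone f K x)
    (t : ℝ) : mfderiv (𝓡 n) (𝓡 n) (flow f t) x v ∈ pastCone f K (flow f t x) := by
  intro s hs
  change tflow f (-s) (tflow f t ⟨x, v⟩) ∈ fieldTotal K
  rw [← tflow_add h.contMDiff h.complete]
  rcases le_total t s with hts | hts
  · rw [show -s + t = -(s - t) by ring]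
    exact hv _ (by linarith)
  · exact h.tflow_mem (p := ⟨x, v⟩) (h.pastCone_subset hv) (by linarith)

/-- The images of the cones along the past converge to the past cone. -/
theorem kuratowskiTendsto_pastCone (x : X) :
    KuratowskiTendsto
      (fun s : ℝ => {v' : TangentSpace (𝓡 n) x | ∃ u ∈ K (flow f s x),
        tangentMap (𝓡 n) (𝓡 n) (flow f (-s)) (⟨flow f s x, u⟩ : TangentBundle (𝓡 n) X) =
          (⟨x, v'⟩ : TangentBundle (𝓡 n) X)})
      atBot (pastCone f K x) := by
  have hS : ∀ (s : ℝ) (v' : TangentSpace (𝓡 n) x), (∃ u ∈ K (flow f s x),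
      tangentMap (𝓡 n) (𝓡 n) (flow f (-s)) (⟨flow f s x, u⟩ : TangentBundle (𝓡 n) X) =
        (⟨x, v'⟩ : TangentBundle (𝓡 n) X)) ↔ tflow f (- -s) ⟨x, v'⟩ ∈ fieldTotal K := by
    intro s v'
    rw [neg_neg]
    constructor
    · rintro ⟨u, hu, hv⟩
      rw [← hv]
      change tflow f s (tflow f (-s) _) ∈ fieldTotal K
      rw [h.tflow_tflow_neg]
      exact hu
    · intro hv
      exact ⟨_, hv, h.tflow_neg_tflow s ⟨x, v'⟩⟩
  simp only [hS]
  have hin : pastCone f K x ⊆ {v | ∀ U ∈ 𝓝 v, ∀ᶠ s : ℝ in atBot,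
      ({v' : TangentSpace (𝓡 n) x | tflow f (- -s) ⟨x, v'⟩ ∈ fieldTotal K} ∩ U).Nonempty} := by
    intro v hv U hU
    filter_upwards [eventually_le_atBot (0 : ℝ)] with s hs
    exact ⟨v, hv (-s) (by linarith), mem_of_mem_nhds hU⟩
  have hout : {v | ∀ U ∈ 𝓝 v, ∃ᶠ s : ℝ in atBot,
      ({v' : TangentSpace (𝓡 n) x | tflow f (- -s) ⟨x, v'⟩ ∈ fieldTotal K} ∩ U).Nonempty} ⊆
      pastCone f K x := by
    intro v hv r hr
    by_contra hcon
    have hU : {v' : TangentSpace (𝓡 n) x | tflow f (-r) ⟨x, v'⟩ ∈ fieldTotal K}ᶜ ∈ 𝓝 v :=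
      (h.isClosed_setOf_tflow_mem (-r) x).isOpen_compl.mem_nhds hcon
    obtain ⟨s, ⟨v', hv', hv''⟩, hs⟩ :=
      ((hv _ hU).and_eventually (eventually_le_atBot (-r))).exists
    exact hv'' (h.tflow_neg_mem_of_le (by linarith) hv')
  have hio : {v | ∀ U ∈ 𝓝 v, ∀ᶠ s : ℝ in atBot,
      ({v' : TangentSpace (𝓡 n) x | tflow f (- -s) ⟨x, v'⟩ ∈ fieldTotal K} ∩ U).Nonempty} ⊆
      {v | ∀ U ∈ 𝓝 v, ∃ᶠ s : ℝ in atBot,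
      ({v' : TangentSpace (𝓡 n) x | tflow f (- -s) ⟨x, v'⟩ ∈ fieldTotal K} ∩ U).Nonempty} :=
    fun v hv U hU => (hv U hU).frequently
  exact ⟨(hio.trans hout).antisymm hin, hout.antisymm (hin.trans hio)⟩

end IsPositiveSystem

end PastCone

/-! ### The Perron-Frobenius vector field and its growth -/

section PerronFrobenius

set_option linter.unusedSectionVars false

variable {n : ℕ} {X : Type*} [TopologicalSpace X] [T2Space X]
  [ChartedSpace (EuclideanSpace ℝ (Fin n)) X] [IsManifold (𝓡 n) ∞ X]
  [RiemannianBundle (fun x : X => TangentSpace (𝓡 n) x)]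
  {f : (x : X) → TangentSpace (𝓡 n) x} {K : (x : X) → Set (TangentSpace (𝓡 n) x)}

/-- The growth factor `|∂ψ_t(x) w(x)|` of the Perron-Frobenius vector field `w`. -/
noncomputable def pfGrowth (f : (x : X) → TangentSpace (𝓡 n) x)
    (K : (x : X) → Set (TangentSpace (𝓡 n) x)) (t : ℝ) (x : X) : ℝ :=
  ‖mfderiv (𝓡 n) (𝓡 n) (flow f t) x (perronFrobenius f K x)‖

theorem continuous_norm_tangentBundle
    [IsContinuousRiemannianBundle (EuclideanSpace ℝ (Fin n)) (fun x : X => TangentSpace (𝓡 n) x)] :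
    Continuous (fun p : TangentBundle (𝓡 n) X => ‖p.2‖) := by
  have h1 : Continuous (fun p : TangentBundle (𝓡 n) X => inner ℝ p.2 p.2) :=
    Continuous.inner_bundle (F := EuclideanSpace ℝ (Fin n))
      (E := fun x : X => TangentSpace (𝓡 n) x) (b := fun p : TangentBundle (𝓡 n) X => p.1)
      (v := fun p => p.2) (w := fun p => p.2) continuous_id continuous_id
  have h2 : (fun p : TangentBundle (𝓡 n) X => ‖p.2‖) = fun p => √(inner ℝ p.2 p.2) := by
    ext p
    exact norm_eq_sqrt_real_inner p.2
  rw [h2]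
  exact h1.sqrt

namespace IsPositiveSystem

variable (h : IsPositiveSystem f K)
include h

theorem isPerronFrobeniusVector_perronFrobenius (x : X) :
    IsPerronFrobeniusVector f K x (perronFrobenius f K x) := by
  have hex : ∃ v, IsPerronFrobeniusVector f K x v := by
    obtain ⟨v, hv, hv0⟩ := h.exists_mem_pastCone x
    have hn : 0 < ‖v‖ := norm_pos_iff.2 hv0
    have hw : ‖v‖⁻¹ • v ∈ pastCone f K x :=
      (h.isClosedPointedCone_pastCone x).smul_mem _ (inv_nonneg.2 hn.le) _ hv
    have hw0 : ‖v‖⁻¹ • v ≠ 0 := smul_ne_zero (inv_ne_zero hn.ne') hv0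
    refine ⟨‖v‖⁻¹ • v, h.pastCone_subset_interior hw hw0, ?_, ?_⟩
    · rw [norm_smul, norm_inv, norm_norm, inv_mul_cancel₀ hn.ne']
    · rw [← h.pastCone_eq_ray hw hw0]
      exact h.kuratowskiTendsto_pastCone x
  rw [perronFrobenius, dif_pos hex]
  exact hex.choose_spec

theorem norm_perronFrobenius (x : X) : ‖perronFrobenius f K x‖ = 1 :=
  (h.isPerronFrobeniusVector_perronFrobenius x).2.1

theorem perronFrobenius_ne_zero (x : X) : perronFrobenius f K x ≠ 0 :=
  norm_ne_zero_iff.1 (by rw [h.norm_perronFrobenius]; exact one_ne_zero)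

theorem perronFrobenius_mem_interior (x : X) : perronFrobenius f K x ∈ interior (K x) :=
  (h.isPerronFrobeniusVector_perronFrobenius x).1

theorem mem_pastCone_iff {x : X} {v : TangentSpace (𝓡 n) x} :
    v ∈ pastCone f K x ↔ ∃ c : ℝ, 0 ≤ c ∧ v = c • perronFrobenius f K x := by
  have h1 : pastCone f K x = {v' | ∃ c : ℝ, 0 ≤ c ∧ v' = c • perronFrobenius f K x} :=
    (h.kuratowskiTendsto_pastCone x).1.symm.trans
      (h.isPerronFrobeniusVector_perronFrobenius x).2.2.1
  rw [h1]
  rfl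

theorem perronFrobenius_mem_pastCone (x : X) : perronFrobenius f K x ∈ pastCone f K x :=
  h.mem_pastCone_iff.2 ⟨1, zero_le_one, (one_smul _ _).symm⟩

/-- The Perron-Frobenius vector field is invariant up to the growth factor. -/
theorem mfderiv_flow_perronFrobenius (t : ℝ) (x : X) :
    mfderiv (𝓡 n) (𝓡 n) (flow f t) x (perronFrobenius f K x) =
      pfGrowth f K t x • perronFrobenius f K (flow f t x) := by
  obtain ⟨c, hc, hv⟩ := h.mem_pastCone_iff.1
    (h.mfderiv_flow_mem_pastCone (h.perronFrobenius_mem_pastCone x) t)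
  have h1 : pfGrowth f K t x = c := by
    rw [pfGrowth, hv, norm_smul, h.norm_perronFrobenius, mul_one, Real.norm_of_nonneg hc]
  rw [h1, hv]

theorem pfGrowth_pos (t : ℝ) (x : X) : 0 < pfGrowth f K t x :=
  norm_pos_iff.2 fun h0 => h.perronFrobenius_ne_zero x (h.mfderiv_flow_eq_zero h0)

theorem pfGrowth_add (s t : ℝ) (x : X) :
    pfGrowth f K (s + t) x = pfGrowth f K t x * pfGrowth f K s (flow f t x) := by
  have h2 := congrArg (fun p : TangentBundle (𝓡 n) X => ‖p.2‖)
    (tflow_add h.contMDiff h.complete s t ⟨x, perronFrobenius f K x⟩)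
  have h3 : tflow f t ⟨x, perronFrobenius f K x⟩ = (⟨flow f t x,
      pfGrowth f K t x • perronFrobenius f K (flow f t x)⟩ : TangentBundle (𝓡 n) X) := by
    rw [← h.mfderiv_flow_perronFrobenius]
    rfl
  rw [h3] at h2
  refine h2.trans ?_
  change ‖mfderiv (𝓡 n) (𝓡 n) (flow f s) (flow f t x)
    (pfGrowth f K t x • perronFrobenius f K (flow f t x))‖ = _
  rw [map_smul, norm_smul, Real.norm_of_nonneg (h.pfGrowth_pos t x).le]
  rfl

variable [IsContinuousRiemannianBundle (EuclideanSpace ℝ (Fin n))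
  (fun x : X => TangentSpace (𝓡 n) x)]

/-- A limit of Perron-Frobenius vectors is a unit vector whose past lies in the cone field, since
the cone field has a closed total space. Hence it is the Perron-Frobenius vector of the limit. -/
theorem continuous_perronFrobenius :
    Continuous (fun x => (⟨x, perronFrobenius f K x⟩ : TangentBundle (𝓡 n) X)) := by
  rw [continuous_iff_continuousAt]
  intro x
  rw [ContinuousAt, tendsto_tangentBundle_iff (y := x) (mem_extChartAt_source x)]
  refine ⟨tendsto_id, ?_⟩
  change Tendsto (fun y => coordVec x y (perronFrobenius f K y)) (𝓝 x)
    (𝓝 (coordVec x x (perronFrobenius f K x)))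
  obtain ⟨C, hC, hev⟩ := eventually_norm_trivializationAt_lt (EuclideanSpace ℝ (Fin n))
    (fun x : X => TangentSpace (𝓡 n) x) x
  refine (isCompact_closedBall (0 : EuclideanSpace ℝ (Fin n)) C).tendsto_nhds_of_unique_mapClusterPt
    ?_ ?_
  · have hbase : ∀ᶠ y in 𝓝 x, y ∈ (trivializationAt (EuclideanSpace ℝ (Fin n))
        (TangentSpace (𝓡 n) : X → Type _) x).baseSet :=
      (trivializationAt (EuclideanSpace ℝ (Fin n)) (TangentSpace (𝓡 n) : X → Type _)
        x).open_baseSet.mem_nhds (FiberBundle.mem_baseSet_trivializationAt' x)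
    filter_upwards [hev, hbase] with y hy hyb
    rw [mem_closedBall_zero_iff]
    have h1 := ContinuousLinearMap.le_opNorm ((trivializationAt (EuclideanSpace ℝ (Fin n))
      (fun x : X => TangentSpace (𝓡 n) x) x).continuousLinearMapAt ℝ y) (perronFrobenius f K y)
    rw [h.norm_perronFrobenius, mul_one, Trivialization.continuousLinearMapAt_apply,
      Trivialization.linearMapAt_apply, if_pos hyb] at h1
    exact h1.trans hy.le
  · intro e _ he
    obtain ⟨U, hU, hUe⟩ := mapClusterPt_iff_ultrafilter.1 he
    have hlim : Tendsto (fun y => (⟨y, perronFrobenius f K y⟩ : TangentBundle (𝓡 n) X)) U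
        (𝓝 (⟨x, e⟩ : TangentBundle (𝓡 n) X)) := by
      rw [tendsto_tangentBundle_iff (y := x) (mem_extChartAt_source x)]
      refine ⟨hU, ?_⟩
      rw [show coordVec x x e = e from coordVec_self x e]
      exact hUe
    have hpast : e ∈ pastCone f K x := by
      intro s hs
      have hc : Continuous (tflow f (-s)) :=
        (continuous_tflow h.contMDiff h.complete).comp (by fun_prop : Continuous
          fun p : TangentBundle (𝓡 n) X => (-s, p))
      refine h.cone.isClosed_fieldTotal.mem_of_tendsto ((hc.tendsto _).comp hlim) ?_
      exact Eventually.of_forall fun y => h.perronFrobenius_mem_pastCone y s hs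
    obtain ⟨c, hc, hec⟩ := h.mem_pastCone_iff.1 hpast
    have hnorm : ‖c • perronFrobenius f K x‖ = 1 := by
      have h2 := (continuous_norm_tangentBundle.tendsto _).comp hlim
      refine tendsto_nhds_unique (f := fun _ : X => (1 : ℝ)) (l := (U : Filter X)) ?_
        tendsto_const_nhds
      rw [← hec]
      refine h2.congr fun y => ?_
      exact h.norm_perronFrobenius y
    rw [norm_smul, h.norm_perronFrobenius, mul_one, Real.norm_of_nonneg hc] at hnorm
    rw [hnorm, one_smul] at hec
    rw [hec]
    exact (coordVec_self x _).symm

theorem continuous_pfGrowth : Continuous (fun q : ℝ × X => pfGrowth f K q.1 q.2) := by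
  have h1 : Continuous (fun q : ℝ × X =>
      tflow f q.1 (⟨q.2, perronFrobenius f K q.2⟩ : TangentBundle (𝓡 n) X)) :=
    (continuous_tflow h.contMDiff h.complete).comp
      (continuous_fst.prodMk (h.continuous_perronFrobenius.comp continuous_snd))
  exact continuous_norm_tangentBundle.comp h1

end IsPositiveSystem

end PerronFrobenius

/-! ### Multiplicative cocycles over a flow -/

section Cocycle

variable {X : Type*} [TopologicalSpace X] [T2Space X] (φ : Flow ℝ X) {C : Set X} {p : X}

theorem omegaLimit_singleton_subset (hC : IsCompact C) (hp : ∀ t, 0 ≤ t → φ t p ∈ C) :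
    omegaLimit atTop φ {p} ⊆ C := by
  refine (omegaLimit_subset_closure_image2 atTop φ {p} (Ici_mem_atTop (0 : ℝ))).trans ?_
  refine closure_minimal ?_ hC.isClosed
  rintro _ ⟨t, ht, x, rfl, rfl⟩
  exact hp t ht

theorem omegaLimit_singleton_nonempty (hC : IsCompact C) (hp : ∀ t, 0 ≤ t → φ t p ∈ C) :
    (omegaLimit atTop φ {p}).Nonempty := by
  refine nonempty_omegaLimit_of_isCompact_absorbing atTop φ {p} hC
    ⟨Ici 0, Ici_mem_atTop (0 : ℝ), closure_minimal ?_ hC.isClosed⟩ (singleton_nonempty p)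
  rintro _ ⟨t, ht, x, rfl, rfl⟩
  exact hp t ht

omit [T2Space X] in
theorem omegaLimit_singleton_invariant {y : X} (hy : y ∈ omegaLimit atTop φ {p}) (t : ℝ) :
    φ t y ∈ omegaLimit atTop φ {p} :=
  φ.isInvariant_omegaLimit atTop {p} (fun t => tendsto_atTop_add_const_left atTop t tendsto_id) t hy

omit [T2Space X] in
theorem omegaLimit_singleton_subset_of_mem {y : X} (hy : y ∈ omegaLimit atTop φ {p}) :
    omegaLimit atTop φ {y} ⊆ omegaLimit atTop φ {p} :=
  (omegaLimit_mono_right atTop φ (singleton_subset_iff.2 hy)).trans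
    (φ.omegaLimit_omegaLimit atTop {p}
      (fun t => tendsto_atTop_add_const_left atTop t tendsto_id))

/-- If a positive multiplicative cocycle exceeds `2` at some positive time over each point of a
limit set, then it grows without bound along the orbit: compactness yields finitely many times
that serve for all late points of the orbit, and the factors `2` accumulate. -/
theorem tendsto_atTop_of_cocycle (hC : IsCompact C) (hp : ∀ t, 0 ≤ t → φ t p ∈ C)
    {G : ℝ → X → ℝ} (hG : Continuous (fun q : ℝ × X => G q.1 q.2)) (hpos : ∀ t x, 0 < G t x)
    (hadd : ∀ s t x, G (s + t) x = G t x * G s (φ t x))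
    (hexp : ∀ y ∈ omegaLimit atTop φ {p}, ∃ t, 0 < t ∧ 2 < G t y) :
    Tendsto (fun t => G t p) atTop atTop := by
  choose! τ hτ0 hτ using hexp
  have hcpt : IsCompact (omegaLimit atTop φ {p}) :=
    hC.of_isClosed_subset (isClosed_omegaLimit _ _ _) (omegaLimit_singleton_subset φ hC hp)
  let U : X → Set X := fun y => {q | 2 < G (τ y) q}
  have hU : ∀ y, IsOpen (U y) := fun y =>
    isOpen_lt continuous_const (hG.comp (by fun_prop : Continuous fun q : X => (τ y, q)))
  obtain ⟨s, hs, hcov⟩ := hcpt.elim_nhds_subcover U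
    (fun y hy => (hU y).mem_nhds (hτ y hy))
  have hsne : s.Nonempty := by
    obtain ⟨y, hy⟩ := omegaLimit_singleton_nonempty φ hC hp
    obtain ⟨x, hx, -⟩ := mem_iUnion₂.1 (hcov hy)
    exact ⟨x, hx⟩
  obtain ⟨a, ha, hamin⟩ := s.exists_min_image τ hsne
  obtain ⟨b, hb, hbmax⟩ := s.exists_max_image τ hsne
  have hta : 0 < τ a := hτ0 a (hs a ha)
  have htb : 0 < τ b := hτ0 b (hs b hb)
  have hev := eventually_mapsTo_of_isCompact_absorbing_of_isOpen_of_omegaLimit_subset atTop φ {p} hC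
    ((eventually_ge_atTop 0).mono fun t ht x hx => by rw [mem_singleton_iff.1 hx]; exact hp t ht)
    (isOpen_biUnion fun y (_ : y ∈ s) => hU y) hcov
  obtain ⟨t₀, ht₀⟩ := eventually_atTop.1 hev
  set t₁ := max t₀ 0 with ht₁
  have hstep : ∀ t, t₁ ≤ t → ∃ r, τ a ≤ r ∧ r ≤ τ b ∧ 2 < G r (φ t p) := by
    intro t ht
    obtain ⟨y, hy, hyU⟩ := mem_iUnion₂.1
      (ht₀ t ((le_max_left _ _).trans ht) (mem_singleton p))
    exact ⟨τ y, hamin y hy, hbmax y hy, hyU⟩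
  obtain ⟨m, hm, hm1, hmG⟩ : ∃ m > 0, m ≤ 1 ∧ ∀ t, t₁ ≤ t → ∀ l, 0 ≤ l → l ≤ τ b →
      m ≤ G l (φ t p) := by
    have hne : (Icc 0 (τ b) ×ˢ C).Nonempty :=
      ⟨(0, φ 0 p), ⟨le_rfl, htb.le⟩, hp 0 le_rfl⟩
    obtain ⟨q, hq, hmin⟩ := (isCompact_Icc.prod hC).exists_isMinOn hne hG.continuousOn
    refine ⟨min (G q.1 q.2) 1, lt_min (hpos _ _) one_pos, min_le_right _ _,
      fun t ht l hl hlb => (min_le_left _ _).trans ?_⟩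
    exact hmin (a := (l, φ t p)) ⟨⟨hl, hlb⟩, hp t ((le_max_right _ _).trans ht)⟩
  have hsplit : ∀ r l t, G l (φ t p) = G r (φ t p) * G (l - r) (φ (r + t) p) := by
    intro r l t
    have h1 := hadd (l - r) r (φ t p)
    rwa [sub_add_cancel, ← φ.map_add] at h1
  have hlow : ∀ N : ℕ, ∀ t, t₁ ≤ t → ∀ l, 0 ≤ l → l ≤ N * τ a → m ≤ G l (φ t p) := by
    intro N
    induction N with
    | zero =>
      intro t ht l hl hlN
      have hl0 : l ≤ 0 := by simpa using hlN
      exact hmG t ht l hl (hl0.trans htb.le)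
    | succ N ih =>
      intro t ht l hl hlN
      obtain ⟨r, hra, hrb, hr⟩ := hstep t ht
      rcases le_total l r with hlr | hlr
      · exact hmG t ht l hl (hlr.trans hrb)
      · rw [hsplit r l t]
        have h1 := ih (r + t) (by linarith) (l - r) (by linarith) (by push_cast at hlN; linarith)
        nlinarith
  have hgrow : ∀ k : ℕ, ∀ t, t₁ ≤ t → ∀ l, k * τ b ≤ l → m * 2 ^ k ≤ G l (φ t p) := by
    intro k
    induction k with
    | zero =>
      intro t ht l hl
      have hl0 : 0 ≤ l := by simpa using hl
      obtain ⟨N, hN⟩ := exists_nat_ge (l / τ a)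
      have := hlow N t ht l hl0 ((div_le_iff₀ hta).1 hN)
      simpa using this
    | succ k ih =>
      intro t ht l hl
      obtain ⟨r, hra, hrb, hr⟩ := hstep t ht
      rw [hsplit r l t]
      have h1 := ih (r + t) (by linarith) (l - r) (by push_cast at hl; linarith)
      have h2 : 0 < m * 2 ^ k := by positivity
      rw [pow_succ]
      nlinarith
  refine tendsto_atTop.2 fun B => ?_
  have hg := hpos t₁ p
  obtain ⟨k, hk⟩ := pow_unbounded_of_one_lt (B / (G t₁ p * m)) (one_lt_two (α := ℝ))
  rw [div_lt_iff₀ (by positivity)] at hk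
  filter_upwards [eventually_ge_atTop (k * τ b + t₁)] with t ht
  have h1 := hadd (t - t₁) t₁ p
  rw [sub_add_cancel] at h1
  have h2 := hgrow k t₁ le_rfl (t - t₁) (by linarith)
  rw [h1]
  nlinarith

end Cocycle

/-! ### Growth of the Perron-Frobenius vectors along bounded orbits -/

section Growth

set_option linter.unusedSectionVars false

variable {n : ℕ} {X : Type*} [TopologicalSpace X] [T2Space X]
  [ChartedSpace (EuclideanSpace ℝ (Fin n)) X] [IsManifold (𝓡 n) ∞ X]
  [RiemannianBundle (fun x : X => TangentSpace (𝓡 n) x)]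
  {f : (x : X) → TangentSpace (𝓡 n) x} {K : (x : X) → Set (TangentSpace (𝓡 n) x)}

theorem hasUnboundedPFGrowth_of_tendsto {x : X}
    (hG : Tendsto (fun t => pfGrowth f K t x) atTop atTop) : HasUnboundedPFGrowth f K x := by
  have h1 := ENNReal.tendsto_ofReal_atTop.comp hG
  refine Tendsto.liminf_eq (h1.congr fun t => ?_)
  exact ofReal_norm _

theorem HasUnboundedPFGrowth.exists_two_lt {x : X} (hG : HasUnboundedPFGrowth f K x) :
    ∃ t, 0 < t ∧ 2 < pfGrowth f K t x := by
  have h1 : (ENNReal.ofReal 2) < liminf (fun t : ℝ =>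
      ‖mfderiv (𝓡 n) (𝓡 n) (flow f t) x (perronFrobenius f K x)‖ₑ) atTop := by
    rw [show liminf _ _ = ⊤ from hG]
    exact ENNReal.ofReal_lt_top
  obtain ⟨t, ht, ht0⟩ := ((eventually_lt_of_lt_liminf h1).and (eventually_gt_atTop 0)).exists
  refine ⟨t, ht0, ?_⟩
  rw [← ofReal_norm] at ht
  exact (ENNReal.ofReal_lt_ofReal_iff (h := norm_pos_iff.2 fun h0 => by simp [h0] at ht)).1 ht

namespace IsPositiveSystem

variable (h : IsPositiveSystem f K)
include h

/-- The flow of the field, as a continuous action of `ℝ`. -/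
noncomputable def toFlow : Flow ℝ X where
  toFun := flow f
  cont' := continuous_flow h.contMDiff h.complete
  map_add' := flow_add h.contMDiff h.complete
  map_zero' := flow_zero h.complete

variable [IsContinuousRiemannianBundle (EuclideanSpace ℝ (Fin n))
  (fun x : X => TangentSpace (𝓡 n) x)]

theorem tendsto_pfGrowth {C : Set X} (hC : IsCompact C) {p : X}
    (hp : ∀ t, 0 ≤ t → flow f t p ∈ C)
    (hexp : ∀ y ∈ omegaLimit atTop (flow f) {p}, ∃ t, 0 < t ∧ 2 < pfGrowth f K t y) :
    Tendsto (fun t => pfGrowth f K t p) atTop atTop :=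
  tendsto_atTop_of_cocycle h.toFlow hC hp h.continuous_pfGrowth h.pfGrowth_pos h.pfGrowth_add hexp

/-- If the Perron-Frobenius vector at `p` grows without bound, the field at `p` is not in the
cone. Otherwise a positive multiple of the Perron-Frobenius vector could be subtracted from it at
a later time, the difference would stay in the cone, and its direction would converge to that of
`-w` over the limit set. -/
theorem notMem_of_tendsto_pfGrowth {C : Set X} (hC : IsCompact C) {p : X}
    (hp : ∀ t, 0 ≤ t → flow f t p ∈ C)
    (hG : Tendsto (fun t => pfGrowth f K t p) atTop atTop) : f p ∉ K p \ {0} := by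
  rintro ⟨hfK, hf0⟩
  have : Nonempty X := ⟨p⟩
  obtain ⟨T, hT, R, Θ, hR, hRK, -, hTR⟩ := h.exists_comparable
  set w : (x : X) → TangentSpace (𝓡 n) x := perronFrobenius f K with hw
  have hint : f (flow f T p) ∈ interior (K (flow f T p)) := by
    have h1 : mfderiv (𝓡 n) (𝓡 n) (flow f T) p (f p) ∈ R (flow f T p) :=
      hTR ⟨p, f p⟩ hfK T le_rfl
    have h2 := hRK _ h1
    have h3 : mfderiv (𝓡 n) (𝓡 n) (flow f T) p (f p) ≠ 0 := fun h0 =>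
      hf0 (h.mfderiv_flow_eq_zero h0)
    rw [mfderiv_flow_field h.contMDiff h.complete] at h2 h3
    exact h2.resolve_right h3
  obtain ⟨a, ha, haK⟩ : ∃ a : ℝ, 0 < a ∧ f (flow f T p) - a • w (flow f T p) ∈ K (flow f T p) := by
    have h1 : Tendsto (fun a : ℝ => f (flow f T p) - a • w (flow f T p)) (𝓝[>] 0)
        (𝓝 (f (flow f T p))) := by
      have h2 : Continuous (fun a : ℝ => f (flow f T p) - a • w (flow f T p)) := by fun_prop
      have h3 := (h2.tendsto 0).mono_left (nhdsWithin_le_nhds (s := Ioi 0))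
      rwa [zero_smul, sub_zero] at h3
    obtain ⟨a, haK, ha⟩ :=
      ((h1.eventually (mem_interior_iff_mem_nhds.1 hint)).and self_mem_nhdsWithin).exists
    exact ⟨a, ha, haK⟩
  have hlater : ∀ t, T ≤ t → ∃ b : ℝ, b = a / pfGrowth f K T p ∧
      (pfGrowth f K t p)⁻¹ • f (flow f t p) - b • w (flow f t p) ∈ K (flow f t p) := by
    intro t ht
    refine ⟨_, rfl, ?_⟩
    have h1 : mfderiv (𝓡 n) (𝓡 n) (flow f (t - T)) (flow f T p)
        (f (flow f T p) - a • w (flow f T p)) ∈ K (flow f (t - T) (flow f T p)) :=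
      h.tflow_mem (p := ⟨flow f T p, f (flow f T p) - a • w (flow f T p)⟩) haK (sub_nonneg.2 ht)
    rw [map_sub, map_smul, mfderiv_flow_field h.contMDiff h.complete, hw,
      h.mfderiv_flow_perronFrobenius, ← flow_add h.contMDiff h.complete, sub_add_cancel] at h1
    have h2 := (h.cone.cone _).smul_mem _ (inv_nonneg.2 (h.pfGrowth_pos t p).le) _ h1
    have h3 : pfGrowth f K t p = pfGrowth f K T p * pfGrowth f K (t - T) (flow f T p) := by
      rw [← h.pfGrowth_add, sub_add_cancel]
    have h4 := h.pfGrowth_pos T p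
    have h5 := h.pfGrowth_pos (t - T) (flow f T p)
    rw [smul_sub, smul_smul, smul_smul] at h2
    convert h2 using 3
    rw [h3]
    field_simp
  set b : ℝ := a / pfGrowth f K T p with hb
  have hbpos : 0 < b := div_pos ha (h.pfGrowth_pos T p)
  obtain ⟨y, hy⟩ := omegaLimit_singleton_nonempty h.toFlow hC hp
  rw [mem_omegaLimit_singleton_iff_mapClusterPt, mapClusterPt_iff_ultrafilter] at hy
  obtain ⟨U, hU, hUy⟩ := hy
  have hUy : Tendsto (fun t => flow f t p) U (𝓝 y) := hUy
  have hlimf := (h.contMDiff.continuous.tendsto y).comp hUy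
  have hlimw := (h.continuous_perronFrobenius.tendsto y).comp hUy
  have hlimG : Tendsto (fun t => (pfGrowth f K t p)⁻¹) U (𝓝 0) :=
    (tendsto_inv_atTop_zero.comp hG).mono_left hU
  have hsrc := mem_extChartAt_source (I := 𝓡 n) y
  have hlim : Tendsto (fun t => (⟨flow f t p, (pfGrowth f K t p)⁻¹ • f (flow f t p) -
      b • w (flow f t p)⟩ : TangentBundle (𝓡 n) X)) U
      (𝓝 (⟨y, -(b • w y)⟩ : TangentBundle (𝓡 n) X)) := by
    have h1 := ((tendsto_tangentBundle_iff (y := y) hsrc).1 hlimf).2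
    have h2 := ((tendsto_tangentBundle_iff (y := y) hsrc).1 hlimw).2
    refine (tendsto_tangentBundle_iff (y := y) hsrc).2 ⟨hUy, ?_⟩
    have h3 := (hlimG.smul h1).sub (h2.const_smul b)
    have h4 : coordVec y y (-(b • w y)) =
        (0 : ℝ) • coordVec y y (f y) - b • coordVec y y (w y) := by
      rw [← coordVec_smul hsrc, ← coordVec_smul hsrc, ← coordVec_sub hsrc, zero_smul, zero_sub]
    refine (h3.congr' ?_).trans (le_of_eq (congrArg 𝓝 h4.symm))
    filter_upwards [hUy.eventually ((isOpen_extChartAt_source (I := 𝓡 n) y).mem_nhds hsrc)]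
      with t ht
    change (pfGrowth f K t p)⁻¹ • coordVec y (flow f t p) (f (flow f t p)) -
      b • coordVec y (flow f t p) (w (flow f t p)) = coordVec y (flow f t p) _
    rw [coordVec_sub ht, coordVec_smul ht, coordVec_smul ht]
  have hmem : -(b • w y) ∈ K y := by
    refine h.cone.isClosed_fieldTotal.mem_of_tendsto hlim ?_
    filter_upwards [hU (Ici_mem_atTop T)] with t ht
    obtain ⟨b', rfl, hb'⟩ := hlater t ht
    exact hb'
  have hmem' : b • w y ∈ K y := (h.cone.cone y).smul_mem b hbpos.le _
    (interior_subset (h.perronFrobenius_mem_interior y))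
  exact smul_ne_zero hbpos.ne' (h.perronFrobenius_ne_zero y) ((h.cone.cone y).eq_zero hmem' hmem)

end IsPositiveSystem

end Growth

/-! ### A map near a fixed point -/

section FixedPoint

variable {n : ℕ} {X : Type*} [TopologicalSpace X] [ChartedSpace (EuclideanSpace ℝ (Fin n)) X]
  [IsManifold (𝓡 n) ∞ X]

theorem coordVec_mfderiv_extChartAt_symm {y x : X} (hx : x ∈ (extChartAt (𝓡 n) y).source)
    (ζ : EuclideanSpace ℝ (Fin n)) :
    coordVec y x (mfderiv 𝓘(ℝ, EuclideanSpace ℝ (Fin n)) (𝓡 n) (extChartAt (𝓡 n) y).symm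
      (extChartAt (𝓡 n) y x) ζ) = ζ := by
  obtain ⟨v, hv⟩ := (coordEquiv y x hx).surjective ζ
  have hv : coordVec y x v = ζ := hv
  rw [← hv]
  exact congrArg (coordVec y x) (mfderiv_extChartAt_symm_coordVec hx v)

/-- The derivative of a map between manifolds, read in the chart around `x`. -/
theorem exists_hasFDerivAt_in_extChartAt {ψ : X → X} {x q : X}
    (hψ : MDifferentiableAt (𝓡 n) (𝓡 n) ψ q) (hq : q ∈ (extChartAt (𝓡 n) x).source)
    (hψq : ψ q ∈ (extChartAt (𝓡 n) x).source) :
    ∃ L : EuclideanSpace ℝ (Fin n) →L[ℝ] EuclideanSpace ℝ (Fin n),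
      HasFDerivAt (fun a => extChartAt (𝓡 n) x (ψ ((extChartAt (𝓡 n) x).symm a))) L
        (extChartAt (𝓡 n) x q) ∧
      ∀ v : TangentSpace (𝓡 n) q,
        L (coordVec x q v) = coordVec x (ψ q) (mfderiv (𝓡 n) (𝓡 n) ψ q v) := by
  obtain ⟨a, ha, rfl⟩ : ∃ a ∈ (extChartAt (𝓡 n) x).target, (extChartAt (𝓡 n) x).symm a = q :=
    ⟨_, (extChartAt (𝓡 n) x).map_source hq, (extChartAt (𝓡 n) x).left_inv hq⟩
  have h3 : MDifferentiableAt 𝓘(ℝ, EuclideanSpace ℝ (Fin n)) (𝓡 n) (extChartAt (𝓡 n) x).symm a := by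
    have h4 := mdifferentiableWithinAt_extChartAt_symm (I := 𝓡 n) ha
    rwa [ModelWithCorners.range_eq_univ, mdifferentiableWithinAt_univ] at h4
  have h5 : MDifferentiableAt (𝓡 n) 𝓘(ℝ, EuclideanSpace ℝ (Fin n)) (extChartAt (𝓡 n) x)
      (ψ ((extChartAt (𝓡 n) x).symm a)) :=
    mdifferentiableAt_extChartAt (by simpa using hψq)
  have h6 := h5.hasMFDerivAt.comp a (hψ.hasMFDerivAt.comp a h3.hasMFDerivAt)
  have h7 := hasMFDerivAt_iff_hasFDerivAt.1 h6
  have h8 : extChartAt (𝓡 n) x ((extChartAt (𝓡 n) x).symm a) = a :=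
    (extChartAt (𝓡 n) x).right_inv ha
  obtain ⟨L, hL, hLζ⟩ : ∃ L : EuclideanSpace ℝ (Fin n) →L[ℝ] EuclideanSpace ℝ (Fin n),
      HasFDerivAt (fun a => extChartAt (𝓡 n) x (ψ ((extChartAt (𝓡 n) x).symm a))) L a ∧
      ∀ ζ, L ζ = coordVec x (ψ ((extChartAt (𝓡 n) x).symm a)) (mfderiv (𝓡 n) (𝓡 n) ψ
        ((extChartAt (𝓡 n) x).symm a) (mfderiv 𝓘(ℝ, EuclideanSpace ℝ (Fin n)) (𝓡 n)
          (extChartAt (𝓡 n) x).symm a ζ)) := by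
    refine ⟨_, h7, fun ζ => ?_⟩
    exact (coordVec_eq_mfderiv hψq _).symm
  rw [h8]
  refine ⟨L, hL, fun v => ?_⟩
  have h9 := mfderiv_extChartAt_symm_coordVec hq v
  rw [h8] at h9
  rw [hLζ, h9]

/-- In the chart around a fixed point, a continuously differentiable map is close to its
derivative `P` at the fixed point, both infinitesimally and for differences. -/
theorem exists_nhds_approx_of_fixedPoint {ψ : X → X} (hψ : MDifferentiable (𝓡 n) (𝓡 n) ψ)
    (hT : Continuous (tangentMap (𝓡 n) (𝓡 n) ψ)) {x : X}
    {P : EuclideanSpace ℝ (Fin n) →L[ℝ] EuclideanSpace ℝ (Fin n)}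
    (hP : ∀ v : EuclideanSpace ℝ (Fin n), tangentMap (𝓡 n) (𝓡 n) ψ
      (⟨x, v⟩ : TangentBundle (𝓡 n) X) = (⟨x, P v⟩ : TangentBundle (𝓡 n) X)) {ε : ℝ} (hε : 0 < ε) :
    ∃ N : Set X, IsOpen N ∧ x ∈ N ∧ N ⊆ (extChartAt (𝓡 n) x).source ∧
      (∀ q ∈ N, ∀ v : TangentSpace (𝓡 n) q,
        ‖coordVec x (ψ q) (mfderiv (𝓡 n) (𝓡 n) ψ q v) - P (coordVec x q v)‖ ≤
          ε * ‖coordVec x q v‖) ∧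
      ∀ q ∈ N, ∀ q' ∈ N, ‖extChartAt (𝓡 n) x (ψ q) - extChartAt (𝓡 n) x (ψ q') -
        P (extChartAt (𝓡 n) x q - extChartAt (𝓡 n) x q')‖ ≤
          ε * ‖extChartAt (𝓡 n) x q - extChartAt (𝓡 n) x q'‖ := by
  set e := extChartAt (𝓡 n) x with he
  have hxs : x ∈ e.source := mem_extChartAt_source x
  have hψx : ψ x = x := congrArg (fun p : TangentBundle (𝓡 n) X => p.1) (hP 0)
  have hcψ : Continuous ψ := hψ.continuous
  set F : EuclideanSpace ℝ (Fin n) → EuclideanSpace ℝ (Fin n) := fun a => e (ψ (e.symm a)) with hF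
  have hsymm : ContinuousAt e.symm (e x) := continuousAt_extChartAt_symm x
  have hgood : ∀ᶠ a in 𝓝 (e x), a ∈ e.target ∧ ψ (e.symm a) ∈ e.source := by
    refine Filter.Eventually.and (extChartAt_target_mem_nhds (I := 𝓡 n) x) ?_
    have h1 : ContinuousAt (fun a => ψ (e.symm a)) (e x) := hcψ.continuousAt.comp hsymm
    refine h1.eventually ((isOpen_extChartAt_source x).mem_nhds ?_)
    change ψ (e.symm (e x)) ∈ e.source
    rw [e.left_inv hxs, hψx]
    exact hxs
  have hderiv : ∀ q, q ∈ e.source → ψ q ∈ e.source → HasFDerivAt F (fderiv ℝ F (e q)) (e q) ∧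
      ∀ v : TangentSpace (𝓡 n) q, fderiv ℝ F (e q) (coordVec x q v) =
        coordVec x (ψ q) (mfderiv (𝓡 n) (𝓡 n) ψ q v) := by
    intro q hq hψq
    obtain ⟨L, hL, hLv⟩ := exists_hasFDerivAt_in_extChartAt (hψ q) hq hψq
    have hL : HasFDerivAt F L (e q) := hL
    rw [hL.fderiv]
    exact ⟨hL, hLv⟩
  have hDx : fderiv ℝ F (e x) = P := by
    ext1 ζ
    have h1 := (hderiv x hxs (by rwa [hψx])).2 ζ
    have h1 : fderiv ℝ F (e x) ζ = _ :=
      (congrArg (fderiv ℝ F (e x)) (coordVec_self x ζ)).symm.trans h1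
    have h5 : ∀ q q' : TangentBundle (𝓡 n) X, q = q' →
        coordVec x q.1 q.2 = coordVec x q'.1 q'.2 := by
      rintro q q' rfl
      rfl
    exact h1.trans ((h5 _ _ (hP ζ)).trans (coordVec_self x (P ζ)))
  have hDc : ContinuousAt (fderiv ℝ F) (e x) := by
    rw [continuousAt_clm_apply]
    intro ζ
    have hc : ∀ a ∈ e.target, coordVec x (e.symm a)
        (mfderiv 𝓘(ℝ, EuclideanSpace ℝ (Fin n)) (𝓡 n) e.symm a ζ) = ζ := by
      intro a ha
      have h2 := coordVec_mfderiv_extChartAt_symm (e.map_target ha) ζ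
      rw [← he, e.right_inv ha] at h2
      exact h2
    have h1 : Tendsto (fun a => (⟨e.symm a,
        mfderiv 𝓘(ℝ, EuclideanSpace ℝ (Fin n)) (𝓡 n) e.symm a ζ⟩ : TangentBundle (𝓡 n) X))
        (𝓝 (e x)) (𝓝 ⟨e.symm (e x),
        mfderiv 𝓘(ℝ, EuclideanSpace ℝ (Fin n)) (𝓡 n) e.symm (e x) ζ⟩) := by
      rw [tendsto_tangentBundle_iff (y := x) (by rw [← he]; exact e.map_target (e.map_source hxs))]
      refine ⟨hsymm, ?_⟩
      change Tendsto _ _ (𝓝 (coordVec x (e.symm (e x))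
          (mfderiv 𝓘(ℝ, EuclideanSpace ℝ (Fin n)) (𝓡 n) e.symm (e x) ζ)))
      rw [hc _ (e.map_source hxs)]
      refine tendsto_const_nhds.congr' ?_
      filter_upwards [hgood] with a ha
      exact (hc a ha.1).symm
    have happ : ∀ a, a ∈ e.target → ψ (e.symm a) ∈ e.source → fderiv ℝ F a ζ =
        coordVec x (ψ (e.symm a)) (tangentMap (𝓡 n) (𝓡 n) ψ (⟨e.symm a,
          mfderiv 𝓘(ℝ, EuclideanSpace ℝ (Fin n)) (𝓡 n) e.symm a ζ⟩ : TangentBundle (𝓡 n) X)).2 := by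
      intro a ha ha'
      have h2 := (hderiv _ (e.map_target ha) ha').2
        (mfderiv 𝓘(ℝ, EuclideanSpace ℝ (Fin n)) (𝓡 n) e.symm a ζ)
      rw [hc a ha, e.right_inv ha] at h2
      exact h2
    have h0 := hgood.self_of_nhds
    have h2 := ((tendsto_tangentBundle_iff (y := x) h0.2).1 ((hT.tendsto _).comp h1)).2
    rw [ContinuousAt, happ _ h0.1 h0.2]
    refine h2.congr' ?_
    filter_upwards [hgood] with a ha
    exact (happ a ha.1 ha.2).symm
  have hDev : ∀ᶠ a in 𝓝 (e x), ‖fderiv ℝ F a - P‖ ≤ ε := by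
    have h1 : Tendsto (fun a => ‖fderiv ℝ F a - P‖) (𝓝 (e x)) (𝓝 ‖fderiv ℝ F (e x) - P‖) :=
      (hDc.sub continuousAt_const).norm
    rw [hDx, sub_self, norm_zero] at h1
    exact (h1.eventually_lt_const hε).mono fun a ha => ha.le
  obtain ⟨r, hr, hball⟩ := Metric.eventually_nhds_iff_ball.1 (hgood.and hDev)
  refine ⟨e.source ∩ e ⁻¹' Metric.ball (e x) r,
    (continuousOn_extChartAt x).isOpen_inter_preimage (isOpen_extChartAt_source x)
      Metric.isOpen_ball,
    ⟨hxs, Metric.mem_ball_self hr⟩, inter_subset_left, ?_, ?_⟩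
  · rintro q ⟨hqs, hq⟩ v
    obtain ⟨⟨h1, h2⟩, h3⟩ := hball _ hq
    rw [e.left_inv hqs] at h2
    rw [← (hderiv q hqs h2).2 v]
    refine ((fderiv ℝ F (e q) - P).le_opNorm (coordVec x q v)).trans ?_
    gcongr
  · rintro q ⟨hqs, hq⟩ q' ⟨hqs', hq'⟩
    have hd : ∀ a ∈ Metric.ball (e x) r, HasFDerivWithinAt F (fderiv ℝ F a)
        (Metric.ball (e x) r) a := by
      intro a ha
      obtain ⟨⟨h1, h2⟩, -⟩ := hball a ha
      have h3 := (hderiv _ (e.map_target h1) h2).1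
      rw [e.right_inv h1] at h3
      exact h3.hasFDerivWithinAt
    have h1 := (convex_ball (e x) r).norm_image_sub_le_of_norm_hasFDerivWithin_le'
      hd (fun a ha => (hball a ha).2) hq' hq
    simpa only [hF, e.left_inv hqs, e.left_inv hqs'] using h1

end FixedPoint

/-! ### Cones around a dominating direction -/

section ConeStep

variable {E : Type*} [NormedAddCommGroup E] [NormedSpace ℝ E] {p : E →L[ℝ] ℝ} {w : E} {μ : ℝ}
  {d d' : E}

/-- One step `d ↦ d'` of a map that is close to a linear map with dominating eigenvector `w` and
eigenvalue `μ`. A vector is split as `d = p d • w + (d - p d • w)`; the first part is multiplied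
by about `μ`, the second part is contracted by about `μ / 4`. -/
structure ConeStep (p : E →L[ℝ] ℝ) (w : E) (μ : ℝ) (d d' : E) : Prop where
  fst : |p d' - μ * p d| ≤ μ / 8 * max |p d| ‖d - p d • w‖
  snd : ‖d' - p d' • w‖ ≤ μ / 4 * ‖d - p d • w‖ + μ / 8 * max |p d| ‖d - p d • w‖

theorem coneStep_of_approx {P : E →L[ℝ] E} (hpP : ∀ v, p (P v) = μ * p v) (hμ : 0 < μ)
    (hPw : P w = μ • w) (hP : ∀ v, p v = 0 → ‖P v‖ ≤ μ / 4 * ‖v‖) (hpw : p w = 1)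
    (hd : ‖d' - P d‖ ≤ μ / (8 * ((1 + ‖p‖ + ‖p‖ * ‖w‖) * (1 + ‖w‖))) * ‖d‖) :
    ConeStep p w μ d d' := by
  set r := d' - P d with hr
  set m := max |p d| ‖d - p d • w‖ with hm
  have hd' : d' = P d + r := by rw [hr]; abel
  have hm0 : 0 ≤ m := (abs_nonneg _).trans (le_max_left _ _)
  have hdm : ‖d‖ ≤ (1 + ‖w‖) * m := by
    calc ‖d‖ = ‖(d - p d • w) + p d • w‖ := by rw [sub_add_cancel]
      _ ≤ ‖d - p d • w‖ + |p d| * ‖w‖ := by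
        refine (norm_add_le _ _).trans (le_of_eq ?_)
        rw [norm_smul, Real.norm_eq_abs]
      _ ≤ m + m * ‖w‖ := by
        gcongr
        · exact le_max_right _ _
        · exact le_max_left _ _
      _ = (1 + ‖w‖) * m := by ring
  have hrm : (1 + ‖p‖ + ‖p‖ * ‖w‖) * ‖r‖ ≤ μ / 8 * m := by
    have h1 : 0 < (1 + ‖p‖ + ‖p‖ * ‖w‖) := by positivity
    have h2 : 0 < 1 + ‖w‖ := by positivity
    calc (1 + ‖p‖ + ‖p‖ * ‖w‖) * ‖r‖ ≤ (1 + ‖p‖ + ‖p‖ * ‖w‖) *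
          (μ / (8 * ((1 + ‖p‖ + ‖p‖ * ‖w‖) * (1 + ‖w‖))) * ((1 + ‖w‖) * m)) := by
          gcongr
          exact hd.trans (by gcongr)
      _ = μ / 8 * m := by field_simp
  have hpr : |p r| ≤ ‖p‖ * ‖r‖ := p.le_opNorm r
  have hr0 := norm_nonneg r
  have hp0 := norm_nonneg p
  have hw0 := norm_nonneg w
  constructor
  · rw [hd', map_add, hpP, add_sub_cancel_left]
    refine hpr.trans (le_trans ?_ hrm)
    nlinarith [mul_nonneg (mul_nonneg hp0 hw0) hr0]
  · have h1 : d' - p d' • w = P (d - p d • w) + (r - p r • w) := by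
      rw [map_sub, map_smul, hPw, hr, map_sub, hpP]
      module
    have h2 : ‖r - p r • w‖ ≤ (1 + ‖p‖ + ‖p‖ * ‖w‖) * ‖r‖ := by
      refine (norm_sub_le _ _).trans ?_
      rw [norm_smul, Real.norm_eq_abs]
      nlinarith [mul_le_mul_of_nonneg_right hpr hw0, mul_nonneg hp0 hr0]
    rw [h1]
    refine (norm_add_le _ _).trans (add_le_add (hP _ ?_) (h2.trans hrm))
    rw [map_sub, map_smul, hpw, smul_eq_mul, mul_one, sub_self]

namespace ConeStep

variable (hs : ConeStep p w μ d d') (hμ : 0 < μ)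
include hs hμ

theorem le_abs (hd : ‖d - p d • w‖ ≤ |p d|) : 7 / 8 * μ * |p d| ≤ |p d'| := by
  have h1 := hs.fst
  rw [max_eq_left hd] at h1
  have h2 := abs_sub_abs_le_abs_sub (μ * p d) (p d')
  rw [abs_sub_comm, abs_mul, abs_of_pos hμ] at h2
  linarith

theorem norm_le (hd : ‖d - p d • w‖ ≤ |p d|) : ‖d' - p d' • w‖ ≤ 3 / 7 * |p d'| := by
  have h1 := hs.snd
  have h2 := hs.le_abs hμ hd
  rw [max_eq_left hd] at h1
  have h3 := mul_le_mul_of_nonneg_left hd hμ.le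
  linarith

/-- Within the cone the sign of the dominating coordinate is preserved. -/
theorem mul_neg (hd : ‖d - p d • w‖ ≤ |p d|) {σ : ℝ} (hσ : σ * p d < 0) : σ * p d' < 0 := by
  have h1 := hs.fst
  rw [max_eq_left hd] at h1
  rcases lt_or_gt_of_ne (left_ne_zero_of_mul hσ.ne) with h0 | h0
  · have hp : 0 < p d := pos_of_mul_neg_right hσ h0.le
    rw [abs_of_pos hp, abs_le] at h1
    have : 0 < μ * p d := mul_pos hμ hp
    exact mul_neg_of_neg_of_pos h0 (by linarith)
  · have hp : p d < 0 := neg_of_mul_neg_right hσ h0.le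
    rw [abs_of_neg hp, abs_le] at h1
    have : μ * p d < 0 := mul_neg_of_pos_of_neg hμ hp
    exact mul_neg_of_pos_of_neg h0 (by linarith)

/-- Vectors outside the cone come from vectors outside the cone, which are longer. -/
theorem lt_and_le (hd' : |p d'| < ‖d' - p d' • w‖) :
    |p d| < ‖d - p d • w‖ ∧ ‖d' - p d' • w‖ ≤ 3 / 8 * μ * ‖d - p d • w‖ := by
  have h0 : |p d| < ‖d - p d • w‖ := by
    by_contra hcon
    have h1 := hs.norm_le hμ (not_lt.1 hcon)
    have h2 := abs_nonneg (p d')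
    linarith
  refine ⟨h0, ?_⟩
  have h1 := hs.snd
  rw [max_eq_right h0.le] at h1
  linarith

omit hs in
/-- A vector whose backward orbit does not grow too fast lies in the cone. -/
theorem norm_le_of_backward {d : ℕ → E} (hd : ∀ j, ConeStep p w μ (d (j + 1)) (d j))
    (hlim : Tendsto (fun j => (3 / 8 * μ) ^ j * ‖d j - p (d j) • w‖) atTop (𝓝 0)) :
    ‖d 0 - p (d 0) • w‖ ≤ |p (d 0)| := by
  by_contra hcon
  push Not at hcon
  have h1 : ∀ j, |p (d j)| < ‖d j - p (d j) • w‖ ∧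
      ‖d 0 - p (d 0) • w‖ ≤ (3 / 8 * μ) ^ j * ‖d j - p (d j) • w‖ := by
    intro j
    induction j with
    | zero => exact ⟨hcon, by simp⟩
    | succ j ih =>
      obtain ⟨h2, h3⟩ := (hd j).lt_and_le hμ ih.1
      refine ⟨h2, ih.2.trans ?_⟩
      rw [pow_succ, mul_assoc]
      gcongr
  have h2 := ge_of_tendsto' hlim fun j => (h1 j).2
  have h3 := abs_nonneg (p (d 0))
  linarith

end ConeStep

end ConeStep

/-! ### Equilibria with bounded growth -/

section Equilibrium

set_option linter.unusedSectionVars false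

variable {n : ℕ} {X : Type*} [TopologicalSpace X] [T2Space X]
  [ChartedSpace (EuclideanSpace ℝ (Fin n)) X] [IsManifold (𝓡 n) ∞ X]
  [RiemannianBundle (fun x : X => TangentSpace (𝓡 n) x)]
  {f : (x : X) → TangentSpace (𝓡 n) x} {K : (x : X) → Set (TangentSpace (𝓡 n) x)}

/-- `N` is a neighbourhood, inside the chart around the equilibrium `x`, where the time-`τ` map is
dominated by the Perron-Frobenius direction of `x`: in the coordinates of the chart, tangent
vectors and differences of points are transformed by `ConeStep`s. Moreover the Perron-Frobenius
vectors over `N` are well inside the cone and neither small nor large. -/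
structure IsDominatedNhd (f : (x : X) → TangentSpace (𝓡 n) x)
    (K : (x : X) → Set (TangentSpace (𝓡 n) x)) (x : X) (τ μ : ℝ)
    (p : EuclideanSpace ℝ (Fin n) →L[ℝ] ℝ) (N : Set X) : Prop where
  tau_pos : 0 < τ
  mu_pos : 0 < μ
  mu_le_one : μ ≤ 1
  isOpen : IsOpen N
  mem : x ∈ N
  subset_source : N ⊆ (extChartAt (𝓡 n) x).source
  map_eq_one : p (coordVec x x (perronFrobenius f K x)) = 1
  step_sub : ∀ q ∈ N, ∀ q' ∈ N, ConeStep p (coordVec x x (perronFrobenius f K x)) μ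
    (extChartAt (𝓡 n) x q - extChartAt (𝓡 n) x q')
    (extChartAt (𝓡 n) x (flow f τ q) - extChartAt (𝓡 n) x (flow f τ q'))
  step_tangent : ∀ q ∈ N, ∀ v : TangentSpace (𝓡 n) q,
    ConeStep p (coordVec x x (perronFrobenius f K x)) μ (coordVec x q v)
      (coordVec x (flow f τ q) (mfderiv (𝓡 n) (𝓡 n) (flow f τ) q v))
  cone_perronFrobenius : ∀ q ∈ N, ‖coordVec x q (perronFrobenius f K q) -
      p (coordVec x q (perronFrobenius f K q)) • coordVec x x (perronFrobenius f K x)‖ ≤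
      |p (coordVec x q (perronFrobenius f K q))|
  lower_perronFrobenius : ∀ q ∈ N, 1 / 2 ≤ |p (coordVec x q (perronFrobenius f K q))|
  upper_perronFrobenius : ∀ q ∈ N, ‖coordVec x q (perronFrobenius f K q)‖ ≤
    ‖coordVec x x (perronFrobenius f K x)‖ + 1

namespace IsPositiveSystem

variable (h : IsPositiveSystem f K)
include h

theorem pfGrowth_zero (x : X) : pfGrowth f K 0 x = 1 := by
  have h1 := h.pfGrowth_add 0 0 x
  rw [add_zero, flow_zero h.complete] at h1
  exact (mul_left_cancel₀ (h.pfGrowth_pos 0 x).ne' (by rw [mul_one]; exact h1)).symm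

theorem pfGrowth_nat_mul {x : X} (hfx : f x = 0) (T : ℝ) (j : ℕ) :
    pfGrowth f K (j * T) x = pfGrowth f K T x ^ j := by
  induction j with
  | zero =>
    rw [Nat.cast_zero, zero_mul, pow_zero, h.pfGrowth_zero]
  | succ j ih =>
    have h1 := h.pfGrowth_add T (j * T) x
    rw [flow_of_eq_zero h.contMDiff h.complete hfx, ih] at h1
    rw [pow_succ, ← h1]
    congr 1
    push_cast
    ring

variable [IsContinuousRiemannianBundle (EuclideanSpace ℝ (Fin n))
  (fun x : X => TangentSpace (𝓡 n) x)]

/-- Around an equilibrium at which the growth factors are bounded, a high iterate of the time-`T`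
map is dominated by the Perron-Frobenius direction, with a factor `μ ≤ 1`. -/
theorem exists_isDominatedNhd {x : X} (hfx : f x = 0)
    (hG : ∀ t, 0 < t → pfGrowth f K t x ≤ 2) : ∃ τ μ p N, IsDominatedNhd f K x τ μ p N := by
  have : Nonempty X := ⟨x⟩
  obtain ⟨T, hT, R, Θ, hR, hRK, -, hTR⟩ := h.exists_comparable
  have hfix : ∀ t, flow f t x = x := flow_of_eq_zero h.contMDiff h.complete hfx
  set P : EuclideanSpace ℝ (Fin n) →L[ℝ] EuclideanSpace ℝ (Fin n) :=
    mfderiv (𝓡 n) (𝓡 n) (flow f T) x with hP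
  set w : EuclideanSpace ℝ (Fin n) := coordVec x x (perronFrobenius f K x) with hw
  have hwx : w = perronFrobenius f K x := coordVec_self x _
  set μ₀ := pfGrowth f K T x with hμ₀
  have hμ₀pos : 0 < μ₀ := h.pfGrowth_pos T x
  have hμ₀le : μ₀ ≤ 1 := by
    by_contra hcon
    obtain ⟨m, hm⟩ := pow_unbounded_of_one_lt 2 (not_le.1 hcon)
    have hm0 : m ≠ 0 := by
      rintro rfl
      norm_num at hm
    have h1 := hG (m * T) (by positivity)
    rw [h.pfGrowth_nat_mul hfx] at h1
    linarith
  have hcast : ∀ (y : X) (v : EuclideanSpace ℝ (Fin n)), y = x →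
      (⟨y, v⟩ : TangentBundle (𝓡 n) X) = ⟨x, v⟩ := by
    rintro y v rfl
    rfl
  have hPT : ∀ v : EuclideanSpace ℝ (Fin n),
      tflow f T (⟨x, v⟩ : TangentBundle (𝓡 n) X) = (⟨x, P v⟩ : TangentBundle (𝓡 n) X) :=
    fun v => hcast _ _ (hfix T)
  have hPj : ∀ (j : ℕ) (v : EuclideanSpace ℝ (Fin n)),
      tflow f (j * T) (⟨x, v⟩ : TangentBundle (𝓡 n) X) =
        (⟨x, (P ^ j) v⟩ : TangentBundle (𝓡 n) X) := by
    intro j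
    induction j with
    | zero =>
      intro v
      rw [Nat.cast_zero, zero_mul, tflow_zero h.complete, pow_zero]
      rfl
    | succ j ih =>
      intro v
      rw [show ((j + 1 : ℕ) : ℝ) * T = T + j * T by push_cast; ring,
        tflow_add h.contMDiff h.complete, ih, hPT, pow_succ']
      rfl
  have hPR : ∀ v ∈ (K x : Set (EuclideanSpace ℝ (Fin n))),
      P v ∈ (R x : Set (EuclideanSpace ℝ (Fin n))) := by
    intro v hv
    have h1 := hTR (⟨x, v⟩ : TangentBundle (𝓡 n) X) hv T le_rfl
    exact (congrArg (· ∈ fieldTotal R) (hPT v)).mp h1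
  have hPw : P w = μ₀ • w := by
    have h1 := h.mfderiv_flow_perronFrobenius T x
    have h2 : ∀ y : X, y = x → (perronFrobenius f K y : EuclideanSpace ℝ (Fin n)) = w := by
      rintro y rfl
      exact hwx.symm
    have h3 : P (perronFrobenius f K x : EuclideanSpace ℝ (Fin n)) =
        μ₀ • (perronFrobenius f K (flow f T x) : EuclideanSpace ℝ (Fin n)) := h1
    rw [h2 _ (hfix T), ← hwx] at h3
    exact h3
  have hwint : w ∈ interior (K x : Set (EuclideanSpace ℝ (Fin n))) := by
    rw [hwx]
    exact h.perronFrobenius_mem_interior x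
  have hw0 : w ≠ 0 := by
    rw [hwx]
    exact h.perronFrobenius_ne_zero x
  obtain ⟨p, κ, θ, hpw, hpP, hθ0, hθ1, hdom⟩ := exists_perronFrobenius_functional
    (E := EuclideanSpace ℝ (Fin n)) (h.cone.cone x) (hR x) (hRK x) hPR hwint hw0 hμ₀pos hPw
  obtain ⟨j, hj1, hj⟩ : ∃ j : ℕ, 1 ≤ j ∧ κ * θ ^ j ≤ 1 / 4 := by
    have h1 : Tendsto (fun j : ℕ => κ * θ ^ j) atTop (𝓝 (κ * 0)) :=
      (tendsto_pow_atTop_nhds_zero_of_lt_one hθ0 hθ1).const_mul κ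
    rw [mul_zero] at h1
    exact ((eventually_ge_atTop 1).and
      (h1.eventually_le_const (by norm_num : (0 : ℝ) < 1 / 4))).exists
  set μ := μ₀ ^ j with hμ
  have hμpos : 0 < μ := pow_pos hμ₀pos j
  set Q := P ^ j with hQ
  have hpow : ∀ v, p (Q v) = μ * p v := by
    have h1 : ∀ (i : ℕ) (v : EuclideanSpace ℝ (Fin n)), p ((P ^ i) v) = μ₀ ^ i * p v := by
      intro i
      induction i with
      | zero => intro v; simp
      | succ i ih =>
        intro v
        rw [pow_succ' P, mul_apply_eq_comp, hpP, ih]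
        ring
    exact h1 j
  have hQw : Q w = μ • w := by
    have h1 : ∀ i : ℕ, (P ^ i) w = μ₀ ^ i • w := by
      intro i
      induction i with
      | zero => simp
      | succ i ih =>
        rw [pow_succ' P, mul_apply_eq_comp, ih, map_smul, hPw, smul_smul, pow_succ]
    exact h1 j
  have hQ4 : ∀ v, p v = 0 → ‖Q v‖ ≤ μ / 4 * ‖v‖ := by
    intro v hv
    have h1 := hdom j v
    rw [hv, mul_zero, zero_smul, sub_zero] at h1
    refine h1.trans ?_
    have h2 : κ * θ ^ j * μ ≤ 1 / 4 * μ := by gcongr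
    calc κ * θ ^ j * μ₀ ^ j * ‖v‖ ≤ 1 / 4 * μ * ‖v‖ := by gcongr
      _ = μ / 4 * ‖v‖ := by ring
  have hε : 0 < μ / (8 * ((1 + ‖p‖ + ‖p‖ * ‖w‖) * (1 + ‖w‖))) := by positivity
  have hcT : Continuous (tangentMap (𝓡 n) (𝓡 n) (flow f (j * T))) :=
    (continuous_tflow h.contMDiff h.complete).comp (by fun_prop : Continuous
      fun p : TangentBundle (𝓡 n) X => ((j * T : ℝ), p))
  obtain ⟨N, hNo, hxN, hNs, hN1, hN2⟩ := exists_nhds_approx_of_fixedPoint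
    (mdifferentiable_flow h.contMDiff h.complete (j * T)) hcT (hPj j) hε
  -- the coordinates of the Perron-Frobenius vectors are close to `w`
  have hlim : Tendsto (fun q => coordVec x q (perronFrobenius f K q)) (𝓝 x) (𝓝 w) :=
    ((tendsto_tangentBundle_iff (y := x) (mem_extChartAt_source x)).1
      (h.continuous_perronFrobenius.tendsto x)).2
  have hlim1 : Tendsto (fun q => p (coordVec x q (perronFrobenius f K q))) (𝓝 x) (𝓝 1) := by
    rw [← hpw]
    exact (p.continuous.tendsto w).comp hlim
  have hlim2 : Tendsto (fun q => ‖coordVec x q (perronFrobenius f K q) -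
      p (coordVec x q (perronFrobenius f K q)) • w‖) (𝓝 x) (𝓝 0) := by
    have h1 := (hlim.sub (hlim1.smul_const w)).norm
    rwa [one_smul, sub_self, norm_zero] at h1
  obtain ⟨M, hM, hMo, hxM⟩ := eventually_nhds_iff.1
    ((hlim1.eventually_const_lt (by norm_num : (1 / 2 : ℝ) < 1)).and
      ((hlim2.eventually_lt_const (by norm_num : (0 : ℝ) < 1 / 2)).and
        (hlim.norm.eventually_lt_const (lt_add_one ‖w‖))))
  refine ⟨j * T, μ, p, N ∩ M, by positivity, hμpos, pow_le_one₀ hμ₀pos.le hμ₀le, hNo.inter hMo,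
    ⟨hxN, hxM⟩, inter_subset_left.trans hNs, hpw, ?_, ?_, ?_, ?_, ?_⟩
  · intro q hq q' hq'
    exact coneStep_of_approx hpow hμpos hQw hQ4 hpw (hN2 q hq.1 q' hq'.1)
  · intro q hq v
    exact coneStep_of_approx hpow hμpos hQw hQ4 hpw (hN1 q hq.1 v)
  · intro q hq
    obtain ⟨h1, h2, -⟩ := hM q hq.2
    exact h2.le.trans (h1.le.trans (le_abs_self _))
  · intro q hq
    exact (hM q hq.2).1.le.trans (le_abs_self _)
  · intro q hq
    exact (hM q hq.2).2.2.le

end IsPositiveSystem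

end Equilibrium

/-! ### Backward orbits that stay near an equilibrium -/

section Backward

set_option linter.unusedSectionVars false

variable {n : ℕ} {X : Type*} [TopologicalSpace X] [T2Space X]
  [ChartedSpace (EuclideanSpace ℝ (Fin n)) X] [IsManifold (𝓡 n) ∞ X]
  [RiemannianBundle (fun x : X => TangentSpace (𝓡 n) x)]
  {f : (x : X) → TangentSpace (𝓡 n) x} {K : (x : X) → Set (TangentSpace (𝓡 n) x)}

namespace IsPositiveSystem

variable (h : IsPositiveSystem f K) {x : X} {τ μ : ℝ} {p : EuclideanSpace ℝ (Fin n) →L[ℝ] ℝ}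
  {N B : Set X} (hN : IsDominatedNhd f K x τ μ p N)
include h hN

theorem flow_neg_succ_mul (y : X) (j : ℕ) :
    flow f τ (flow f (-((j + 1 : ℕ) * τ)) y) = flow f (-(j * τ)) y := by
  rw [← flow_add h.contMDiff h.complete]
  congr 1
  push_cast
  ring

/-- A point whose backward orbit stays near the equilibrium differs from it by a vector of the
cone. -/
theorem sub_mem_cone_of_backward (hfx : f x = 0) (hB : IsCompact B) (hBN : B ⊆ N) {y : X}
    (hy : ∀ j : ℕ, flow f (-(j * τ)) y ∈ B) :
    ‖(extChartAt (𝓡 n) x y - extChartAt (𝓡 n) x x) -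
      p (extChartAt (𝓡 n) x y - extChartAt (𝓡 n) x x) •
        coordVec x x (perronFrobenius f K x)‖ ≤
      |p (extChartAt (𝓡 n) x y - extChartAt (𝓡 n) x x)| := by
  set w : EuclideanSpace ℝ (Fin n) := coordVec x x (perronFrobenius f K x) with hw
  let D : X → EuclideanSpace ℝ (Fin n) := fun q => extChartAt (𝓡 n) x q - extChartAt (𝓡 n) x x
  have hD : ContinuousOn D B :=
    ((continuousOn_extChartAt x).mono (hBN.trans hN.subset_source)).sub continuousOn_const
  obtain ⟨M, hM⟩ := hB.exists_bound_of_continuousOn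
    (hD.sub ((p.continuous.comp_continuousOn hD).smul continuousOn_const : ContinuousOn
      (fun q => p (D q) • w) B))
  have h1 := ConeStep.norm_le_of_backward (p := p) (w := w) (μ := μ) hN.mu_pos
    (d := fun j : ℕ => D (flow f (-(j * τ)) y)) (fun j => by
      have h2 := hN.step_sub _ (hBN (hy (j + 1))) x hN.mem
      rwa [h.flow_neg_succ_mul hN, flow_of_eq_zero h.contMDiff h.complete hfx] at h2) ?_
  · simp only [Nat.cast_zero, zero_mul, neg_zero, flow_zero h.complete] at h1
    exact h1
  · have hM0 : 0 ≤ M := (norm_nonneg _).trans (hM _ (hy 0))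
    have h2 : Tendsto (fun j : ℕ => (3 / 8 : ℝ) ^ j * M) atTop (𝓝 (0 * M)) :=
      (tendsto_pow_atTop_nhds_zero_of_lt_one (by norm_num) (by norm_num)).mul_const M
    rw [zero_mul] at h2
    have hμ := hN.mu_pos
    refine squeeze_zero (fun j => by positivity) (fun j => ?_) h2
    gcongr
    · linarith [hN.mu_le_one]
    · exact hM _ (hy j)

/-- At a point whose backward orbit stays near the equilibrium, the field is parallel to the
Perron-Frobenius vector: a component across it would grow too fast backwards. -/
theorem exists_eq_smul_of_backward
    [IsContinuousRiemannianBundle (EuclideanSpace ℝ (Fin n)) (fun x : X => TangentSpace (𝓡 n) x)]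
    (hB : IsCompact B) (hBN : B ⊆ N) {y : X}
    (hy : ∀ j : ℕ, flow f (-(j * τ)) y ∈ B) : ∃ c : ℝ, f y = c • perronFrobenius f K y := by
  set w : EuclideanSpace ℝ (Fin n) := coordVec x x (perronFrobenius f K x) with hw
  have hμ := hN.mu_pos
  let cf : X → EuclideanSpace ℝ (Fin n) := fun q => coordVec x q (f q)
  let cw : X → EuclideanSpace ℝ (Fin n) := fun q => coordVec x q (perronFrobenius f K q)
  let Y : ℕ → X := fun j => flow f (-(j * τ)) y
  have hYN : ∀ j, Y j ∈ N := fun j => hBN (hy j)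
  have hYs : ∀ j, Y j ∈ (extChartAt (𝓡 n) x).source := fun j => hN.subset_source (hYN j)
  have hY : ∀ j, flow f τ (Y (j + 1)) = Y j := h.flow_neg_succ_mul hN y
  have hY0 : Y 0 = y := by simp [Y, flow_zero h.complete]
  have hcf : ContinuousOn cf B := by
    intro q hq
    exact ((tendsto_tangentBundle_iff (y := x) (p := (⟨q, f q⟩ : TangentBundle (𝓡 n) X))
      (hN.subset_source (hBN hq))).1 (h.contMDiff.continuous.tendsto q)).2.mono_left
        nhdsWithin_le_nhds
  obtain ⟨M, hM⟩ := hB.exists_bound_of_continuousOn hcf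
  let g : ℕ → ℝ := fun j => pfGrowth f K (j * τ) (Y j)
  have hg0 : g 0 = 1 := by simp [g, h.pfGrowth_zero]
  have hgpos : ∀ j, 0 < g j := fun j => h.pfGrowth_pos _ _
  have hg : ∀ j, g (j + 1) = pfGrowth f K τ (Y (j + 1)) * g j := by
    intro j
    change pfGrowth f K ((j + 1 : ℕ) * τ) (Y (j + 1)) = _ * pfGrowth f K (j * τ) (Y j)
    rw [← hY j, ← h.pfGrowth_add]
    congr 1
    push_cast
    ring
  have hcw0 : p (cw y) ≠ 0 := by
    have h1 := hN.lower_perronFrobenius _ (hYN 0)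
    rw [hY0] at h1
    intro h0
    have h2 : p (coordVec x y (perronFrobenius f K y)) = 0 := h0
    rw [h2, abs_zero] at h1
    norm_num at h1
  have hglow : ∀ j, (7 / 8 * μ) ^ j * |p (cw (Y j))| ≤ g j * |p (cw y)| := by
    intro j
    induction j with
    | zero =>
      rw [hg0, hY0]
      simp
    | succ j ih =>
      have h1 := hN.step_tangent _ (hYN (j + 1)) (perronFrobenius f K (Y (j + 1)))
      have h2 := h1.le_abs hμ (hN.cone_perronFrobenius _ (hYN (j + 1)))
      have h3 : coordVec x (flow f τ (Y (j + 1))) (mfderiv (𝓡 n) (𝓡 n) (flow f τ) (Y (j + 1))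
          (perronFrobenius f K (Y (j + 1)))) = pfGrowth f K τ (Y (j + 1)) • cw (Y j) := by
        rw [h.mfderiv_flow_perronFrobenius, coordVec_smul (by rw [hY]; exact hYs j), hY]
      rw [h3, map_smul, smul_eq_mul, abs_mul, abs_of_pos (h.pfGrowth_pos _ _)] at h2
      have h4 := h.pfGrowth_pos τ (Y (j + 1))
      calc (7 / 8 * μ) ^ (j + 1) * |p (cw (Y (j + 1)))|
          = (7 / 8 * μ) ^ j * (7 / 8 * μ * |p (cw (Y (j + 1)))|) := by ring
        _ ≤ (7 / 8 * μ) ^ j * (pfGrowth f K τ (Y (j + 1)) * |p (cw (Y j))|) := by gcongr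
        _ = pfGrowth f K τ (Y (j + 1)) * ((7 / 8 * μ) ^ j * |p (cw (Y j))|) := by ring
        _ ≤ pfGrowth f K τ (Y (j + 1)) * (g j * |p (cw y)|) := by gcongr
        _ = g (j + 1) * |p (cw y)| := by rw [hg]; ring
  -- `c` is chosen such that `f y - c • w y` has no component along the dominating direction
  set c : ℝ := p (cf y) / p (cw y) with hc
  let d : ℕ → EuclideanSpace ℝ (Fin n) := fun j => cf (Y j) - (c / g j) • cw (Y j)
  have hd0 : d 0 = cf y - c • cw y := by
    simp only [d, hg0, hY0, div_one]
  have hstep : ∀ j, ConeStep p w μ (d (j + 1)) (d j) := by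
    intro j
    have h1 := hN.step_tangent _ (hYN (j + 1))
      (f (Y (j + 1)) - (c / g (j + 1)) • perronFrobenius f K (Y (j + 1)))
    have hs : flow f τ (Y (j + 1)) ∈ (extChartAt (𝓡 n) x).source := by rw [hY]; exact hYs j
    rw [map_sub, map_smul, mfderiv_flow_field h.contMDiff h.complete,
      h.mfderiv_flow_perronFrobenius, coordVec_sub (hYs _), coordVec_smul (hYs _),
      coordVec_sub hs, coordVec_smul hs, coordVec_smul hs, hY, smul_smul,
      show c / g (j + 1) * pfGrowth f K τ (Y (j + 1)) = c / g j by
        have h4 := h.pfGrowth_pos τ (Y (j + 1))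
        have h5 := hgpos j
        rw [hg]
        field_simp] at h1
    exact h1
  have hcone := ConeStep.norm_le_of_backward hμ hstep ?_
  · have hp0 : p (d 0) = 0 := by
      rw [hd0, map_sub, map_smul, smul_eq_mul, hc, div_mul_cancel₀ _ hcw0, sub_self]
    rw [hp0, zero_smul, sub_zero, abs_zero] at hcone
    have h1 : cf y - c • cw y = 0 := by
      rw [← hd0]
      exact norm_le_zero_iff.1 hcone
    refine ⟨c, coordVec_injective (hY0 ▸ hYs 0) ?_⟩
    rw [coordVec_smul (hY0 ▸ hYs 0)]
    exact sub_eq_zero.1 h1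
  · have hM0 : 0 ≤ M := (norm_nonneg _).trans (hM _ (hy 0))
    set A : ℝ := 1 + ‖p‖ * ‖w‖ with hA
    set L : ℝ := 2 * |c| * |p (cw y)| * (‖w‖ + 1) with hL
    have h2 : Tendsto (fun j : ℕ => A * ((3 / 8 : ℝ) ^ j * M + (3 / 7 : ℝ) ^ j * L)) atTop
        (𝓝 (A * (0 * M + 0 * L))) :=
      (((tendsto_pow_atTop_nhds_zero_of_lt_one (by norm_num) (by norm_num)).mul_const M).add
        ((tendsto_pow_atTop_nhds_zero_of_lt_one (by norm_num) (by norm_num)).mul_const L)).const_mul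
          A
    rw [zero_mul, zero_mul, add_zero, mul_zero] at h2
    refine squeeze_zero (fun j => by positivity) (fun j => ?_) h2
    have h3 : ‖d j - p (d j) • w‖ ≤ A * ‖d j‖ := by
      refine (norm_sub_le _ _).trans ?_
      rw [norm_smul, hA]
      have h4 := mul_le_mul_of_nonneg_right (p.le_opNorm (d j)) (norm_nonneg w)
      linarith
    have h5 : 1 / g j ≤ 2 * |p (cw y)| / (7 / 8 * μ) ^ j := by
      rw [div_le_div_iff₀ (hgpos j) (by positivity)]
      have h6 := hglow j
      have h7 : 1 / 2 ≤ |p (cw (Y j))| := hN.lower_perronFrobenius _ (hYN j)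
      have h8 : (7 / 8 * μ) ^ j * (1 / 2) ≤ (7 / 8 * μ) ^ j * |p (cw (Y j))| := by gcongr
      linarith
    have h6 : ‖d j‖ ≤ M + L / (7 / 8 * μ) ^ j := by
      refine (norm_sub_le _ _).trans (add_le_add (hM _ (hy j)) ?_)
      rw [norm_smul, Real.norm_eq_abs, abs_div, abs_of_pos (hgpos j)]
      calc |c| / g j * ‖cw (Y j)‖ = |c| * (1 / g j) * ‖cw (Y j)‖ := by ring
        _ ≤ |c| * (2 * |p (cw y)| / (7 / 8 * μ) ^ j) * (‖w‖ + 1) := by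
          gcongr
          exact hN.upper_perronFrobenius _ (hYN j)
        _ = L / (7 / 8 * μ) ^ j := by rw [hL]; ring
    calc (3 / 8 * μ) ^ j * ‖d j - p (d j) • w‖
        ≤ (3 / 8 * μ) ^ j * (A * (M + L / (7 / 8 * μ) ^ j)) := by
          gcongr
          exact h3.trans (by gcongr)
      _ = A * ((3 / 8 * μ) ^ j * M + ((3 / 8 * μ) ^ j / (7 / 8 * μ) ^ j) * L) := by ring
      _ = A * ((3 / 8 * μ) ^ j * M + (3 / 7) ^ j * L) := by
          rw [← div_pow]
          congr 4
          field_simp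
      _ ≤ A * ((3 / 8) ^ j * M + (3 / 7) ^ j * L) := by
          gcongr
          linarith [hN.mu_le_one]

end IsPositiveSystem

end Backward

/-! ### Growth at equilibria of a limit set -/

section LimitSet

set_option linter.unusedSectionVars false

/-- The first time at which a path leaves an open set. -/
theorem exists_exit_time {X : Type*} [TopologicalSpace X] {γ : ℝ → X} (hγ : Continuous γ)
    {O : Set X} (hO : IsOpen O) {t : ℝ} (ht : γ t ∈ O) (hex : ∃ s, t ≤ s ∧ γ s ∉ O) :
    ∃ s, t < s ∧ γ s ∉ O ∧ γ s ∈ closure O ∧ ∀ r, t ≤ r → r < s → γ r ∈ O := by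
  set S : Set ℝ := {s | t ≤ s ∧ γ s ∉ O} with hS
  have hcl : IsClosed S := isClosed_Ici.inter (hO.isClosed_compl.preimage hγ)
  have hbdd : BddBelow S := ⟨t, fun s hs => hs.1⟩
  have hmem : sInf S ∈ S := hcl.csInf_mem hex hbdd
  have hbefore : ∀ r, t ≤ r → r < sInf S → γ r ∈ O := by
    intro r hr hrs
    by_contra hcon
    exact absurd (csInf_le hbdd ⟨hr, hcon⟩) (not_le.2 hrs)
  have hlt : t < sInf S := lt_of_le_of_ne hmem.1 fun h0 => hmem.2 (h0 ▸ ht)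
  refine ⟨sInf S, hlt, hmem.2, ?_, hbefore⟩
  have h1 : Tendsto γ (𝓝[<] (sInf S)) (𝓝 (γ (sInf S))) :=
    (hγ.tendsto _).mono_left nhdsWithin_le_nhds
  refine mem_closure_of_tendsto h1 ?_
  filter_upwards [Ico_mem_nhdsLT hlt] with r hr
  exact hbefore r hr.1 hr.2

variable {n : ℕ} {X : Type*} [TopologicalSpace X] [T2Space X]
  [ChartedSpace (EuclideanSpace ℝ (Fin n)) X]

/-- In a chart, the closed boxes around a point that are adapted to a splitting of the model space
into a line and a complement are compact and arbitrarily small. -/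
theorem exists_isCompact_box (p : EuclideanSpace ℝ (Fin n) →L[ℝ] ℝ) (w : EuclideanSpace ℝ (Fin n))
    {x : X} {N : Set X} (hN : N ∈ 𝓝 x) : ∃ ρ > 0, ∃ B ⊆ N, IsCompact B ∧ ∀ q, q ∈ B ↔
      q ∈ (extChartAt (𝓡 n) x).source ∧
        max |p (extChartAt (𝓡 n) x q - extChartAt (𝓡 n) x x)|
          ‖(extChartAt (𝓡 n) x q - extChartAt (𝓡 n) x x) -
            p (extChartAt (𝓡 n) x q - extChartAt (𝓡 n) x x) • w‖ ≤ ρ := by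
  set e := extChartAt (𝓡 n) x with he
  have hxs : x ∈ e.source := mem_extChartAt_source x
  have hsymm : ContinuousAt e.symm (e x) := continuousAt_extChartAt_symm x
  have hev : ∀ᶠ a in 𝓝 (e x), a ∈ e.target ∧ e.symm a ∈ N := by
    refine Filter.Eventually.and (extChartAt_target_mem_nhds (I := 𝓡 n) x) ?_
    refine hsymm.eventually (show N ∈ 𝓝 (e.symm (e x)) from ?_)
    rwa [e.left_inv hxs]
  obtain ⟨r, hr, hball⟩ := Metric.eventually_nhds_iff_ball.1 hev
  set ρ : ℝ := r / (2 * (1 + ‖w‖)) with hρ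
  set H : EuclideanSpace ℝ (Fin n) → ℝ := fun a => max |p (a - e x)| ‖(a - e x) - p (a - e x) • w‖
    with hH
  have hHc : Continuous H := by fun_prop
  have hsub : {a | H a ≤ ρ} ⊆ Metric.closedBall (e x) (r / 2) := by
    intro a ha
    rw [Metric.mem_closedBall, dist_eq_norm]
    have h1 : |p (a - e x)| ≤ ρ := (le_max_left _ _).trans ha
    have h2 : ‖(a - e x) - p (a - e x) • w‖ ≤ ρ := (le_max_right _ _).trans ha
    calc ‖a - e x‖ = ‖((a - e x) - p (a - e x) • w) + p (a - e x) • w‖ := by rw [sub_add_cancel]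
      _ ≤ ρ + ρ * ‖w‖ := by
        refine (norm_add_le _ _).trans (add_le_add h2 ?_)
        rw [norm_smul, Real.norm_eq_abs]
        gcongr
      _ = r / 2 := by
        rw [hρ]
        field_simp
  have hsub' : {a | H a ≤ ρ} ⊆ Metric.ball (e x) r :=
    hsub.trans (Metric.closedBall_subset_ball (half_lt_self hr))
  have hcpt : IsCompact {a | H a ≤ ρ} :=
    (isCompact_closedBall _ _).of_isClosed_subset (isClosed_le hHc continuous_const) hsub
  refine ⟨ρ, by positivity, e.symm '' {a | H a ≤ ρ}, ?_, ?_, fun q => ?_⟩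
  · rintro _ ⟨a, ha, rfl⟩
    exact (hball a (hsub' ha)).2
  · exact hcpt.image_of_continuousOn
      ((continuousOn_extChartAt_symm x).mono fun a ha => (hball a (hsub' ha)).1)
  · constructor
    · rintro ⟨a, ha, rfl⟩
      have h1 := (hball a (hsub' ha)).1
      refine ⟨e.map_target h1, ?_⟩
      rw [e.right_inv h1]
      exact ha
    · rintro ⟨hq, hle⟩
      exact ⟨e q, hle, e.left_inv hq⟩

variable [IsManifold (𝓡 n) ∞ X]
  [RiemannianBundle (fun x : X => TangentSpace (𝓡 n) x)]
  [IsContinuousRiemannianBundle (EuclideanSpace ℝ (Fin n)) (fun x : X => TangentSpace (𝓡 n) x)]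
  {f : (x : X) → TangentSpace (𝓡 n) x} {K : (x : X) → Set (TangentSpace (𝓡 n) x)}

namespace IsPositiveSystem

variable (h : IsPositiveSystem f K)
include h

omit [RiemannianBundle (fun x : X => TangentSpace (𝓡 n) x)]
  [IsContinuousRiemannianBundle (EuclideanSpace ℝ (Fin n)) (fun x : X => TangentSpace (𝓡 n) x)] in
/-- An orbit that comes close to an equilibrium stays close to it for a long time. -/
theorem eventually_forall_flow {x ξ : X} (hfx : f x = 0) {l : Filter ℝ}
    (hl : Tendsto (fun t => flow f t ξ) l (𝓝 x)) {Q : X → Prop} (hQ : ∀ᶠ q in 𝓝 x, Q q) (L : ℝ) :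
    ∀ᶠ t in l, ∀ s ∈ Icc t (t + L), Q (flow f s ξ) := by
  have h1 : ∀ᶠ q in 𝓝 x, ∀ s ∈ Icc 0 L, Q (flow f s q) := by
    refine isCompact_Icc.eventually_forall_of_forall_eventually fun s _ => ?_
    have hc : Continuous fun z : X × ℝ => flow f z.2 z.1 :=
      (continuous_flow h.contMDiff h.complete).comp continuous_swap
    refine (hc.tendsto (x, s)).eventually ?_
    rw [flow_of_eq_zero h.contMDiff h.complete hfx]
    exact hQ
  filter_upwards [hl.eventually h1] with t ht s hs
  have h2 := ht (s - t) ⟨by linarith [hs.1], by linarith [hs.2]⟩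
  rwa [← flow_add h.contMDiff h.complete, sub_add_cancel] at h2

/-- At an equilibrium `x` in a limit set that is not `{x}` and along which the field is transverse
to the Perron-Frobenius field, the Perron-Frobenius vector is expanded. Otherwise the
Perron-Frobenius direction dominates near `x`, and an orbit that approaches `x` and leaves again
does so along this direction. The limits of its late positions are equilibria, because there the
field is parallel to the Perron-Frobenius field. One of these equilibria lies halfway on the way
out, and the orbit cannot pass it, since domination preserves the order along the dominating
direction. -/
theorem exists_two_lt_pfGrowth {x ξ : X} (hx : x ∈ omegaLimit atTop (flow f) {ξ})
    (hne : omegaLimit atTop (flow f) {ξ} ≠ {x}) (hfx : f x = 0)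
    (htrans : ∀ y ∈ omegaLimit atTop (flow f) {ξ}, f y ≠ 0 →
      ∀ c : ℝ, f y ≠ c • perronFrobenius f K y) :
    ∃ t, 0 < t ∧ 2 < pfGrowth f K t x := by
  by_contra hcon
  push Not at hcon
  obtain ⟨τ, μ, p, N, hN⟩ := h.exists_isDominatedNhd hfx hcon
  have hτ := hN.tau_pos
  have hμ := hN.mu_pos
  set w : EuclideanSpace ℝ (Fin n) := coordVec x x (perronFrobenius f K x) with hw
  obtain ⟨x₂, hx₂, hx₂x⟩ : ∃ x₂ ∈ omegaLimit atTop (flow f) {ξ}, x₂ ≠ x := by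
    by_contra hall
    push Not at hall
    exact hne (Subset.antisymm hall (singleton_subset_iff.2 hx))
  obtain ⟨ρ, hρ, B, hBN', hB, hBmem⟩ := exists_isCompact_box p w
    (inter_mem (hN.isOpen.mem_nhds hN.mem) (isOpen_ne.mem_nhds hx₂x.symm : {q | q ≠ x₂} ∈ 𝓝 x))
  have hBN : B ⊆ N := hBN'.trans inter_subset_left
  set e := extChartAt (𝓡 n) x with he
  have hxs : x ∈ e.source := mem_extChartAt_source x
  have heo : IsOpen e.source := isOpen_extChartAt_source x
  have hBs : B ⊆ e.source := hBN.trans hN.subset_source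
  have hec : ∀ q ∈ e.source, ContinuousAt e q := fun q hq =>
    (continuousOn_extChartAt x).continuousAt (heo.mem_nhds hq)
  set H : X → ℝ := fun q => max |p (e q - e x)| ‖(e q - e x) - p (e q - e x) • w‖ with hH
  have hHc : ∀ q ∈ e.source, ContinuousAt H q := by
    intro q hq
    have h1 : Continuous fun a : EuclideanSpace ℝ (Fin n) =>
      max |p (a - e x)| ‖(a - e x) - p (a - e x) • w‖ := by fun_prop
    exact h1.continuousAt.comp (hec q hq)
  have hflow : ∀ s t q, flow f (s + t) q = flow f s (flow f t q) := flow_add h.contMDiff h.complete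
  have hfc : Continuous fun a : ℝ × X => flow f a.1 a.2 := continuous_flow h.contMDiff h.complete
  have hγ : Continuous fun t => flow f t ξ :=
    hfc.comp (by fun_prop : Continuous fun t : ℝ => (t, ξ))
  -- limits are taken along an ultrafilter of times at which the orbit approaches `x`
  rw [mem_omegaLimit_singleton_iff_mapClusterPt, mapClusterPt_iff_ultrafilter] at hx
  obtain ⟨U, hU, hUx⟩ := hx
  set O : Set X := e.source ∩ {q | H q < ρ} with hO
  have hOo : IsOpen O :=
    ContinuousOn.isOpen_inter_preimage (fun q hq => (hHc q hq).continuousWithinAt) heo isOpen_Iio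
  have hxO : x ∈ O := ⟨hxs, by simp [hH, hρ]⟩
  have hOB : O ⊆ B := fun q hq => (hBmem q).2 ⟨hq.1, hq.2.le⟩
  have hclO : closure O ⊆ B := closure_minimal hOB hB.isClosed
  have hexit : ∀ t, flow f t ξ ∈ O → ∃ s, t < s ∧ H (flow f s ξ) = ρ ∧
      ∀ r, t ≤ r → r ≤ s → flow f r ξ ∈ B := by
    intro t ht
    obtain ⟨s, hts, hs1, hs2, hs3⟩ := exists_exit_time hγ hOo ht (by
      rw [mem_omegaLimit_singleton_iff_mapClusterPt, mapClusterPt_iff_frequently] at hx₂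
      have h1 : Bᶜ ∈ 𝓝 x₂ := hB.isClosed.isOpen_compl.mem_nhds fun h0 => (hBN' h0).2 rfl
      obtain ⟨s, hs, hts⟩ := ((hx₂ _ h1).and_eventually (eventually_ge_atTop t)).exists
      exact ⟨s, hts, fun h0 => hs (hOB h0)⟩)
    refine ⟨s, hts, le_antisymm ((hBmem _).1 (hclO hs2)).2 ?_, fun r hr hrs => ?_⟩
    · by_contra hlt
      exact hs1 ⟨hBs (hclO hs2), not_le.1 hlt⟩
    · rcases hrs.lt_or_eq with h0 | rfl
      · exact hOB (hs3 r hr h0)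
      · exact hclO hs2
  choose! s hts hsH hsB using hexit
  have hevO : ∀ᶠ t in (U : Filter ℝ), flow f t ξ ∈ O := hUx.eventually (hOo.mem_nhds hxO)
  have hlong : ∀ L : ℝ, ∀ᶠ t in (U : Filter ℝ), t + L ≤ s t := by
    intro L
    filter_upwards [hevO, h.eventually_forall_flow hfx hUx (hOo.mem_nhds hxO) L] with t ht htL
    by_contra hlt
    have h1 := htL (s t) ⟨(hts t ht).le, (not_le.1 hlt).le⟩
    exact absurd (hsH t ht) h1.2.ne
  have hlimit : ∀ r : ℝ → ℝ, (∀ L : ℝ, ∀ᶠ t in (U : Filter ℝ), t + L ≤ r t) →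
      (∀ᶠ t in (U : Filter ℝ), r t ≤ s t) → ∃ y ∈ B, Tendsto (fun t => flow f (r t) ξ) U (𝓝 y) ∧
        f y = 0 ∧ ‖(e y - e x) - p (e y - e x) • w‖ ≤ |p (e y - e x)| := by
    intro r hrL hrs
    have hrB : ∀ L : ℝ, 0 ≤ L → ∀ᶠ t in (U : Filter ℝ), flow f (-L + r t) ξ ∈ B := by
      intro L hL
      filter_upwards [hevO, hrL L, hrs] with t ht h1 h2
      exact hsB t ht _ (by linarith) (by linarith)
    have h1 : (U.map fun t => flow f (r t) ξ : Filter X) ≤ 𝓟 B := by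
      have h2 := hrB 0 le_rfl
      simp only [neg_zero, zero_add] at h2
      exact le_principal_iff.2 h2
    obtain ⟨y, hyB, hy⟩ := hB.ultrafilter_le_nhds _ h1
    have hy : Tendsto (fun t => flow f (r t) ξ) U (𝓝 y) := hy
    have hyback : ∀ j : ℕ, flow f (-(j * τ)) y ∈ B := by
      intro j
      have h3 : Continuous (flow f (-(j * τ))) :=
        hfc.comp (by fun_prop : Continuous fun q : X => ((-(j * τ) : ℝ), q))
      refine hB.isClosed.mem_of_tendsto ((h3.tendsto y).comp hy) ?_
      filter_upwards [hrB (j * τ) (by positivity)] with t ht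
      change flow f _ (flow f _ ξ) ∈ B
      rwa [← hflow]
    have hyω : y ∈ omegaLimit atTop (flow f) {ξ} := by
      rw [mem_omegaLimit_singleton_iff_mapClusterPt]
      have hr : Tendsto r U atTop := by
        refine tendsto_atTop_mono' (f₁ := id) (U : Filter ℝ) ?_ (tendsto_id'.2 hU)
        exact (hrL 0).mono fun t ht => by simpa using ht
      exact (hy.mapClusterPt : MapClusterPt y U ((fun t => flow f t ξ) ∘ r)).of_comp hr
    refine ⟨y, hyB, hy, ?_, h.sub_mem_cone_of_backward hN hfx hB hBN hyback⟩
    by_contra hfy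
    obtain ⟨c, hc⟩ := h.exists_eq_smul_of_backward hN hB hBN hyback
    exact htrans y hyω hfy c hc
  -- the exit point, which determines the side `σ` on which the orbit leaves
  obtain ⟨y, hyB, hy, -, hycone⟩ := hlimit s hlong (Eventually.of_forall fun t => le_rfl)
  have hyH : H y = ρ := by
    have h1 : Tendsto (fun t => H (flow f (s t) ξ)) U (𝓝 (H y)) := (hHc y (hBs hyB)).tendsto.comp hy
    refine tendsto_nhds_unique (h1.congr' ?_) tendsto_const_nhds
    filter_upwards [hevO] with t ht
    exact hsH t ht
  have hyρ : |p (e y - e x)| = ρ := by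
    rw [← hyH, hH]
    exact (max_eq_left hycone).symm
  obtain ⟨σ, hσ⟩ : ∃ σ : ℝ, σ * p (e y - e x) = ρ := by
    rcases abs_choice (p (e y - e x)) with h0 | h0
    · exact ⟨1, by rw [one_mul, ← h0, hyρ]⟩
    · exact ⟨-1, by rw [neg_one_mul, ← h0, hyρ]⟩
  set u : X → ℝ := fun q => σ * p (e q - e x) with hu
  have huc : ∀ q ∈ e.source, ContinuousAt u q := by
    intro q hq
    have h1 : Continuous fun a : EuclideanSpace ℝ (Fin n) => σ * p (a - e x) := by fun_prop
    exact h1.continuousAt.comp (hec q hq)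
  have hux : u x = 0 := by simp [hu]
  have hnear : ∀ᶠ q in 𝓝 x, u q < ρ / 2 :=
    (huc x hxs).eventually_lt_const (by rw [hux]; exact half_pos hρ)
  have hfar : ∀ᶠ t in (U : Filter ℝ), ρ / 2 < u (flow f (s t) ξ) :=
    ((huc y (hBs hyB)).tendsto.comp hy).eventually_const_lt (by
      rw [hu]
      simp only [hσ]
      exact half_lt_self hρ)
  -- a time at which the orbit is halfway out
  have hhalf : ∀ t, flow f t ξ ∈ O → u (flow f t ξ) < ρ / 2 → ρ / 2 < u (flow f (s t) ξ) →
      ∃ r, t ≤ r ∧ r ≤ s t ∧ u (flow f r ξ) = ρ / 2 := by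
    intro t ht h1 h2
    have h3 : ContinuousOn (fun r => u (flow f r ξ)) (Icc t (s t)) := fun r hr =>
      ((huc _ (hBs (hsB t ht r hr.1 hr.2))).comp (f := fun r => flow f r ξ)
        hγ.continuousAt).continuousWithinAt
    obtain ⟨r, hr, hr'⟩ := intermediate_value_Icc (hts t ht).le h3 ⟨h1.le, h2.le⟩
    exact ⟨r, hr.1, hr.2, hr'⟩
  choose! r htr hrs hru using hhalf
  have hgood : ∀ᶠ t in (U : Filter ℝ), flow f t ξ ∈ O ∧ u (flow f t ξ) < ρ / 2 ∧
      ρ / 2 < u (flow f (s t) ξ) := hevO.and ((hUx.eventually hnear).and hfar)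
  obtain ⟨y', hyB', hy', hfy', hycone'⟩ := hlimit r (fun L => by
      filter_upwards [hgood, h.eventually_forall_flow hfx hUx hnear L] with t ht htL
      by_contra hlt
      have h1 := htL (r t) ⟨htr t ht.1 ht.2.1 ht.2.2, (not_le.1 hlt).le⟩
      exact absurd (hru t ht.1 ht.2.1 ht.2.2) h1.ne)
    (by filter_upwards [hgood] with t ht using hrs t ht.1 ht.2.1 ht.2.2)
  have huy' : u y' = ρ / 2 := by
    have h1 : Tendsto (fun t => u (flow f (r t) ξ)) U (𝓝 (u y')) :=
      (huc y' (hBs hyB')).tendsto.comp hy'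
    refine tendsto_nhds_unique (h1.congr' ?_) tendsto_const_nhds
    filter_upwards [hgood] with t ht
    exact hru t ht.1 ht.2.1 ht.2.2
  have hfix : ∀ t, flow f t y' = y' := flow_of_eq_zero h.contMDiff h.complete hfy'
  have hpy' : p (e y' - e x) ≠ 0 := by
    intro h0
    rw [hu] at huy'
    simp only [h0, mul_zero] at huy'
    linarith
  -- seen from the equilibrium `y'`, the orbit starts inside the cone, on the side of `x`
  have hstart : ∀ᶠ q in 𝓝 x, ‖(e q - e y') - p (e q - e y') • w‖ ≤ |p (e q - e y')| ∧
      σ * p (e q - e y') < 0 := by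
    have h1 := (hN.step_sub y' (hBN hyB') x hN.mem).norm_le hμ hycone'
    rw [hfix, flow_of_eq_zero h.contMDiff h.complete hfx] at h1
    have h2 : ‖(e x - e y') - p (e x - e y') • w‖ < |p (e x - e y')| := by
      have h3 : 0 < |p (e y' - e x)| := abs_pos.2 hpy'
      have h4 : e x - e y' = -(e y' - e x) := by abel
      rw [h4, map_neg, neg_smul, ← neg_sub', norm_neg, abs_neg]
      have h5 : ‖(e y' - e x) - p (e y' - e x) • w‖ ≤ 3 / 7 * |p (e y' - e x)| := h1
      linarith
    have h3 : σ * p (e x - e y') < 0 := by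
      have h4 : e x - e y' = -(e y' - e x) := by abel
      have h5 : σ * p (e y' - e x) = ρ / 2 := huy'
      rw [h4, map_neg, mul_neg, h5]
      linarith
    have hc1 : Continuous fun a : EuclideanSpace ℝ (Fin n) =>
      ‖(a - e y') - p (a - e y') • w‖ - |p (a - e y')| := by fun_prop
    have hc2 : Continuous fun a : EuclideanSpace ℝ (Fin n) => σ * p (a - e y') := by fun_prop
    have h4 : ∀ᶠ a in 𝓝 (e x), ‖(a - e y') - p (a - e y') • w‖ - |p (a - e y')| < 0 ∧
        σ * p (a - e y') < 0 :=
      (hc1.continuousAt.eventually_lt_const (sub_neg.2 h2)).and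
        (hc2.continuousAt.eventually_lt_const h3)
    filter_upwards [(hec x hxs).eventually h4] with q hq
    exact ⟨(sub_neg.1 hq.1).le, hq.2⟩
  obtain ⟨t, ⟨htO, -, hts2⟩, htstart⟩ :=
    (hgood.and (h.eventually_forall_flow hfx hUx hstart τ)).exists
  have hlen := (hts t htO).le
  set j := ⌊(s t - t) / τ⌋₊ with hj
  have hj1 : j * τ ≤ s t - t := by
    have := Nat.floor_le (div_nonneg (sub_nonneg.2 hlen) hτ.le)
    rwa [le_div_iff₀ hτ] at this
  have hj2 : s t - t < (j + 1) * τ := by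
    have := Nat.lt_floor_add_one ((s t - t) / τ)
    rwa [div_lt_iff₀ hτ] at this
  set s₀ := s t - j * τ with hs₀
  have hsteps : ∀ i : ℕ, i ≤ j →
      ‖(e (flow f (s₀ + i * τ) ξ) - e y') - p (e (flow f (s₀ + i * τ) ξ) - e y') • w‖ ≤
        |p (e (flow f (s₀ + i * τ) ξ) - e y')| ∧
      σ * p (e (flow f (s₀ + i * τ) ξ) - e y') < 0 := by
    intro i
    induction i with
    | zero =>
      intro _
      rw [Nat.cast_zero, zero_mul, add_zero]
      exact htstart s₀ ⟨by linarith, by linarith⟩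
    | succ i ih =>
      intro hi
      obtain ⟨h1, h2⟩ := ih (by omega)
      have hij : (i : ℝ) * τ ≤ j * τ := by
        gcongr
        omega
      have hi0 : 0 ≤ (i : ℝ) * τ := by positivity
      have h3 := hN.step_sub _ (hBN (hsB t htO (s₀ + i * τ) (by linarith) (by linarith)))
        y' (hBN hyB')
      rw [hfix, ← hflow, show τ + (s₀ + i * τ) = s₀ + (i + 1 : ℕ) * τ by push_cast; ring] at h3
      have h4 := h3.norm_le hμ h1
      exact ⟨h4.trans (by linarith [abs_nonneg (p (e (flow f (s₀ + (i + 1 : ℕ) * τ) ξ) - e y'))]),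
        h3.mul_neg hμ h1 h2⟩
  have hend := (hsteps j le_rfl).2
  rw [hs₀, sub_add_cancel] at hend
  have h1 : u (flow f (s t) ξ) = σ * p (e (flow f (s t) ξ) - e y') + u y' := by
    rw [hu]
    simp only [map_sub]
    ring
  linarith

end IsPositiveSystem

end LimitSet

/-! ### Limit sets transverse to the Perron-Frobenius field -/

section Transverse

variable {n : ℕ} {X : Type*} [TopologicalSpace X] [T2Space X]
  [ChartedSpace (EuclideanSpace ℝ (Fin n)) X] [IsManifold (𝓡 n) ∞ X]
  [RiemannianBundle (fun x : X => TangentSpace (𝓡 n) x)]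
  [IsContinuousRiemannianBundle (EuclideanSpace ℝ (Fin n)) (fun x : X => TangentSpace (𝓡 n) x)]
  {f : (x : X) → TangentSpace (𝓡 n) x} {K : (x : X) → Set (TangentSpace (𝓡 n) x)}

/-- Over a transverse limit set that is not a point, every Perron-Frobenius vector is expanded at
some time. If the field tends to zero along the orbit of `x`, the limit set of `x` consists of
equilibria, where the Perron-Frobenius vectors are expanded; the expansion carries over to `x`. -/
theorem IsPositiveSystem.exists_two_lt_of_isTransverseLimitSet (h : IsPositiveSystem f K) {ξ : X}
    (hξ : IsTransverseLimitSet f K (omegaLimit atTop (flow f) {ξ}))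
    (hξ' : ∀ p : X, omegaLimit atTop (flow f) {ξ} ≠ {p}) {C : Set X} (hC : IsCompact C)
    (hξC : ∀ t, 0 ≤ t → flow f t ξ ∈ C) {x : X} (hx : x ∈ omegaLimit atTop (flow f) {ξ}) :
    ∃ t, 0 < t ∧ 2 < pfGrowth f K t x := by
  rcases (hξ x hx).2 with hG | hf0
  · exact hG.exists_two_lt
  have hxC : ∀ t, 0 ≤ t → flow f t x ∈ C := fun t _ =>
    omegaLimit_singleton_subset h.toFlow hC hξC (omegaLimit_singleton_invariant h.toFlow hx t)
  have hsub : omegaLimit atTop (flow f) {x} ⊆ omegaLimit atTop (flow f) {ξ} :=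
    omegaLimit_singleton_subset_of_mem h.toFlow hx
  have hG := h.tendsto_pfGrowth hC hxC fun y hy => by
    refine h.exists_two_lt_pfGrowth (hsub hy) (hξ' y) ?_ fun q hq => (hξ q hq).1
    rw [mem_omegaLimit_singleton_iff_mapClusterPt, mapClusterPt_iff_ultrafilter] at hy
    obtain ⟨U, hU, hUy⟩ := hy
    have hUy : Tendsto (fun t => flow f t x) U (𝓝 y) := hUy
    have h1 := (continuous_norm_tangentBundle.tendsto _).comp
      ((h.contMDiff.continuous.tendsto y).comp hUy)
    exact norm_eq_zero.1 (tendsto_nhds_unique h1 (hf0.mono_left hU))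
  exact ((eventually_gt_atTop 0).and (hG.eventually_gt_atTop 2)).exists

end Transverse

theorem mainTheorem8 {n : ℕ} {X : Type*} [MetricSpace X] [CompleteSpace X]
    [SecondCountableTopology X] [ConnectedSpace X]
    [ChartedSpace (EuclideanSpace ℝ (Fin n)) X] [IsManifold (𝓡 n) ∞ X]
    [RiemannianBundle (fun x : X => TangentSpace (𝓡 n) x)]
    [IsContMDiffRiemannianBundle (𝓡 n) ∞ (EuclideanSpace ℝ (Fin n))
      (fun x : X => TangentSpace (𝓡 n) x)]
    [IsRiemannianManifold (𝓡 n) X]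
    (f : (x : X) → TangentSpace (𝓡 n) x)
    (hf : ContMDiff (𝓡 n) (𝓡 n).tangent 2 (fun x => (⟨x, f x⟩ : TangentBundle (𝓡 n) X)))
    (hcomplete : IsCompleteField f)
    (hbounded : ∀ x : X, Bornology.IsBounded ((fun t : ℝ => flow f t x) '' Ici 0))
    (K : (x : X) → Set (TangentSpace (𝓡 n) x)) (hK : IsSmoothConeField K)
    (hpos : IsStrictlyDifferentiallyPositive f K)
    (hHilbert : ∀ x : X, IsHilbertComplete (K x) (K x ∩ {v | ‖v‖ = 1}))
    (ξ : X) (hξ : IsTransverseLimitSet f K (omegaLimit atTop (flow f) {ξ}))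
    (hξ' : ∀ p : X, omegaLimit atTop (flow f) {ξ} ≠ {p})
    (z : X) (hz : omegaLimit atTop (flow f) {z} ⊆ omegaLimit atTop (flow f) {ξ}) :
    (∀ t : ℝ, 0 ≤ t → f (flow f t z) ∉ K (flow f t z) \ {0}) ∧
    ((∀ p : X, omegaLimit atTop (flow f) {z} ≠ {p}) → HasUnboundedPFGrowth f K z) := by
  have : ProperSpace X := properSpace_of_isRiemannianManifold n X
  rcases Nat.eq_zero_or_pos n with rfl | hn
  · -- a manifold of dimension zero has no limit set other than a point
    have hsub : ∀ x : X, Subsingleton (TangentSpace (𝓡 0) x) := fun x =>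
      inferInstanceAs (Subsingleton (EuclideanSpace ℝ (Fin 0)))
    have hflow : ∀ t x, flow f t x = x := fun t x =>
      flow_of_eq_zero hf hcomplete (Subsingleton.elim _ _) t
    refine absurd ?_ (hξ' ξ)
    ext y
    rw [mem_omegaLimit_singleton_iff_mapClusterPt, mem_singleton_iff]
    simp only [hflow]
    refine ⟨fun hy => ?_, ?_⟩
    · obtain ⟨U, -, hUy⟩ := mapClusterPt_iff_ultrafilter.1 hy
      exact tendsto_nhds_unique hUy tendsto_const_nhds
    · rintro rfl
      exact tendsto_const_nhds.mapClusterPt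
  have : IsContinuousRiemannianBundle (EuclideanSpace ℝ (Fin n))
      (fun x : X => TangentSpace (𝓡 n) x) := by
    obtain ⟨g, hg, hgi⟩ := IsContMDiffRiemannianBundle.exists_contMDiff (IB := 𝓡 n) (n := ∞)
      (F := EuclideanSpace ℝ (Fin n)) (E := fun x : X => TangentSpace (𝓡 n) x)
    exact ⟨g, hg.continuous, hgi⟩
  have h : IsPositiveSystem f K := ⟨hf, hcomplete, hK, hpos, hn⟩
  have horbit : ∀ x : X, ∃ C : Set X, IsCompact C ∧ ∀ t, 0 ≤ t → flow f t x ∈ C := fun x =>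
    ⟨_, (hbounded x).isCompact_closure, fun t ht => subset_closure (mem_image_of_mem _ ht)⟩
  obtain ⟨C, hC, hξC⟩ := horbit ξ
  have hgrow : ∀ p : X, omegaLimit atTop (flow f) {p} ⊆ omegaLimit atTop (flow f) {ξ} →
      Tendsto (fun t => pfGrowth f K t p) atTop atTop := by
    intro p hp
    obtain ⟨C', hC', hpC'⟩ := horbit p
    exact h.tendsto_pfGrowth hC' hpC' fun y hy =>
      h.exists_two_lt_of_isTransverseLimitSet hξ hξ' hC hξC (hp hy)
  refine ⟨fun t _ => ?_, fun _ => hasUnboundedPFGrowth_of_tendsto (hgrow z hz)⟩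
  obtain ⟨C', hC', hC''⟩ := horbit (flow f t z)
  refine h.notMem_of_tendsto_pfGrowth hC' hC'' (hgrow _ (Subset.trans ?_ hz))
  have h1 := h.toFlow.omegaLimit_image_subset atTop {z} t
    (tendsto_atTop_add_const_right _ t tendsto_id)
  rwa [image_singleton] at h1
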